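/- **Setting.** Let $X$ and $A$ be finite nonempty state and action spaces, where $X$ is partitioned into nonempty layers $X_0,\dots,X_L$ ($L\ge 1$), $X_0=\{x_0\}$ and $X_L=\{x_L\}$; $k(x)$ is the index of the layer of $x$. A transition function $P$ gives, for $x\in X_k$, $k<L$, and $a\in A$, a probability distribution $P(\cdot\mid x,a)$ on $X_{k+1}$. For a policy $\pi$ let $q^{P,\pi}(x,a,x')=\Pr[x_k=x,a_k=a,x_{k+1}=x'\mid P,\pi]$ for $x\in X_k$, $k<L$, and let $q^{P,\pi}(x,a)=\sum_{x'}q^{P,\pi}(x,a,x')$ (zero for $x=x_L$). Occupancy measures are regarded as vectors in $\mathbb R^{X\times A}$. For a set $\mathcal P$ of transition functions, $\Delta(\mathcal P)\subset\mathbb R^{X\times A}$ is the set of all $q^{P',\pi}$ with $P'\in\mathcal P$ and $\pi$ a policy; $\Delta(M)=\Delta(\{P\})$ for the true, unknown $P$. In each episode $t=1,\dots,T$ the learner plays a policy $\pi_t$; given the losses and trajectories of the previous episodes, the trajectory $(x_0,a_0,\dots,a_{L-1},x_L)$ is generated by $P$ and $\pi_t$, and then it and a loss vector $\ell_t\in\mathbb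 R^{X\times A}$ are revealed. The losses are arbitrary random vectors (fixed, stochastic, or chosen by an adversary who may react to the past). Write $q_t=q^{P,\pi_t}$, $\overline\ell_{t_1,t_2}=\max_{t_1\le t\le t_2}\|\ell_t\|_\infty$, $\overline\ell_t=\overline\ell_{1,t}$, and $R^{\mathsf P}_{t_1,t_2}(q)=\sum_{t=t_1}^{t_2}\ell_t^\top(q_t-q)$. **Algorithm UC-O-GDPS** (parameters $T$, $\delta\in(0,1]$, $C>0$). Start in epoch $i=1$ with $\mathcal P_1$ the set of all transition functions, all counters zero, and $\widehat q_1(x,a,x')=\frac1{|X_k||A||X_{k+1}|}$ for $x\in X_k$, $x'\in X_{k+1}$, $k<L$. In episode $t$ play $\pi_t(a\mid x)=\widehat q_t(x,a)/\sum_b\widehat q_t(x,b)$ (uniform if the denominator is zero), and count the visits of all $(x,a)$ and $(x,a,x')$. If, after episode $t$, some $(x_k,a_k)$ on its trajectory has been visited in total at least $\max\{1,2N_i(x_k,a_k)\}$ times, where $N_i(x,a)$ and $M_i(x'\mid x,a)$ are the numbers of visits before epoch $i$, start a new epoch, $i\leftarrow i+1$, with confidence set $$\mathcal P_i=\Big\{\widehat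 P:\ \Big\|\widehat P(\cdot\mid x,a)-\tfrac{M_i(\cdot\mid x,a)}{\max\{1,N_i(x,a)\}}\Big\|_1\le\sqrt{\tfrac{2|X_{k(x)+1}|\ln(T|X||A|/\delta)}{\max\{1,N_i(x,a)\}}}\quad\forall (x,a)\in X\times A\Big\},$$ where $\widehat P$ ranges over transition functions. Then set $\widehat q_{t+1}=\Pi_{\Delta(\mathcal P_i)}(\widehat q_t-\eta_t\ell_t)$ with $\eta_t=(\overline\ell_t C\sqrt T)^{-1}$ and $\Pi$ the Euclidean projection in $\mathbb R^{X\times A}$ (if $\overline\ell_t=0$ then $\ell_t=0$ and the value of $\eta_t$ is irrelevant). **Theorem.** Let $\mathcal E^q_\delta=4L|X|\sqrt{2T\ln(1/\delta)}+6L|X|\sqrt{2T|A|\ln(T|X||A|/\delta)}$. With probability at least $1-2\delta$, UC-O-GDPS satisfies simultaneously for all $1\le t_1\le t_2\le T$ and all $q\in\bigcap_i\Delta(\mathcal P_i)$ (the intersection over the epochs $i$ of the episodes $1,\dots,T$) $$R^{\mathsf P}_{t_1,t_2}(q)\le\overline\ell_{t_1,t_2}\,\mathcal E^q_\delta+\overline\ell_{t_2}LC\sqrt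 T+\overline\ell_{t_1,t_2}\frac{|X||A|}{2}\,\frac{t_2-t_1+1}{C\sqrt T}.$$ In particular, UC-O-GDPS has the weak no-interval-regret property: there are constants $K$ and $p$ that depend only on $X$ (with its layers), $A$, $L$ and $C$, such that for all $T$, $\delta\in(0,1]$, $P$ and losses, with probability at least $1-2\delta$, $R^{\mathsf P}_{t_1,t_2}(q)\le K\,\overline\ell_T\,\sqrt T\,(1+\ln(T/\delta))^p$ for all $1\le t_1\le t_2\le T$ and all $q\in\Delta(M)$. -/

import Mathlib

open MeasureTheory
open scoped NNReal

universe u v w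

namespace LoopFreeMDP

/-- The layers of a loop-free state space: `X` is partitioned into the nonempty layers
`X_0, …, X_L`, the first and the last of which are singletons. -/
structure Layering (X : Type u) (L : ℕ) where
  layer : X → ℕ
  layer_le : ∀ x, layer x ≤ L
  pos : 0 < L
  layer_nonempty : ∀ k ≤ L, ∃ x, layer x = k
  first_unique : ∃! x, layer x = 0
  last_unique : ∃! x, layer x = L

/-- The trajectory `x_0, a_0, x_1, …, a_{L-1}, x_L` of one episode. -/
@[ext]
structure Trajectory (X : Type u) (A : Type v) (L : ℕ) where
  state : Fin (L + 1) → X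
  action : Fin L → A

/-- A trajectory is a pair of finite tuples. -/
def Trajectory.equivProd (X : Type u) (A : Type v) (L : ℕ) :
    (Fin (L + 1) → X) × (Fin L → A) ≃ Trajectory X A L where
  toFun p := ⟨p.1, p.2⟩
  invFun τ := (τ.state, τ.action)
  left_inv _ := rfl
  right_inv _ := rfl

instance (X : Type u) (A : Type v) (L : ℕ) [Fintype X] [Fintype A] [DecidableEq X]
    [DecidableEq A] : Fintype (Trajectory X A L) :=
  Fintype.ofEquiv _ (Trajectory.equivProd X A L)

instance (X : Type u) (A : Type v) (L : ℕ) : MeasurableSpace (Trajectory X A L) := ⊤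

section Model

variable {X : Type u} {A : Type v} {L : ℕ} [Fintype X] [DecidableEq X] [Fintype A] [DecidableEq A]

/-- The layer `X_k`. -/
def Layering.layerSet (Λ : Layering X L) (k : ℕ) : Finset X :=
  Finset.univ.filter fun x => Λ.layer x = k

/-- `P x a x'` is `P(x' | x, a)`: from a state of layer `k < L` it is a probability distribution
on layer `k + 1`, and all the other values vanish. -/
structure IsTransition (Λ : Layering X L) (P : X → A → X → ℝ) : Prop where
  nonneg : ∀ x a x', 0 ≤ P x a x'
  sum_eq_one : ∀ x a, Λ.layer x < L → ∑ x', P x a x' = 1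
  next_layer : ∀ x a x', 0 < P x a x' → Λ.layer x' = Λ.layer x + 1

/-- `π x a` is `π(a | x)`. -/
structure IsPolicy (π : X → A → ℝ) : Prop where
  nonneg : ∀ x a, 0 ≤ π x a
  sum_eq_one : ∀ x, ∑ a, π x a = 1

/-- The probability of a trajectory that starts in the state of layer `0` and is generated by
`a_k ∼ π(· | x_k)`, `x_{k+1} ∼ P(· | x_k, a_k)`. -/
def trajProb (Λ : Layering X L) (P : X → A → X → ℝ) (π : X → A → ℝ) (τ : Trajectory X A L) : ℝ :=
  (if Λ.layer (τ.state 0) = 0 then 1 else 0) *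
    ∏ k : Fin L, (π (τ.state k.castSucc) (τ.action k) *
      P (τ.state k.castSucc) (τ.action k) (τ.state k.succ))

/-- `q^{P,π}(x, a, x') = Pr[x_k = x, a_k = a, x_{k+1} = x' | P, π]` for `x` in layer `k`. -/
def occTriple (Λ : Layering X L) (P : X → A → X → ℝ) (π : X → A → ℝ) (x : X) (a : A) (x' : X) : ℝ :=
  ∑ τ : Trajectory X A L,
    if ∃ k : Fin L, (k : ℕ) = Λ.layer x ∧ τ.state k.castSucc = x ∧ τ.action k = a ∧
      τ.state k.succ = x' then trajProb Λ P π τ else 0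

/-- The occupancy measure vector `q^{P,π}(x, a) = ∑_{x'} q^{P,π}(x, a, x')`. -/
noncomputable def occ (Λ : Layering X L) (P : X → A → X → ℝ) (π : X → A → ℝ) :
    EuclideanSpace ℝ (X × A) :=
  WithLp.toLp 2 fun p => ∑ x', occTriple Λ P π p.1 p.2 x'

/-- `Δ(Ps)`: the occupancy measure vectors of the policies under the transition functions in `Ps`.
For `Ps = {P}` this is the set `Δ(M)` of valid occupancy measures. -/
def occSet (Λ : Layering X L) (Ps : Set (X → A → X → ℝ)) : Set (EuclideanSpace ℝ (X × A)) :=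
  {q | ∃ P ∈ Ps, ∃ π, IsPolicy π ∧ q = occ Λ P π}

/-- The policy `π^q(a | x) = q(x, a) / q(x)`, uniform in the states with `q(x) = 0`. -/
noncomputable def inducedPolicy (q : EuclideanSpace ℝ (X × A)) (x : X) (a : A) : ℝ :=
  if ∑ b, q (x, b) = 0 then 1 / (Fintype.card A : ℝ) else q (x, a) / ∑ b, q (x, b)

/-- What is revealed over the past episodes, oldest first. -/
abbrev History (X : Type u) (A : Type v) (L : ℕ) : Type (max u v) :=
  List (Trajectory X A L × (X × A → ℝ))

/-- An online optimizer knows `T` and `δ` and maps the past to the policy of the next episode. -/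
abbrev Optimizer (X : Type u) (A : Type v) (L : ℕ) : Type (max u v) :=
  ℕ → ℝ → History X A L → X → A → ℝ

/-- The history before episode `n`; episodes are numbered `0, …, T - 1`. -/
def history {Ω : Type w} (traj : ℕ → Ω → Trajectory X A L) (loss : ℕ → Ω → X × A → ℝ)
    (n : ℕ) (ω : Ω) : History X A L :=
  (List.range n).map fun i => (traj i ω, loss i ω)

/-- The σ-algebra generated by the trajectories and losses of the episodes before `n`. -/
abbrev past {Ω : Type w} (traj : ℕ → Ω → Trajectory X A L) (loss : ℕ → Ω → X × A → ℝ) (n : ℕ) :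
    MeasurableSpace Ω :=
  MeasurableSpace.comap (fun ω (i : Fin n) => (traj i ω, loss i ω)) inferInstance

/-- The optimizer interacts for `T` episodes with an MDP with transition function `P`: given the
past, the trajectory of an episode is generated by `P` and the policy that the optimizer has chosen.
The losses are arbitrary real random vectors: fixed in advance, stochastic, or chosen by
an adversary who knows the past. -/
structure IsInteraction (Λ : Layering X L) (P : X → A → X → ℝ) (π : History X A L → X → A → ℝ)
    (T : ℕ) {Ω : Type w} [MeasurableSpace Ω] (μ : Measure Ω)
    (traj : ℕ → Ω → Trajectory X A L) (loss : ℕ → Ω → X × A → ℝ) : Prop where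
  measurable_traj : ∀ n < T, Measurable (traj n)
  measurable_loss : ∀ n < T, Measurable (loss n)
  condLaw : ∀ n < T, ∀ τ : Trajectory X A L,
    μ[({ω | traj n ω = τ} : Set Ω).indicator (fun _ => (1 : ℝ)) | past traj loss n]
      =ᵐ[μ] fun ω => trajProb Λ P (π (history traj loss n ω)) τ

/-- `ℓ̄_{t₁,t₂} = max_{t₁ ≤ t ≤ t₂} ‖ℓ_t‖_∞` (the norm on `X × A → ℝ` is the supremum norm). -/
noncomputable def lossMax (ℓ : ℕ → X × A → ℝ) (t₁ t₂ : ℕ) : ℝ :=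
  ((Finset.Icc t₁ t₂).sup fun t => ‖ℓ t‖₊ : ℝ≥0)

/-- The interval regret `∑_{t=t₁}^{t₂} ℓ_tᵀ (q_t - q)`. -/
noncomputable def intervalRegret (ℓ : ℕ → X × A → ℝ) (qs : ℕ → EuclideanSpace ℝ (X × A))
    (t₁ t₂ : ℕ) (q : EuclideanSpace ℝ (X × A)) : ℝ :=
  ∑ t ∈ Finset.Icc t₁ t₂, ∑ p, ℓ t p * (qs t p - q p)

/-- The occupancy measures `q_t = q^{P,π_t}` of the policies that an optimizer plays. -/
noncomputable def played (Λ : Layering X L) (P : X → A → X → ℝ) (π : History X A L → X → A → ℝ)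
    {Ω : Type w} (traj : ℕ → Ω → Trajectory X A L) (loss : ℕ → Ω → X × A → ℝ) (ω : Ω) (t : ℕ) :
    EuclideanSpace ℝ (X × A) :=
  occ Λ P (π (history traj loss t ω))

/-- Weak no-interval regret: with probability at least `1 - 2δ` the regret on every interval and
against every valid occupancy measure is at most `√T`, up to the scale of the losses, a power of
`1 + log (T / δ)`, and a constant that depends on the state and action spaces and the optimizer,
but not on `T`, `δ`, the transition function, the losses, or the probability space. -/
def WeakNoIntervalRegret (Λ : Layering X L) (alg : Optimizer X A L) : Prop :=
  ∃ (K : ℝ) (p : ℕ), ∀ (T : ℕ) (δ : ℝ), 0 < δ → δ ≤ 1 →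
    ∀ P : X → A → X → ℝ, IsTransition Λ P →
    ∀ (Ω : Type w) [MeasurableSpace Ω] (μ : Measure Ω) [IsProbabilityMeasure μ]
      (traj : ℕ → Ω → Trajectory X A L) (loss : ℕ → Ω → X × A → ℝ),
      IsInteraction Λ P (alg T δ) T μ traj loss →
      ∃ E : Set Ω, MeasurableSet E ∧ 1 - 2 * δ ≤ μ.real E ∧
        ∀ ω ∈ E, ∀ t₁ t₂ : ℕ, t₁ ≤ t₂ → t₂ < T → ∀ q ∈ occSet Λ {P},
          intervalRegret (fun t => loss t ω) (played Λ P (alg T δ) traj loss ω) t₁ t₂ q ≤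
            K * lossMax (fun t => loss t ω) 0 (T - 1) * √T * (1 + Real.log (T / δ)) ^ p

/-- The Euclidean projection of `y` on `S`. -/
noncomputable def euclProj (S : Set (EuclideanSpace ℝ (X × A))) (y : EuclideanSpace ℝ (X × A)) :
    EuclideanSpace ℝ (X × A) :=
  Classical.epsilon fun z => z ∈ S ∧ ∀ z' ∈ S, dist y z ≤ dist y z'

/-- The memory of UC-O-GDPS between two episodes. -/
structure UCState (X : Type u) (A : Type v) where
  /-- the index of the current epoch -/
  epoch : ℕ
  /-- the number of visits of `(x, a)` so far -/
  visits : X → A → ℕ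
  /-- the number of visits of `(x, a, x')` so far -/
  visits' : X → A → X → ℕ
  /-- the number of visits of `(x, a)` before the current epoch -/
  initVisits : X → A → ℕ
  /-- the number of visits of `(x, a, x')` before the current epoch -/
  initVisits' : X → A → X → ℕ
  /-- the largest `‖ℓ_τ‖_∞` so far -/
  maxLoss : ℝ
  /-- the current occupancy measure `q̂_t` -/
  qhat : EuclideanSpace ℝ (X × A)

/-- The empirical transition function at the beginning of the current epoch. -/
noncomputable def UCState.empirical (s : UCState X A) (x : X) (a : A) (x' : X) : ℝ :=
  (s.initVisits' x a x' : ℝ) / max 1 (s.initVisits x a : ℝ)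

/-- The confidence radius `√(2 |X_{k(x)+1}| ln(T|X||A|/δ) / max {1, N(x, a)})`. -/
noncomputable def UCState.radius (Λ : Layering X L) (T : ℕ) (δ : ℝ) (s : UCState X A)
    (x : X) (a : A) : ℝ :=
  √(2 * ((Λ.layerSet (Λ.layer x + 1)).card : ℝ) *
      Real.log ((T : ℝ) * Fintype.card X * Fintype.card A / δ) / max 1 (s.initVisits x a : ℝ))

/-- The confidence set of the current epoch; in the first epoch, all transition functions. -/
def UCState.confSet (Λ : Layering X L) (T : ℕ) (δ : ℝ) (s : UCState X A) : Set (X → A → X → ℝ) :=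
  {P | IsTransition Λ P ∧
    (s.epoch ≠ 1 → ∀ x a, ∑ x', |P x a x' - s.empirical x a x'| ≤ s.radius Λ T δ x a)}

/-- The initialization, with `q̂_1(x, a, x') = 1 / (|X_k| |A| |X_{k+1}|)`. -/
noncomputable def UCState.init (Λ : Layering X L) : UCState X A where
  epoch := 1
  visits _ _ := 0
  visits' _ _ _ := 0
  initVisits _ _ := 0
  initVisits' _ _ _ := 0
  maxLoss := 0
  qhat := WithLp.toLp 2 fun p => ∑ _x' ∈ Λ.layerSet (Λ.layer p.1 + 1),
    1 / (((Λ.layerSet (Λ.layer p.1)).card : ℝ) * Fintype.card A *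
      (Λ.layerSet (Λ.layer p.1 + 1)).card)

/-- The part of the update that concerns the counters, the epoch and the maximal loss. -/
noncomputable def UCState.count (s : UCState X A) (τ : Trajectory X A L) (ℓ : X × A → ℝ) :
    UCState X A :=
  let N : X → A → ℕ := fun x a => s.visits x a +
    (Finset.univ.filter fun k : Fin L => τ.state k.castSucc = x ∧ τ.action k = a).card
  let M : X → A → X → ℕ := fun x a x' => s.visits' x a x' +
    (Finset.univ.filter fun k : Fin L =>
      τ.state k.castSucc = x ∧ τ.action k = a ∧ τ.state k.succ = x').card
  let newEpoch : Prop := ∃ k : Fin L, max 1 (2 * s.initVisits (τ.state k.castSucc) (τ.action k)) ≤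
    N (τ.state k.castSucc) (τ.action k)
  { epoch := if newEpoch then s.epoch + 1 else s.epoch
    visits := N
    visits' := M
    initVisits := if newEpoch then N else s.initVisits
    initVisits' := if newEpoch then M else s.initVisits'
    maxLoss := max s.maxLoss ‖ℓ‖
    qhat := s.qhat }

/-- One update of UC-O-GDPS. With the step size `η_t = 1 / (ℓ̄_t C √T)`, the new occupancy measure is
the projection of `q̂_t - η_t ℓ_t` on `Δ(𝒫_i)` for the current confidence set `𝒫_i`. (If `ℓ̄_t = 0`,
then `ℓ_t = 0` and the value of `η_t` does not matter.) -/
noncomputable def UCState.update (Λ : Layering X L) (C : ℝ) (T : ℕ) (δ : ℝ) (s : UCState X A)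
    (o : Trajectory X A L × (X × A → ℝ)) : UCState X A :=
  let s' := s.count o.1 o.2
  { s' with
    qhat := euclProj (occSet Λ (s'.confSet Λ T δ))
      (s.qhat - (1 / (s'.maxLoss * C * √T)) • WithLp.toLp 2 o.2) }

/-- The memory of UC-O-GDPS after the history `h`. -/
noncomputable def ucState (Λ : Layering X L) (C : ℝ) (T : ℕ) (δ : ℝ) (h : History X A L) :
    UCState X A :=
  h.foldl (UCState.update Λ C T δ) (UCState.init Λ)

/-- UC-O-GDPS with the step size constant `C` plays the policy induced by `q̂_t`. -/
noncomputable def ucogdps (Λ : Layering X L) (C : ℝ) : Optimizer X A L :=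
  fun T δ h => inducedPolicy (ucState Λ C T δ h).qhat

/-- `⋂_i Δ(𝒫_i)`, over the epochs `i` of the episodes `0, …, T - 1`. -/
def commonPolytope (Λ : Layering X L) (C : ℝ) (T : ℕ) (δ : ℝ) {Ω : Type w}
    (traj : ℕ → Ω → Trajectory X A L) (loss : ℕ → Ω → X × A → ℝ) (ω : Ω) :
    Set (EuclideanSpace ℝ (X × A)) :=
  {q | ∀ n < T, q ∈ occSet Λ ((ucState Λ C T δ (history traj loss n ω)).confSet Λ T δ)}

end Model

/-- `ℰ^q_δ = 4L|X|√(2T ln(1/δ)) + 6L|X|√(2T|A| ln(T|X||A|/δ))`. -/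
noncomputable def estimationError (X : Type u) (A : Type v) [Fintype X] [Fintype A]
    (L T : ℕ) (δ : ℝ) : ℝ :=
  4 * L * Fintype.card X * √(2 * T * Real.log (1 / δ)) +
    6 * L * Fintype.card X *
      √(2 * T * Fintype.card A * Real.log ((T : ℝ) * Fintype.card X * Fintype.card A / δ))

end LoopFreeMDP

/-! Write `q_t - q = (q_t - q̂_t) + (q̂_t - q)`, where `q̂_t` is the iterate and `q_t` the occupancy
measure that its policy has under the true `P`.

The second part is online gradient descent. A comparator in all the sets `Δ(𝒫_i)` never gets further
away by a projection, even though the set changes between epochs: each `Δ(𝒫_i)` is convex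
(`convex_occSet_confSet`) and compact, so `norm_euclProj_sub_le` applies. As the step sizes do not
increase, the telescoping argument can start at any episode (`sum_inner_le_of_descent`). Squared
distances are at most `2L`, and one of the two factors `‖ℓ_t‖_∞` in the gradient term cancels
against the scale in the step size (`sum_loss_qhat_sub_le`).

For the first part, `q̂_t` is the occupancy measure of the played policy under some `P'` in the
current confidence set. If `P` is in that set as well, the `ℓ¹` distance of `q_t` and `q̂_t` is at
most `L` times the expected sum of confidence widths along a trajectory (`sum_abs_occ_sub_le`). The
widths on the observed trajectories sum to order `√T`, because counts at most double in an epoch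
(`sum_confWidth_visited_le`). These bounds cover all episodes at once and have nonnegative terms, so
every interval inherits them.

Two events of probability at least `1 - δ` are needed: `P` lies in all confidence sets, and the
expected widths are close to the observed ones. Both follow from Markov's inequality for products of
exponentials with conditional expectation at most `1` (`IsInteraction.measureReal_prod_ge_le`), the
conditional bounds being Hoeffding's lemma. For the first event the product is truncated after a
fixed number of visits of a pair, and a union bound runs over pairs, visit numbers and sign
patterns.

On the first event `Δ(M)` is contained in the intersection of the `Δ(𝒫_i)`, which gives weak
no-interval regret. -/

namespace LoopFreeMDP

/-! ### Path sums of chains with time-dependent weights -/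

section Chain

variable {X : Type u} {A : Type v} [Fintype X] [Fintype A]

/-- The mass that a chain with initial weights `w` and step weights `K` has in a state after `n`
steps. -/
def chainMass (w : X → ℝ) (K : ℕ → X → A → X → ℝ) : ℕ → X → ℝ
  | 0 => w
  | n + 1 => fun x' => ∑ x, ∑ a, chainMass w K n x * K n x a x'

/-- Induction on the length, peeling off the last step. The test function `φ` is there for the
induction: the peeled step is absorbed into it. -/
lemma sum_paths_eq_chainMass [DecidableEq X] [DecidableEq A] (w : X → ℝ) (K : ℕ → X → A → X → ℝ)
    (n : ℕ) (φ : X → ℝ) :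
    ∑ p : (Fin (n + 1) → X) × (Fin n → A), w (p.1 0) *
      (∏ k : Fin n, K k (p.1 k.castSucc) (p.2 k) (p.1 k.succ)) * φ (p.1 (Fin.last n)) =
    ∑ x, chainMass w K n x * φ x := by
  induction n generalizing φ with
  | zero =>
    rw [Fintype.sum_prod_type, ← (Equiv.funUnique (Fin 1) X).symm.sum_comp]
    simp [chainMass]
  | succ n ih =>
    have e := ih fun x => ∑ a, ∑ x', K n x a x' * φ x'
    have r : ∑ x, chainMass w K (n + 1) x * φ x =
        ∑ x, chainMass w K n x * ∑ a, ∑ x', K n x a x' * φ x' := by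
      simp only [chainMass, Finset.sum_mul, Finset.mul_sum]
      rw [Finset.sum_comm]
      refine Finset.sum_congr rfl fun x _ => ?_
      rw [Finset.sum_comm]
      exact Finset.sum_congr rfl fun a _ => Finset.sum_congr rfl fun x' _ => by ring
    rw [r, ← e, ← ((Fin.snocEquiv fun _ : Fin (n + 2) => X).prodCongr
      (Fin.snocEquiv fun _ : Fin (n + 1) => A)).sum_comp]
    simp only [Fintype.sum_prod_type, Equiv.prodCongr_apply, Prod.map, Fin.snocEquiv,
      Equiv.coe_fn_mk, Fin.prod_univ_castSucc, Fin.snoc_castSucc, Fin.snoc_last, Fin.succ_last,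
      ← Fin.castSucc_zero, Fin.val_castSucc, Fin.succ_castSucc, Fin.val_last, Finset.mul_sum]
    rw [Finset.sum_comm]
    refine Finset.sum_congr rfl fun s _ => ?_
    rw [Finset.sum_comm]
    conv_rhs => rw [Finset.sum_comm]
    refine Finset.sum_congr rfl fun b _ => ?_
    rw [Finset.sum_comm]
    exact Finset.sum_congr rfl fun p _ => Finset.sum_congr rfl fun x _ => by ring

lemma layer_eq_of_chainMass_ne_zero (f : X → ℕ) {w : X → ℝ} {K : ℕ → X → A → X → ℝ}
    (hw : ∀ x, w x ≠ 0 → f x = 0) (hK : ∀ k x a x', K k x a x' ≠ 0 → f x' = f x + 1)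
    {n : ℕ} {x : X} (h : chainMass w K n x ≠ 0) : f x = n := by
  induction n generalizing x with
  | zero => exact hw x h
  | succ n ih =>
    obtain ⟨y, -, hy⟩ := Finset.exists_ne_zero_of_sum_ne_zero h
    obtain ⟨a, -, ha⟩ := Finset.exists_ne_zero_of_sum_ne_zero hy
    rw [hK n y a x (right_ne_zero_of_mul ha), ih (left_ne_zero_of_mul ha)]

/-- Normalization of the weights is needed only on layer `n`, since all the mass after `n` steps
sits there. -/
lemma sum_chainMass_succ (f : X → ℕ) {w : X → ℝ} {K : ℕ → X → A → X → ℝ}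
    (hw : ∀ x, w x ≠ 0 → f x = 0) (hK : ∀ k x a x', K k x a x' ≠ 0 → f x' = f x + 1) {n : ℕ}
    (h1 : ∀ x, f x = n → ∑ a, ∑ x', K n x a x' = 1) :
    ∑ x, chainMass w K (n + 1) x = ∑ x, chainMass w K n x := by
  simp only [chainMass]
  rw [Finset.sum_comm]
  refine Finset.sum_congr rfl fun x _ => ?_
  rw [Finset.sum_comm]
  simp only [← Finset.mul_sum]
  by_cases h : chainMass w K n x = 0
  · simp [h]
  · rw [h1 x (layer_eq_of_chainMass_ne_zero f hw hK h), mul_one]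

lemma chainMass_congr {w : X → ℝ} {K K' : ℕ → X → A → X → ℝ} {n : ℕ}
    (h : ∀ k < n, K k = K' k) : chainMass w K n = chainMass w K' n := by
  induction n with
  | zero => rfl
  | succ n ih =>
    funext x
    simp only [chainMass, ih fun k hk => h k (hk.trans n.lt_succ_self), h n n.lt_succ_self]

end Chain

/-! ### State distributions and marginals of the trajectory law -/

section Occupancy

variable {X : Type u} {A : Type v} {L : ℕ} [Fintype X] [Fintype A]

/-- The probability of being in a state after `k` steps. -/
noncomputable def stateOcc (Λ : Layering X L) (P : X → A → X → ℝ) (π : X → A → ℝ) : ℕ → X → ℝ :=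
  chainMass (fun x => if Λ.layer x = 0 then 1 else 0) fun _ x a x' => π x a * P x a x'

variable {Λ : Layering X L} {P : X → A → X → ℝ} {π : X → A → ℝ}

lemma stateOcc_zero (x : X) : stateOcc Λ P π 0 x = if Λ.layer x = 0 then 1 else 0 := rfl

lemma stateOcc_succ (k : ℕ) (x' : X) : stateOcc Λ P π (k + 1) x' =
    ∑ x, ∑ a, stateOcc Λ P π k x * (π x a * P x a x') := rfl

omit [Fintype A] in
lemma IsTransition.next_layer_of_ne (hP : IsTransition Λ P) {x : X} {a : A} {x' : X}
    (h : P x a x' ≠ 0) : Λ.layer x' = Λ.layer x + 1 :=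
  hP.next_layer x a x' (lt_of_le_of_ne (hP.nonneg x a x') h.symm)

lemma stateOcc_nonneg (hP : IsTransition Λ P) (hπ : IsPolicy π) (k : ℕ) (x : X) :
    0 ≤ stateOcc Λ P π k x := by
  induction k generalizing x with
  | zero => rw [stateOcc_zero]; split_ifs <;> norm_num
  | succ k ih =>
    rw [stateOcc_succ]
    exact Finset.sum_nonneg fun y _ => Finset.sum_nonneg fun a _ =>
      mul_nonneg (ih y) (mul_nonneg (hπ.nonneg y a) (hP.nonneg y a x))

lemma layer_eq_of_stateOcc_ne_zero (hP : IsTransition Λ P) {k : ℕ} {x : X}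
    (h : stateOcc Λ P π k x ≠ 0) : Λ.layer x = k :=
  layer_eq_of_chainMass_ne_zero Λ.layer (by intro x hx; by_contra h; simp [h] at hx)
    (fun _ _ _ _ h => hP.next_layer_of_ne (right_ne_zero_of_mul h)) h

lemma sum_policy_transition (hP : IsTransition Λ P) (hπ : IsPolicy π) {x : X}
    (hx : Λ.layer x < L) : ∑ a, ∑ x', π x a * P x a x' = 1 := by
  simp only [← Finset.mul_sum, hP.sum_eq_one x _ hx, mul_one, hπ.sum_eq_one x]

lemma sum_stateOcc (hP : IsTransition Λ P) (hπ : IsPolicy π) {k : ℕ} (hk : k ≤ L) :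
    ∑ x, stateOcc Λ P π k x = 1 := by
  induction k with
  | zero =>
    obtain ⟨x₀, h0, hu⟩ := Λ.first_unique
    simp only [stateOcc_zero]
    rw [Finset.sum_eq_single x₀ (fun y _ hy => if_neg fun h => hy (hu y h)) (by simp), if_pos h0]
  | succ k ih =>
    rw [← ih (by omega)]
    exact sum_chainMass_succ Λ.layer (by intro x hx; by_contra h; simp [h] at hx)
      (fun _ _ _ _ h => hP.next_layer_of_ne (right_ne_zero_of_mul h))
      fun x hx => sum_policy_transition hP hπ (by omega)

variable [DecidableEq X] [DecidableEq A]

/-- The marginal of step `j`. Inserting `g` as a weight of that step turns the left side into a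
total chain mass. The later steps preserve mass, and the earlier ones are those of `stateOcc`. -/
lemma sum_trajProb_mul (hP : IsTransition Λ P) (hπ : IsPolicy π) (j : Fin L)
    (g : X → A → X → ℝ) :
    ∑ τ : Trajectory X A L, trajProb Λ P π τ *
      g (τ.state j.castSucc) (τ.action j) (τ.state j.succ) =
    ∑ x, ∑ a, ∑ x', stateOcc Λ P π j x * (π x a * P x a x') * g x a x' := by
  set w : X → ℝ := fun x => if Λ.layer x = 0 then 1 else 0 with hwdef
  set K : ℕ → X → A → X → ℝ := fun k x a x' =>
    π x a * P x a x' * if k = j then g x a x' else 1 with hKdef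
  have hw : ∀ x, w x ≠ 0 → Λ.layer x = 0 := by
    intro x hx; by_contra h; simp [w, h] at hx
  have hK : ∀ k x a x', K k x a x' ≠ 0 → Λ.layer x' = Λ.layer x + 1 := fun k x a x' h =>
    hP.next_layer_of_ne (right_ne_zero_of_mul (left_ne_zero_of_mul h))
  have h1 : ∑ τ : Trajectory X A L, trajProb Λ P π τ *
      g (τ.state j.castSucc) (τ.action j) (τ.state j.succ) = ∑ x, chainMass w K L x := by
    rw [← (Trajectory.equivProd X A L).sum_comp]
    have := sum_paths_eq_chainMass w K L fun _ => 1
    simp only [mul_one] at this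
    rw [← this]
    refine Finset.sum_congr rfl fun p _ => ?_
    simp only [trajProb, Trajectory.equivProd, Equiv.coe_fn_mk, hKdef, hwdef, mul_assoc]
    congr 1
    simp only [← mul_assoc]
    rw [Finset.prod_mul_distrib (f := fun k : Fin L => π (p.1 k.castSucc) (p.2 k) *
      P (p.1 k.castSucc) (p.2 k) (p.1 k.succ))]
    congr 1
    simp only [Fin.val_inj]
    rw [Finset.prod_ite_eq' Finset.univ j fun k => g (p.1 k.castSucc) (p.2 k) (p.1 k.succ)]
    simp
  have h2 : ∀ d, (j : ℕ) + 1 + d ≤ L →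
      ∑ x, chainMass w K (j + 1 + d) x = ∑ x, chainMass w K (j + 1) x := by
    intro d
    induction d with
    | zero => intro; rfl
    | succ d ih =>
      intro hd
      rw [← ih (by omega), ← add_assoc]
      refine sum_chainMass_succ Λ.layer hw hK fun x hx => ?_
      have : ¬ (j : ℕ) + 1 + d = j := by omega
      simp only [hKdef, this, if_false, mul_one]
      exact sum_policy_transition hP hπ (by omega)
  have h3 := h2 (L - (j + 1)) (by omega)
  rw [show (j : ℕ) + 1 + (L - (j + 1)) = L by omega] at h3
  rw [h1, h3]
  have h4 : chainMass w K j = stateOcc Λ P π j :=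
    chainMass_congr fun k hk => by funext x a x'; simp [hKdef, hk.ne]
  simp only [chainMass, h4]
  rw [Finset.sum_comm]
  refine Finset.sum_congr rfl fun x _ => ?_
  rw [Finset.sum_comm]
  refine Finset.sum_congr rfl fun a _ => Finset.sum_congr rfl fun x' _ => ?_
  simp [hKdef, mul_assoc]

omit [DecidableEq X] [DecidableEq A] in
lemma trajProb_nonneg (hP : IsTransition Λ P) (hπ : IsPolicy π) (τ : Trajectory X A L) :
    0 ≤ trajProb Λ P π τ :=
  mul_nonneg (by split_ifs <;> norm_num) (Finset.prod_nonneg fun _ _ =>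
    mul_nonneg (hπ.nonneg _ _) (hP.nonneg _ _ _))

end Occupancy
-- Occupancy measures as flows; convexity and compactness of `Δ(𝒫)`
section Flow

variable {X : Type u} {A : Type v} {L : ℕ} [Fintype X] [Fintype A] [DecidableEq X] [DecidableEq A]
  {Λ : Layering X L} {P P' : X → A → X → ℝ} {π : X → A → ℝ}

lemma sum_trajProb (hP : IsTransition Λ P) (hπ : IsPolicy π) :
    ∑ τ : Trajectory X A L, trajProb Λ P π τ = 1 := by
  have h := sum_trajProb_mul hP hπ ⟨0, Λ.pos⟩ fun _ _ _ => 1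
  simp only [mul_one] at h
  rw [h, ← sum_stateOcc hP hπ (Nat.zero_le L)]
  refine Finset.sum_congr rfl fun x _ => ?_
  simp only [← Finset.mul_sum]
  by_cases hx : Λ.layer x = 0
  · have := sum_policy_transition hP hπ (hx.trans_lt Λ.pos)
    simp only [← Finset.mul_sum] at this
    rw [this, mul_one]
  · simp [stateOcc_zero, hx]

lemma occTriple_of_lt (hP : IsTransition Λ P) (hπ : IsPolicy π) {x : X} (hx : Λ.layer x < L)
    (a : A) (x' : X) :
    occTriple Λ P π x a x' = stateOcc Λ P π (Λ.layer x) x * (π x a * P x a x') := by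
  have h := sum_trajProb_mul hP hπ ⟨Λ.layer x, hx⟩ fun y b y' =>
    if y = x ∧ b = a ∧ y' = x' then 1 else 0
  have e : ∀ τ : Trajectory X A L, (∃ k : Fin L, (k : ℕ) = Λ.layer x ∧ τ.state k.castSucc = x ∧
      τ.action k = a ∧ τ.state k.succ = x') ↔
      τ.state (⟨Λ.layer x, hx⟩ : Fin L).castSucc = x ∧ τ.action ⟨Λ.layer x, hx⟩ = a ∧
        τ.state (⟨Λ.layer x, hx⟩ : Fin L).succ = x' := by
    intro τ
    constructor
    · rintro ⟨k, hk, h⟩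
      obtain rfl : k = ⟨Λ.layer x, hx⟩ := Fin.ext hk
      exact h
    · exact fun h => ⟨_, rfl, h⟩
  simp only [mul_ite, mul_one, mul_zero] at h
  simp only [occTriple, e]
  rw [h, Finset.sum_eq_single x, Finset.sum_eq_single a, Finset.sum_eq_single x'] <;>
    simp +contextual

lemma occ_of_lt (hP : IsTransition Λ P) (hπ : IsPolicy π) {x : X} (hx : Λ.layer x < L) (a : A) :
    occ Λ P π (x, a) = stateOcc Λ P π (Λ.layer x) x * π x a := by
  simp only [occ, occTriple_of_lt hP hπ hx, ← Finset.mul_sum, hP.sum_eq_one x a hx, mul_one]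

lemma occTriple_of_last {x : X} (hx : Λ.layer x = L) (a : A) (x' : X) :
    occTriple Λ P π x a x' = 0 :=
  Finset.sum_eq_zero fun τ _ => if_neg fun ⟨k, hk, _⟩ => by omega

lemma occ_of_last {x : X} (hx : Λ.layer x = L) (a : A) : occ Λ P π (x, a) = 0 := by
  simp [occ, occTriple_of_last hx]

/-- Only `k = Λ.layer x` contributes. The sum over all steps covers the last layer too and so avoids
case distinctions later. -/
lemma occ_eq_sum (hP : IsTransition Λ P) (hπ : IsPolicy π) (x : X) (a : A) :
    occ Λ P π (x, a) = ∑ k : Fin L, stateOcc Λ P π k x * π x a := by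
  rcases lt_or_eq_of_le (Λ.layer_le x) with h | h
  · rw [occ_of_lt hP hπ h, Finset.sum_eq_single ⟨Λ.layer x, h⟩]
    · intro k _ hk
      have : stateOcc Λ P π k x = 0 := by
        by_contra h0
        exact hk (Fin.ext (layer_eq_of_stateOcc_ne_zero hP h0).symm)
      rw [this, zero_mul]
    · simp
  · rw [occ_of_last h, Finset.sum_eq_zero]
    intro k _
    have : stateOcc Λ P π k x = 0 := by
      by_contra h0
      have := layer_eq_of_stateOcc_ne_zero hP h0
      omega
    rw [this, zero_mul]

lemma occ_nonneg (hP : IsTransition Λ P) (hπ : IsPolicy π) (p : X × A) : 0 ≤ occ Λ P π p := by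
  rw [occ_eq_sum hP hπ]
  exact Finset.sum_nonneg fun k _ => mul_nonneg (stateOcc_nonneg hP hπ _ _) (hπ.nonneg _ _)

lemma sum_occ (hP : IsTransition Λ P) (hπ : IsPolicy π) : ∑ p, occ Λ P π p = L := by
  rw [Fintype.sum_prod_type]
  simp only [occ_eq_sum hP hπ]
  simp only [Finset.sum_comm (s := (Finset.univ : Finset A)) (t := (Finset.univ : Finset (Fin L))),
    ← Finset.mul_sum, hπ.sum_eq_one, mul_one]
  rw [Finset.sum_comm]
  rw [Finset.sum_congr rfl fun (k : Fin L) _ => sum_stateOcc hP hπ k.2.le]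
  simp

/-- The expectation over a trajectory of a sum over the visited pairs. -/
lemma sum_trajProb_mul_sum (hP : IsTransition Λ P) (hπ : IsPolicy π) (h : X × A → ℝ) :
    ∑ τ : Trajectory X A L, trajProb Λ P π τ * ∑ k : Fin L, h (τ.state k.castSucc, τ.action k) =
      ∑ p, occ Λ P π p * h p := by
  simp only [Finset.mul_sum]
  rw [Finset.sum_comm, Fintype.sum_prod_type]
  simp only [occ_eq_sum hP hπ, Finset.sum_mul]
  simp only [Finset.sum_comm (s := (Finset.univ : Finset A)) (t := (Finset.univ : Finset (Fin L)))]
  conv_rhs => rw [Finset.sum_comm]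
  refine Finset.sum_congr rfl fun k _ => ?_
  rw [sum_trajProb_mul hP hπ k fun x a _ => h (x, a)]
  refine Finset.sum_congr rfl fun x _ => Finset.sum_congr rfl fun a _ => ?_
  by_cases h0 : stateOcc Λ P π k x = 0
  · simp [h0]
  · have hx : Λ.layer x < L := (layer_eq_of_stateOcc_ne_zero hP h0).trans_lt k.2
    rw [← Finset.sum_mul, ← Finset.mul_sum, ← Finset.mul_sum, hP.sum_eq_one x a hx, mul_one]

/-- The linear constraints of the occupancy measures for the transition function `P`. -/
structure IsFlow (Λ : Layering X L) (P : X → A → X → ℝ) (q : EuclideanSpace ℝ (X × A)) :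
    Prop where
  nonneg : ∀ p, 0 ≤ q p
  last : ∀ x a, Λ.layer x = L → q (x, a) = 0
  first : ∀ x, Λ.layer x = 0 → ∑ a, q (x, a) = 1
  flow : ∀ x', 0 < Λ.layer x' → Λ.layer x' < L →
    ∑ a, q (x', a) = ∑ x, ∑ a, q (x, a) * P x a x'

lemma isFlow_occ (hP : IsTransition Λ P) (hπ : IsPolicy π) : IsFlow Λ P (occ Λ P π) where
  nonneg := occ_nonneg hP hπ
  last x a h := occ_of_last h a
  first x h := by
    simp only [occ_of_lt hP hπ (h.trans_lt Λ.pos), ← Finset.mul_sum, hπ.sum_eq_one, mul_one]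
    rw [h, stateOcc_zero, if_pos h]
  flow x' h0 h1 := by
    simp only [occ_of_lt hP hπ h1, ← Finset.mul_sum, hπ.sum_eq_one, mul_one]
    obtain ⟨k, hk⟩ : ∃ k, Λ.layer x' = k + 1 := ⟨_, (Nat.succ_pred_eq_of_pos h0).symm⟩
    rw [hk, stateOcc_succ]
    refine Finset.sum_congr rfl fun x _ => Finset.sum_congr rfl fun a _ => ?_
    by_cases h : P x a x' = 0
    · simp [h]
    · have hx : Λ.layer x = k := by have := hP.next_layer_of_ne h; omega
      rw [occ_of_lt hP hπ (by omega), hx, mul_assoc]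

omit [Fintype X] [DecidableEq X] [DecidableEq A] in
lemma isPolicy_inducedPolicy [Nonempty A] {q : EuclideanSpace ℝ (X × A)} (hq : ∀ p, 0 ≤ q p) :
    IsPolicy (inducedPolicy q) where
  nonneg x a := by
    unfold inducedPolicy
    split_ifs
    · positivity
    · exact div_nonneg (hq _) (Finset.sum_nonneg fun _ _ => hq _)
  sum_eq_one x := by
    unfold inducedPolicy
    split_ifs with h
    · simp
    · rw [← Finset.sum_div, div_self h]

omit [DecidableEq X] [DecidableEq A] [Fintype X] in
lemma sum_mul_inducedPolicy {q : EuclideanSpace ℝ (X × A)} (hq : ∀ p, 0 ≤ q p) (x : X) (a : A) :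
    (∑ b, q (x, b)) * inducedPolicy q x a = q (x, a) := by
  unfold inducedPolicy
  split_ifs with h
  · rw [h, zero_mul, (Finset.sum_eq_zero_iff_of_nonneg fun b _ => hq (x, b)).1 h a
      (Finset.mem_univ a)]
  · rw [mul_div_cancel₀ _ h]

/-- Along the layers, the state masses of `q` satisfy the recursion of `stateOcc` for the induced
policy, by the flow equations. -/
lemma IsFlow.occ_inducedPolicy [Nonempty A] (hP : IsTransition Λ P)
    {q : EuclideanSpace ℝ (X × A)} (hq : IsFlow Λ P q) : occ Λ P (inducedPolicy q) = q := by
  have hπ := isPolicy_inducedPolicy hq.nonneg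
  have key : ∀ k < L, ∀ x, Λ.layer x = k →
      stateOcc Λ P (inducedPolicy q) k x = ∑ b, q (x, b) := by
    intro k
    induction k with
    | zero => intro _ x hx; rw [hq.first x hx, stateOcc_zero, if_pos hx]
    | succ k ih =>
      intro hk x' hx'
      rw [hq.flow x' (by omega) (by omega), stateOcc_succ]
      refine Finset.sum_congr rfl fun x _ => Finset.sum_congr rfl fun a _ => ?_
      by_cases h : P x a x' = 0
      · simp [h]
      · have hx : Λ.layer x = k := by have := hP.next_layer_of_ne h; omega
        rw [ih (by omega) x hx, ← mul_assoc, sum_mul_inducedPolicy hq.nonneg]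
  ext ⟨x, a⟩
  rcases lt_or_eq_of_le (Λ.layer_le x) with h | h
  · rw [occ_of_lt hP hπ h, key _ h x rfl, sum_mul_inducedPolicy hq.nonneg]
  · rw [occ_of_last h, hq.last x a h]

/-- For a fixed transition function the policy disappears and only linear constraints on `q` remain.
-/
lemma mem_occSet_iff [Nonempty A] {Ps : Set (X → A → X → ℝ)} (hPs : ∀ P ∈ Ps, IsTransition Λ P)
    {q : EuclideanSpace ℝ (X × A)} : q ∈ occSet Λ Ps ↔ ∃ P ∈ Ps, IsFlow Λ P q := by
  constructor
  · rintro ⟨P, hP, π, hπ, rfl⟩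
    exact ⟨P, hP, isFlow_occ (hPs P hP) hπ⟩
  · rintro ⟨P, hP, hq⟩
    exact ⟨P, hP, _, isPolicy_inducedPolicy hq.nonneg, (hq.occ_inducedPolicy (hPs P hP)).symm⟩

/-- If `Ps` is convex separately in all pairs of a state and an action, then `Δ(Ps)` is convex. -/
lemma convex_occSet [Nonempty A] {Ps : Set (X → A → X → ℝ)} (hPs : ∀ P ∈ Ps, IsTransition Λ P)
    (hmix : ∀ P₁ ∈ Ps, ∀ P₂ ∈ Ps, ∀ α : X → A → ℝ, (∀ x a, 0 ≤ α x a) → (∀ x a, α x a ≤ 1) →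
      (fun x a x' => α x a * P₁ x a x' + (1 - α x a) * P₂ x a x') ∈ Ps) :
    Convex ℝ (occSet Λ Ps) := by
  intro q₁ h₁ q₂ h₂ s t hs ht hst
  rw [mem_occSet_iff hPs] at h₁ h₂ ⊢
  obtain ⟨P₁, hP₁, f₁⟩ := h₁
  obtain ⟨P₂, hP₂, f₂⟩ := h₂
  have n₁ : ∀ p, 0 ≤ s * q₁ p := fun p => mul_nonneg hs (f₁.nonneg p)
  have n₂ : ∀ p, 0 ≤ t * q₂ p := fun p => mul_nonneg ht (f₂.nonneg p)
  have hq : ∀ p, (s • q₁ + t • q₂) p = s * q₁ p + t * q₂ p := fun p => by simp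
  -- The weight of `P₁` in `(x, a)` is the share of the first measure in the mixed mass there, so
  -- that the mixed flow is a flow for the mixed transition function. Where there is no mass, any
  -- weight in `[0, 1]` would do.
  set α : X → A → ℝ := fun x a =>
    if s * q₁ (x, a) + t * q₂ (x, a) = 0 then 1
    else s * q₁ (x, a) / (s * q₁ (x, a) + t * q₂ (x, a)) with hα
  have e₁ : ∀ x a, (s * q₁ (x, a) + t * q₂ (x, a)) * α x a = s * q₁ (x, a) := by
    intro x a
    simp only [hα]
    split_ifs with h
    · have := n₁ (x, a); have := n₂ (x, a); linarith
    · rw [mul_div_cancel₀ _ h]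
  refine ⟨_, hmix P₁ hP₁ P₂ hP₂ α (fun x a => ?_) (fun x a => ?_), ?_, ?_, ?_, ?_⟩
  · simp only [hα]
    split_ifs
    · norm_num
    · exact div_nonneg (n₁ _) (add_nonneg (n₁ _) (n₂ _))
  · simp only [hα]
    split_ifs
    · norm_num
    · exact div_le_one_of_le₀ (by linarith [n₂ (x, a)]) (add_nonneg (n₁ _) (n₂ _))
  · intro p; rw [hq]; exact add_nonneg (n₁ _) (n₂ _)
  · intro x a h; rw [hq, f₁.last x a h, f₂.last x a h]; simp
  · intro x h
    simp only [hq, Finset.sum_add_distrib, ← Finset.mul_sum, f₁.first x h, f₂.first x h, mul_one,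
      hst]
  · intro x' h0 h1
    simp only [hq, Finset.sum_add_distrib, ← Finset.mul_sum, f₁.flow x' h0 h1, f₂.flow x' h0 h1]
    simp only [Finset.mul_sum, ← Finset.sum_add_distrib]
    refine Finset.sum_congr rfl fun x _ => Finset.sum_congr rfl fun a _ => ?_
    have := e₁ x a
    linear_combination (-(P₁ x a x') + P₂ x a x') * this

omit [Fintype X] [DecidableEq X] [DecidableEq A] in
lemma IsPolicy.le_one (hπ : IsPolicy π) (x : X) (a : A) : π x a ≤ 1 := by
  rw [← hπ.sum_eq_one x]
  exact Finset.single_le_sum (fun b _ => hπ.nonneg x b) (Finset.mem_univ a)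

omit [Fintype A] [DecidableEq X] [DecidableEq A] in
lemma IsTransition.sum_le_one (hP : IsTransition Λ P) (x : X) (a : A) :
    ∑ x', P x a x' ≤ 1 := by
  by_cases h : Λ.layer x < L
  · exact (hP.sum_eq_one x a h).le
  · rw [Finset.sum_eq_zero]
    · norm_num
    · intro x' _
      by_contra h0
      have := hP.next_layer_of_ne h0
      have := Λ.layer_le x'
      omega

omit [Fintype A] [DecidableEq X] [DecidableEq A] in
lemma IsTransition.le_one (hP : IsTransition Λ P) (x : X) (a : A) (x' : X) : P x a x' ≤ 1 :=
  (Finset.single_le_sum (fun y _ => hP.nonneg x a y) (Finset.mem_univ x')).trans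
    (hP.sum_le_one x a)

lemma continuous_occ (Λ : Layering X L) :
    Continuous fun r : (X → A → X → ℝ) × (X → A → ℝ) => occ Λ r.1 r.2 := by
  unfold occ occTriple trajProb
  refine (PiLp.continuous_toLp 2 _).comp (continuous_pi fun p => ?_)
  refine continuous_finsetSum _ fun x' _ => continuous_finsetSum _ fun τ _ => ?_
  split_ifs <;> fun_prop

omit [Fintype X] [DecidableEq X] [DecidableEq A] in
lemma isCompact_setOf_isPolicy : IsCompact {π : X → A → ℝ | IsPolicy π} := by
  have h : {π : X → A → ℝ | IsPolicy π} =
      {π | ∀ x a, 0 ≤ π x a} ∩ {π | ∀ x, ∑ a, π x a = 1} := by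
    ext π; exact ⟨fun h => ⟨h.1, h.2⟩, fun h => ⟨h.1, h.2⟩⟩
  refine IsCompact.of_isClosed_subset
    (isCompact_univ_pi fun _ : X => isCompact_univ_pi fun _ : A =>
      isCompact_Icc (a := (0 : ℝ)) (b := 1)) ?_
    fun π hπ x _ a _ => ⟨IsPolicy.nonneg hπ x a, IsPolicy.le_one hπ x a⟩
  rw [h]
  simp only [Set.ofPred_forall]
  refine IsClosed.inter (isClosed_iInter fun x => isClosed_iInter fun a => ?_)
    (isClosed_iInter fun x => ?_)
  · exact isClosed_le continuous_const (by fun_prop)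
  · exact isClosed_eq (by fun_prop) continuous_const

omit [Fintype A] [DecidableEq X] [DecidableEq A] in
lemma isCompact_setOf_isTransition (Λ : Layering X L) :
    IsCompact {P : X → A → X → ℝ | IsTransition Λ P} := by
  -- The layer condition has a strict inequality as its hypothesis; its contrapositive is a closed
  -- condition.
  have h : {P : X → A → X → ℝ | IsTransition Λ P} =
      {P | ∀ x a x', 0 ≤ P x a x'} ∩ {P | ∀ x a, Λ.layer x < L → ∑ x', P x a x' = 1} ∩
        {P | ∀ x a x', Λ.layer x' ≠ Λ.layer x + 1 → P x a x' ≤ 0} := by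
    ext P
    refine ⟨fun h => ⟨⟨h.1, h.2⟩, fun x a x' h0 => not_lt.1 fun h1 => h0 (h.3 x a x' h1)⟩,
      fun h => ⟨h.1.1, h.1.2, fun x a x' h1 => ?_⟩⟩
    by_contra h0
    exact absurd (h.2 x a x' h0) (not_le.2 h1)
  refine IsCompact.of_isClosed_subset (isCompact_univ_pi fun _ : X => isCompact_univ_pi
    fun _ : A => isCompact_univ_pi fun _ : X => isCompact_Icc (a := (0 : ℝ)) (b := 1)) ?_
    fun P hP x _ a _ x' _ => ⟨IsTransition.nonneg hP x a x', IsTransition.le_one hP x a x'⟩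
  rw [h]
  simp only [Set.ofPred_forall]
  refine (IsClosed.inter ?_ ?_).inter ?_
  · exact isClosed_iInter fun x => isClosed_iInter fun a => isClosed_iInter fun x' =>
      isClosed_le continuous_const (by fun_prop)
  · exact isClosed_iInter fun x => isClosed_iInter fun a => isClosed_iInter fun _ =>
      isClosed_eq (by fun_prop) continuous_const
  · exact isClosed_iInter fun x => isClosed_iInter fun a => isClosed_iInter fun x' =>
      isClosed_iInter fun _ => isClosed_le (by fun_prop) continuous_const

/-- `occ` is polynomial in the transition function and the policy. Compactness ensures that the
projections on `Δ(𝒫_i)` are attained. -/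
lemma isCompact_occSet {Ps : Set (X → A → X → ℝ)} (hPs : IsCompact Ps) :
    IsCompact (occSet Λ Ps) := by
  have : occSet Λ Ps = (fun r : (X → A → X → ℝ) × (X → A → ℝ) => occ Λ r.1 r.2) ''
      (Ps ×ˢ {π | IsPolicy π}) := by
    ext q
    constructor
    · rintro ⟨P, hP, π, hπ, rfl⟩
      exact ⟨(P, π), ⟨hP, hπ⟩, rfl⟩
    · rintro ⟨⟨P, π⟩, ⟨hP, hπ⟩, rfl⟩
      exact ⟨P, hP, π, hπ, rfl⟩
  rw [this]
  exact (hPs.prod isCompact_setOf_isPolicy).image (continuous_occ Λ)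

omit [DecidableEq X] [DecidableEq A] in
lemma isCompact_confSet (Λ : Layering X L) (T : ℕ) (δ : ℝ) (s : UCState X A) :
    IsCompact (s.confSet Λ T δ) := by
  have : s.confSet Λ T δ = {P | IsTransition Λ P} ∩ {P | s.epoch ≠ 1 →
      ∀ x a, ∑ x', |P x a x' - s.empirical x a x'| ≤ s.radius Λ T δ x a} := rfl
  rw [this]
  refine (isCompact_setOf_isTransition Λ).inter_right ?_
  simp only [Set.ofPred_forall]
  exact isClosed_iInter fun _ => isClosed_iInter fun x => isClosed_iInter fun a =>
    isClosed_le (by fun_prop) continuous_const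

omit [Fintype A] [DecidableEq X] [DecidableEq A] in
lemma IsTransition.mix {P₁ P₂ : X → A → X → ℝ} (h₁ : IsTransition Λ P₁) (h₂ : IsTransition Λ P₂)
    {α : X → A → ℝ} (h0 : ∀ x a, 0 ≤ α x a) (h1 : ∀ x a, α x a ≤ 1) :
    IsTransition Λ fun x a x' => α x a * P₁ x a x' + (1 - α x a) * P₂ x a x' where
  nonneg x a x' := add_nonneg (mul_nonneg (h0 x a) (h₁.nonneg x a x'))
    (mul_nonneg (sub_nonneg.2 (h1 x a)) (h₂.nonneg x a x'))
  sum_eq_one x a hx := by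
    simp only [Finset.sum_add_distrib, ← Finset.mul_sum, h₁.sum_eq_one x a hx,
      h₂.sum_eq_one x a hx]
    ring
  next_layer x a x' h := by
    by_contra hne
    have e₁ : P₁ x a x' = 0 := by
      by_contra h'; exact hne (h₁.next_layer_of_ne h')
    have e₂ : P₂ x a x' = 0 := by
      by_contra h'; exact hne (h₂.next_layer_of_ne h')
    simp [e₁, e₂] at h

/-- A confidence set restricts each `P(· | x, a)` to an `ℓ¹` ball separately, hence allows mixing
with weights that depend on `(x, a)`. -/
lemma convex_occSet_confSet [Nonempty A] (Λ : Layering X L) (T : ℕ) (δ : ℝ) (s : UCState X A) :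
    Convex ℝ (occSet Λ (s.confSet Λ T δ)) := by
  refine convex_occSet (fun P hP => hP.1) fun P₁ h₁ P₂ h₂ α h0 h1 =>
    ⟨h₁.1.mix h₂.1 h0 h1, fun he x a => ?_⟩
  calc ∑ x', |α x a * P₁ x a x' + (1 - α x a) * P₂ x a x' - s.empirical x a x'|
      ≤ ∑ x', (α x a * |P₁ x a x' - s.empirical x a x'| +
          (1 - α x a) * |P₂ x a x' - s.empirical x a x'|) := by
        refine Finset.sum_le_sum fun x' _ => ?_
        rw [show α x a * P₁ x a x' + (1 - α x a) * P₂ x a x' - s.empirical x a x' =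
          α x a * (P₁ x a x' - s.empirical x a x') +
            (1 - α x a) * (P₂ x a x' - s.empirical x a x') by ring]
        refine (abs_add_le _ _).trans (le_of_eq ?_)
        rw [abs_mul, abs_mul, abs_of_nonneg (h0 x a), abs_of_nonneg (sub_nonneg.2 (h1 x a))]
    _ = α x a * ∑ x', |P₁ x a x' - s.empirical x a x'| +
          (1 - α x a) * ∑ x', |P₂ x a x' - s.empirical x a x'| := by
        rw [Finset.sum_add_distrib, ← Finset.mul_sum, ← Finset.mul_sum]
    _ ≤ α x a * s.radius Λ T δ x a + (1 - α x a) * s.radius Λ T δ x a :=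
        add_le_add (mul_le_mul_of_nonneg_left (h₁.2 he x a) (h0 x a))
          (mul_le_mul_of_nonneg_left (h₂.2 he x a) (sub_nonneg.2 (h1 x a)))
    _ = s.radius Λ T δ x a := by ring

/-- Two transition functions lead the same policy to occupancy measures that differ by at most `L`
times the expected difference of the next-state distributions along a trajectory. -/
lemma sum_abs_occ_sub_le (hP : IsTransition Λ P) (hP' : IsTransition Λ P') (hπ : IsPolicy π) :
    ∑ p, |occ Λ P π p - occ Λ P' π p| ≤
      L * ∑ p : X × A, occ Λ P π p * ∑ x', |P p.1 p.2 x' - P' p.1 p.2 x'| := by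
  set ξ : X → A → ℝ := fun x a => ∑ x', |P x a x' - P' x a x'| with hξ
  have hξ0 : ∀ x a, 0 ≤ ξ x a := fun x a => Finset.sum_nonneg fun _ _ => abs_nonneg _
  set W : ℕ → ℝ := fun k => ∑ x, ∑ a, stateOcc Λ P π k x * π x a * ξ x a with hW
  have hW0 : ∀ k, 0 ≤ W k := fun k => Finset.sum_nonneg fun x _ => Finset.sum_nonneg fun a _ =>
    mul_nonneg (mul_nonneg (stateOcc_nonneg hP hπ k x) (hπ.nonneg x a)) (hξ0 x a)
  have hsum : ∑ p : X × A, occ Λ P π p * ∑ x', |P p.1 p.2 x' - P' p.1 p.2 x'| =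
      ∑ k : Fin L, W k := by
    rw [Fintype.sum_prod_type]
    simp only [occ_eq_sum hP hπ, Finset.sum_mul, hW]
    rw [Finset.sum_comm]
    simp only [Finset.sum_comm (s := (Finset.univ : Finset (Fin L)))]
    rw [Finset.sum_comm]
  -- The error inherited from step `k` does not grow when transported by `P'`; the use of `P'` in
  -- place of `P` in this step adds at most `W k`.
  have hstep : ∀ k, ∑ x, |stateOcc Λ P π (k + 1) x - stateOcc Λ P' π (k + 1) x| ≤
      ∑ x, |stateOcc Λ P π k x - stateOcc Λ P' π k x| + W k := by
    intro k
    calc ∑ x', |stateOcc Λ P π (k + 1) x' - stateOcc Λ P' π (k + 1) x'|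
        ≤ ∑ x', ∑ x, ∑ a, (|stateOcc Λ P π k x - stateOcc Λ P' π k x| * π x a * P' x a x' +
            stateOcc Λ P π k x * π x a * |P x a x' - P' x a x'|) := by
          refine Finset.sum_le_sum fun x' _ => ?_
          rw [stateOcc_succ, stateOcc_succ, ← Finset.sum_sub_distrib]
          refine (Finset.abs_sum_le_sum_abs _ _).trans (Finset.sum_le_sum fun x _ => ?_)
          rw [← Finset.sum_sub_distrib]
          refine (Finset.abs_sum_le_sum_abs _ _).trans (Finset.sum_le_sum fun a _ => ?_)
          rw [show stateOcc Λ P π k x * (π x a * P x a x') -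
              stateOcc Λ P' π k x * (π x a * P' x a x') =
            (stateOcc Λ P π k x - stateOcc Λ P' π k x) * π x a * P' x a x' +
              stateOcc Λ P π k x * π x a * (P x a x' - P' x a x') by ring]
          refine (abs_add_le _ _).trans (le_of_eq ?_)
          rw [abs_mul, abs_mul, abs_mul, abs_mul, abs_of_nonneg (hπ.nonneg x a),
            abs_of_nonneg (hP'.nonneg x a x'), abs_of_nonneg (stateOcc_nonneg hP hπ k x)]
      _ = ∑ x, (|stateOcc Λ P π k x - stateOcc Λ P' π k x| * ∑ a, π x a * ∑ x', P' x a x') +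
            W k := by
          simp only [Finset.sum_add_distrib, hW, hξ, Finset.mul_sum]
          congr 1
          · rw [Finset.sum_comm]
            refine Finset.sum_congr rfl fun x _ => ?_
            rw [Finset.sum_comm]
            exact Finset.sum_congr rfl fun a _ => Finset.sum_congr rfl fun x' _ => by ring
          · rw [Finset.sum_comm]
            exact Finset.sum_congr rfl fun x _ => Finset.sum_comm
      _ ≤ _ := by
          gcongr with x
          calc _ ≤ |stateOcc Λ P π k x - stateOcc Λ P' π k x| * 1 := by
                gcongr
                rw [← hπ.sum_eq_one x]
                exact Finset.sum_le_sum fun a _ =>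
                  mul_le_of_le_one_right (hπ.nonneg x a) (hP'.sum_le_one x a)
            _ = _ := mul_one _
  have hk : ∀ k ≤ L, ∑ x, |stateOcc Λ P π k x - stateOcc Λ P' π k x| ≤
      ∑ j ∈ Finset.range k, W j := by
    intro k
    induction k with
    | zero => intro; simp [stateOcc_zero]
    | succ k ih =>
      intro hk
      rw [Finset.sum_range_succ]
      exact (hstep k).trans (add_le_add (ih (by omega)) le_rfl)
  -- Every layer may suffer the whole accumulated error; summing over the layers gives the factor
  -- `L`.
  have hk' : ∀ k : Fin L, ∑ x, |stateOcc Λ P π k x - stateOcc Λ P' π k x| ≤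
      ∑ k : Fin L, W k := fun k => by
    rw [Fin.sum_univ_eq_sum_range W L]
    exact (hk k k.2.le).trans (Finset.sum_le_sum_of_subset_of_nonneg
      (Finset.range_mono k.2.le) fun j _ _ => hW0 j)
  rw [hsum]
  calc ∑ p, |occ Λ P π p - occ Λ P' π p|
      ≤ ∑ x, ∑ a, ∑ k : Fin L, |stateOcc Λ P π k x - stateOcc Λ P' π k x| * π x a := by
        rw [Fintype.sum_prod_type]
        refine Finset.sum_le_sum fun x _ => Finset.sum_le_sum fun a _ => ?_
        rw [occ_eq_sum hP hπ, occ_eq_sum hP' hπ, ← Finset.sum_sub_distrib]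
        refine (Finset.abs_sum_le_sum_abs _ _).trans (le_of_eq ?_)
        refine Finset.sum_congr rfl fun k _ => ?_
        rw [← sub_mul, abs_mul, abs_of_nonneg (hπ.nonneg x a)]
    _ = ∑ k : Fin L, ∑ x, |stateOcc Λ P π k x - stateOcc Λ P' π k x| := by
        simp only [Finset.sum_comm (s := (Finset.univ : Finset A))
          (t := (Finset.univ : Finset (Fin L))), ← Finset.mul_sum, hπ.sum_eq_one, mul_one]
        rw [Finset.sum_comm]
    _ ≤ ∑ _k : Fin L, ∑ k : Fin L, W k := Finset.sum_le_sum fun k _ => hk' k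
    _ = L * ∑ k : Fin L, W k := by simp

omit [Fintype A] [DecidableEq X] [DecidableEq A] in
lemma card_layerSet_pos (Λ : Layering X L) {k : ℕ} (hk : k ≤ L) :
    0 < (Λ.layerSet k).card := by
  obtain ⟨x, hx⟩ := Λ.layer_nonempty k hk
  exact Finset.card_pos.2 ⟨x, by simp [Layering.layerSet, hx]⟩

omit [Fintype A] [DecidableEq X] [DecidableEq A] in
lemma mem_layerSet {k : ℕ} {x : X} : x ∈ Λ.layerSet k ↔ Λ.layer x = k := by
  simp [Layering.layerSet]

/-- The transition function with uniform next-state distributions. -/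
noncomputable def uniformTransition (Λ : Layering X L) (x : X) (_a : A) (x' : X) : ℝ :=
  if Λ.layer x' = Λ.layer x + 1 then 1 / ((Λ.layerSet (Λ.layer x + 1)).card : ℝ) else 0

omit [Fintype A] [DecidableEq X] [DecidableEq A] in
lemma isTransition_uniformTransition (Λ : Layering X L) :
    IsTransition Λ (uniformTransition (A := A) Λ) where
  nonneg x a x' := by unfold uniformTransition; split_ifs <;> positivity
  sum_eq_one x a hx := by
    have := card_layerSet_pos Λ (k := Λ.layer x + 1) (by omega)
    simp only [uniformTransition, ← Finset.sum_filter]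
    rw [Finset.sum_const, nsmul_eq_mul]
    change ((Λ.layerSet (Λ.layer x + 1)).card : ℝ) * _ = 1
    field_simp
  next_layer x a x' h := by
    by_contra h'
    simp [uniformTransition, h'] at h

omit [DecidableEq X] [DecidableEq A] in
lemma init_qhat_of_lt (Λ : Layering X L) {x : X} (hx : Λ.layer x < L) (a : A) :
    (UCState.init (A := A) Λ).qhat (x, a) =
      1 / ((Λ.layerSet (Λ.layer x)).card * Fintype.card A) := by
  have := card_layerSet_pos Λ (k := Λ.layer x + 1) (by omega)
  simp only [UCState.init, Finset.sum_const, nsmul_eq_mul]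
  rw [one_div, mul_inv, mul_comm, mul_assoc, inv_mul_cancel₀ (by positivity), mul_one, one_div]

omit [DecidableEq X] [DecidableEq A] in
-- The initial iterate is an occupancy measure, as uniform actions and uniform next states are
-- admissible in the first epoch.
lemma isFlow_init_qhat [Nonempty A] (Λ : Layering X L) :
    IsFlow Λ (uniformTransition Λ) (UCState.init (A := A) Λ).qhat := by
  have hA : (Fintype.card A : ℝ) ≠ 0 := by positivity
  refine ⟨fun p => ?_, fun x a hx => ?_, fun x hx => ?_, fun x' h0 h1 => ?_⟩
  · exact Finset.sum_nonneg fun _ _ => by positivity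
  -- Beyond the last layer the sum that defines the initial iterate is empty.
  · have : Λ.layerSet (Λ.layer x + 1) = ∅ := by
      refine Finset.eq_empty_of_forall_notMem fun y hy => ?_
      have := Λ.layer_le y
      rw [mem_layerSet] at hy
      omega
    simp [UCState.init, this]
  · simp only [init_qhat_of_lt Λ (hx.trans_lt Λ.pos)]
    obtain ⟨x₀, h0, hu⟩ := Λ.first_unique
    have : Λ.layerSet (Λ.layer x) = {x} := by
      ext y
      rw [mem_layerSet, hx, Finset.mem_singleton]
      exact ⟨fun h => (hu y h).trans (hu x hx).symm, fun h => h ▸ hx⟩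
    simp [this, hA]
  · obtain ⟨k, hk⟩ : ∃ k, Λ.layer x' = k + 1 := ⟨_, (Nat.succ_pred_eq_of_pos h0).symm⟩
    have c0 : ((Λ.layerSet k).card : ℝ) ≠ 0 := by
      have := card_layerSet_pos Λ (k := k) (by omega)
      positivity
    simp only [init_qhat_of_lt Λ h1]
    have : ∀ x a, (UCState.init (A := A) Λ).qhat (x, a) * uniformTransition Λ x a x' =
        if Λ.layer x = k then
          1 / ((Λ.layerSet k).card * Fintype.card A) * (1 / (Λ.layerSet (k + 1)).card : ℝ)
        else 0 := by
      intro x a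
      simp only [uniformTransition, hk]
      by_cases h : Λ.layer x = k
      · rw [if_pos (by omega), if_pos h, init_qhat_of_lt Λ (by omega), h]
      · rw [if_neg (by omega), if_neg h, mul_zero]
    simp only [this, Finset.sum_const, nsmul_eq_mul, Finset.card_univ, mul_ite, mul_zero, hk]
    rw [← Finset.sum_filter, Finset.sum_const, nsmul_eq_mul]
    change _ = ((Λ.layerSet k).card : ℝ) * _
    field_simp

end Flow
-- Online gradient descent on intervals
section Descent

variable {E : Type u} [NormedAddCommGroup E] [InnerProductSpace ℝ E]

/-- The expanded square of a gradient step, with `w` the inverse step size. If `w = 0`, then `1 / w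
= 0` and the gradient vanishes, so both sides are zero. -/
lemma inner_eq_step (g z q : E) {w : ℝ} (h0 : w = 0 → g = 0) :
    inner ℝ g (z - q) =
      w / 2 * (‖z - q‖ ^ 2 - ‖z - (1 / w) • g - q‖ ^ 2) + ‖g‖ ^ 2 / (2 * w) := by
  by_cases h : w = 0
  · simp [h, h0 h]
  · have : ‖z - (1 / w) • g - q‖ ^ 2 =
        ‖z - q‖ ^ 2 - 2 * ((1 / w) * inner ℝ g (z - q)) + (1 / w) ^ 2 * ‖g‖ ^ 2 := by
      rw [show z - (1 / w) • g - q = (z - q) - (1 / w) • g by abel, norm_sub_sq_real,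
        inner_smul_right, real_inner_comm, norm_smul, mul_pow, Real.norm_eq_abs, sq_abs]
    rw [this]
    field_simp
    ring

/-- The regret of online gradient descent with nonincreasing step sizes `1 / w t`. -/
lemma sum_inner_le_of_descent (z g : ℕ → E) (q : E) (w : ℕ → ℝ) (D : ℝ) {t₁ t₂ : ℕ}
    (ht : t₁ ≤ t₂) (hw : Monotone w) (hw0 : ∀ t, 0 ≤ w t) (hg : ∀ t, w t = 0 → g t = 0)
    (hD : ∀ t, t ≤ t₂ → ‖z t - q‖ ^ 2 ≤ D)
    (hstep : ∀ t, t + 1 ≤ t₂ → ‖z (t + 1) - q‖ ≤ ‖z t - (1 / w t) • g t - q‖) :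
    ∑ t ∈ Finset.Icc t₁ t₂, inner ℝ (g t) (z t - q) ≤
      w t₂ * D / 2 + ∑ t ∈ Finset.Icc t₁ t₂, ‖g t‖ ^ 2 / (2 * w t) := by
  -- The induction keeps the negative distance term of the last step, which pays for the positive
  -- distance term of the next one.
  have key : ∀ t, t₁ ≤ t → t ≤ t₂ → ∑ t ∈ Finset.Icc t₁ t, inner ℝ (g t) (z t - q) ≤
      w t * D / 2 - w t / 2 * ‖z t - (1 / w t) • g t - q‖ ^ 2 +
        ∑ t ∈ Finset.Icc t₁ t, ‖g t‖ ^ 2 / (2 * w t) := by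
    intro t h1
    induction t, h1 using Nat.le_induction with
    | base =>
      intro h2
      simp only [Finset.Icc_self, Finset.sum_singleton]
      rw [inner_eq_step (g t₁) (z t₁) q (hg t₁)]
      nlinarith [mul_le_mul_of_nonneg_left (hD t₁ h2) (hw0 t₁)]
    | succ t h1 ih =>
      intro h2
      rw [Finset.sum_Icc_succ_top (by omega), Finset.sum_Icc_succ_top (by omega)]
      have e := ih (by omega)
      rw [inner_eq_step (g (t + 1)) (z (t + 1)) q (hg (t + 1))]
      have s : ‖z (t + 1) - q‖ ^ 2 ≤ ‖z t - (1 / w t) • g t - q‖ ^ 2 :=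
        pow_le_pow_left₀ (norm_nonneg _) (hstep t h2) 2
      have m := mul_le_mul_of_nonneg_left s (hw0 t)
      -- The increase of `w` multiplies a squared distance bounded by `D`; these increments
      -- telescope to `w t₂ * D / 2`.
      have m' := mul_nonneg (sub_nonneg.2 (hw t.le_succ)) (sub_nonneg.2 (hD (t + 1) h2))
      rw [Nat.succ_eq_add_one] at m'
      linarith
  refine (key t₂ ht le_rfl).trans ?_
  have := mul_nonneg (hw0 t₂) (sq_nonneg ‖z t₂ - (1 / w t₂) • g t₂ - q‖)
  linarith

end Descent

section LossMax

variable {X : Type u} {A : Type v} [Fintype X] [Fintype A] (ℓ : ℕ → X × A → ℝ)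

lemma lossMax_nonneg (t₁ t₂ : ℕ) : 0 ≤ lossMax ℓ t₁ t₂ := NNReal.coe_nonneg _

lemma norm_le_lossMax {t₁ t₂ t : ℕ} (h₁ : t₁ ≤ t) (h₂ : t ≤ t₂) : ‖ℓ t‖ ≤ lossMax ℓ t₁ t₂ := by
  rw [← coe_nnnorm]
  exact NNReal.coe_le_coe.2
    (Finset.le_sup (f := fun t => ‖ℓ t‖₊) (Finset.mem_Icc.2 ⟨h₁, h₂⟩))

lemma lossMax_le_lossMax {t₁ t₂ s₁ s₂ : ℕ} (h₁ : s₁ ≤ t₁) (h₂ : t₂ ≤ s₂) :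
    lossMax ℓ t₁ t₂ ≤ lossMax ℓ s₁ s₂ :=
  NNReal.coe_le_coe.2 (Finset.sup_mono (Finset.Icc_subset_Icc h₁ h₂))

lemma lossMax_zero_zero : lossMax ℓ 0 0 = ‖ℓ 0‖ := by simp [lossMax]

lemma lossMax_zero_succ (t : ℕ) : lossMax ℓ 0 (t + 1) = max (lossMax ℓ 0 t) ‖ℓ (t + 1)‖ := by
  have : Finset.Icc 0 (t + 1) = insert (t + 1) (Finset.Icc 0 t) := by
    ext; simp only [Finset.mem_Icc, Finset.mem_insert]; omega
  rw [lossMax, this, Finset.sup_insert, sup_comm, NNReal.coe_max, coe_nnnorm, lossMax]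

end LossMax

section Projection

variable {X : Type u} {A : Type v} [Fintype X] [Fintype A]

lemma euclProj_spec {S : Set (EuclideanSpace ℝ (X × A))} (hS : IsCompact S) (hne : S.Nonempty)
    (y : EuclideanSpace ℝ (X × A)) :
    euclProj S y ∈ S ∧ ∀ z ∈ S, dist y (euclProj S y) ≤ dist y z := by
  have : ∃ z, z ∈ S ∧ ∀ z' ∈ S, dist y z ≤ dist y z' := by
    obtain ⟨z, hz, hm⟩ := hS.exists_isMinOn hne (f := fun z => dist y z) (by fun_prop)
    exact ⟨z, hz, fun z' hz' => hm hz'⟩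
  exact Classical.epsilon_spec this

/-- The variational inequality of the projection: seen from the projected point, `y` and `q` form an
angle that is not acute. -/
lemma norm_euclProj_sub_le {S : Set (EuclideanSpace ℝ (X × A))} (hS : IsCompact S)
    (hc : Convex ℝ S) (y : EuclideanSpace ℝ (X × A)) {q : EuclideanSpace ℝ (X × A)} (hq : q ∈ S) :
    ‖euclProj S y - q‖ ≤ ‖y - q‖ := by
  obtain ⟨hz, hmin⟩ := euclProj_spec hS ⟨q, hq⟩ y
  set z := euclProj S y
  have : Nonempty S := ⟨⟨q, hq⟩⟩
  have h : ‖y - z‖ = ⨅ w : S, ‖y - w‖ := by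
    refine le_antisymm (le_ciInf fun w => ?_) (ciInf_le ⟨0, ?_⟩ (⟨z, hz⟩ : S))
    · simpa [dist_eq_norm] using hmin w w.2
    · rintro _ ⟨w, rfl⟩; exact norm_nonneg _
  have hi := (norm_eq_iInf_iff_real_inner_le_zero hc hz).1 h q hq
  have e : ‖y - q‖ ^ 2 = ‖y - z‖ ^ 2 - 2 * inner ℝ (y - z) (q - z) + ‖z - q‖ ^ 2 := by
    rw [show y - q = (y - z) - (q - z) by abel, norm_sub_sq_real, norm_sub_rev q z]
  refine le_of_sq_le_sq ?_ (norm_nonneg _)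
  nlinarith [sq_nonneg ‖y - z‖]

end Projection

section Diameter

variable {X : Type u} {A : Type v} {L : ℕ} [Fintype X] [Fintype A] [DecidableEq X] [DecidableEq A]
  {Λ : Layering X L}

lemma occ_le_one {P : X → A → X → ℝ} {π : X → A → ℝ} (hP : IsTransition Λ P) (hπ : IsPolicy π)
    (p : X × A) : occ Λ P π p ≤ 1 := by
  rcases lt_or_eq_of_le (Λ.layer_le p.1) with h | h
  · rw [← Prod.mk.eta (p := p), occ_of_lt hP hπ h]
    refine mul_le_one₀ ?_ (hπ.nonneg _ _) (hπ.le_one _ _)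
    rw [← sum_stateOcc hP hπ h.le]
    exact Finset.single_le_sum (f := stateOcc Λ P π (Λ.layer p.1))
      (fun y _ => stateOcc_nonneg hP hπ _ y) (Finset.mem_univ p.1)
  · rw [← Prod.mk.eta (p := p), occ_of_last h]
    norm_num

/-- All coordinates lie in `[0, 1]`, so `(u - v)² ≤ u + v`, and the coordinates of each occupancy
measure sum to `L`. -/
lemma norm_sub_sq_le_of_mem_occSet {Ps Ps' : Set (X → A → X → ℝ)}
    (hPs : ∀ P ∈ Ps, IsTransition Λ P) (hPs' : ∀ P ∈ Ps', IsTransition Λ P)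
    {q q' : EuclideanSpace ℝ (X × A)} (hq : q ∈ occSet Λ Ps) (hq' : q' ∈ occSet Λ Ps') :
    ‖q - q'‖ ^ 2 ≤ 2 * L := by
  obtain ⟨P, hP, π, hπ, rfl⟩ := hq
  obtain ⟨P', hP', π', hπ', rfl⟩ := hq'
  replace hP := hPs P hP
  replace hP' := hPs' P' hP'
  rw [EuclideanSpace.norm_sq_eq]
  calc ∑ p, ‖(occ Λ P π - occ Λ P' π') p‖ ^ 2
      ≤ ∑ p, (occ Λ P π p + occ Λ P' π' p) := by
        refine Finset.sum_le_sum fun p _ => ?_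
        rw [Real.norm_eq_abs, sq_abs, PiLp.sub_apply]
        have a0 := occ_nonneg hP hπ p
        have a1 := occ_le_one hP hπ p
        have b0 := occ_nonneg hP' hπ' p
        have b1 := occ_le_one hP' hπ' p
        nlinarith
    _ = 2 * L := by rw [Finset.sum_add_distrib, sum_occ hP hπ, sum_occ hP' hπ']; ring

end Diameter

section Run

variable {X : Type u} {A : Type v} {L : ℕ} [Fintype X] [Fintype A] [DecidableEq X] [DecidableEq A]

/-- The states of UC-O-GDPS along a sequence of trajectories and losses. -/
noncomputable def ucRun (Λ : Layering X L) (C : ℝ) (T : ℕ) (δ : ℝ) (τ : ℕ → Trajectory X A L)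
    (ℓ : ℕ → X × A → ℝ) : ℕ → UCState X A
  | 0 => UCState.init Λ
  | n + 1 => (ucRun Λ C T δ τ ℓ n).update Λ C T δ (τ n, ℓ n)

lemma ucState_history {Ω : Type w} (Λ : Layering X L) (C : ℝ) (T : ℕ) (δ : ℝ)
    (traj : ℕ → Ω → Trajectory X A L) (loss : ℕ → Ω → X × A → ℝ) (n : ℕ) (ω : Ω) :
    ucState Λ C T δ (history traj loss n ω) =
      ucRun Λ C T δ (fun n => traj n ω) (fun n => loss n ω) n := by
  induction n with
  | zero => rfl
  | succ n ih =>
    rw [ucRun, ← ih]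
    simp [ucState, history, List.range_succ]

variable {Λ : Layering X L} {C : ℝ} {T : ℕ} {δ : ℝ} {τ : ℕ → Trajectory X A L}
  {ℓ : ℕ → X × A → ℝ}

lemma ucRun_maxLoss_succ (n : ℕ) : (ucRun Λ C T δ τ ℓ (n + 1)).maxLoss = lossMax ℓ 0 n := by
  have h : ∀ n, (ucRun Λ C T δ τ ℓ (n + 1)).maxLoss = max (ucRun Λ C T δ τ ℓ n).maxLoss ‖ℓ n‖ :=
    fun _ => rfl
  induction n with
  | zero =>
    rw [h, lossMax_zero_zero]
    exact max_eq_right (norm_nonneg _)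
  | succ n ih => rw [h, ih, lossMax_zero_succ]

/-- The step after episode `n` is scaled by a maximum that already includes `‖ℓ n‖`, which the
regret bound relies on. -/
lemma ucRun_qhat_succ (n : ℕ) : (ucRun Λ C T δ τ ℓ (n + 1)).qhat =
    euclProj (occSet Λ ((ucRun Λ C T δ τ ℓ (n + 1)).confSet Λ T δ))
      ((ucRun Λ C T δ τ ℓ n).qhat - (1 / (lossMax ℓ 0 n * C * √T)) • WithLp.toLp 2 (ℓ n)) := by
  rw [← ucRun_maxLoss_succ (Λ := Λ) (C := C) (T := T) (δ := δ) (τ := τ)]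
  rfl

/-- The element `P` only witnesses that the confidence set is nonempty, so that the projection is
attained. -/
lemma ucRun_qhat_mem [Nonempty A] {P : X → A → X → ℝ} {n : ℕ}
    (hP : P ∈ (ucRun Λ C T δ τ ℓ n).confSet Λ T δ) :
    (ucRun Λ C T δ τ ℓ n).qhat ∈ occSet Λ ((ucRun Λ C T δ τ ℓ n).confSet Λ T δ) := by
  cases n with
  | zero =>
    rw [mem_occSet_iff fun P hP => hP.1]
    exact ⟨uniformTransition Λ, ⟨isTransition_uniformTransition Λ, fun h => absurd rfl h⟩,
      isFlow_init_qhat Λ⟩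
  | succ n =>
    have hne : (occSet Λ ((ucRun Λ C T δ τ ℓ (n + 1)).confSet Λ T δ)).Nonempty :=
      ⟨_, P, hP, _, isPolicy_inducedPolicy (isFlow_init_qhat Λ).nonneg, rfl⟩
    rw [ucRun_qhat_succ]
    exact (euclProj_spec (isCompact_occSet (isCompact_confSet Λ T δ _)) hne _).1

/-- The regret of the iterates of UC-O-GDPS, as if they were the occupancy measures played. -/
lemma sum_loss_qhat_sub_le [Nonempty A] (hC : 0 < C) (hT : 0 < T) {P : X → A → X → ℝ}
    (hP : ∀ n < T, P ∈ (ucRun Λ C T δ τ ℓ n).confSet Λ T δ) {q : EuclideanSpace ℝ (X × A)}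
    (hq : ∀ n < T, q ∈ occSet Λ ((ucRun Λ C T δ τ ℓ n).confSet Λ T δ)) {t₁ t₂ : ℕ}
    (ht : t₁ ≤ t₂) (htT : t₂ < T) :
    ∑ t ∈ Finset.Icc t₁ t₂, ∑ p, ℓ t p * ((ucRun Λ C T δ τ ℓ t).qhat p - q p) ≤
      lossMax ℓ 0 t₂ * L * C * √T +
        lossMax ℓ t₁ t₂ * ((Fintype.card X : ℝ) * Fintype.card A / 2) *
          (((t₂ : ℝ) - t₁ + 1) / (C * √T)) := by
  have hsT : 0 < √(T : ℝ) := Real.sqrt_pos.2 (by exact_mod_cast hT)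
  have hCT : 0 < C * √T := mul_pos hC hsT
  have h := sum_inner_le_of_descent (fun t => (ucRun Λ C T δ τ ℓ t).qhat)
    (fun t => WithLp.toLp 2 (ℓ t)) q (fun t => lossMax ℓ 0 t * C * √T) (2 * L) ht
    (fun s t hst => by
      dsimp only
      gcongr
      exact lossMax_le_lossMax ℓ le_rfl hst)
    (fun t => by have := lossMax_nonneg ℓ 0 t; positivity)
    (fun t h0 => by
      have : lossMax ℓ 0 t = 0 := by
        rcases mul_eq_zero.1 h0 with h | h
        · exact (mul_eq_zero.1 h).resolve_right hC.ne'
        · exact absurd h hsT.ne'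
      have h1 := norm_le_lossMax ℓ (Nat.zero_le t) le_rfl
      rw [this] at h1
      rw [norm_le_zero_iff.1 h1]
      rfl)
    (fun t h => norm_sub_sq_le_of_mem_occSet (fun P hP => hP.1) (fun P hP => hP.1)
      (ucRun_qhat_mem (hP t (by omega))) (hq t (by omega)))
    (fun t h => by
      rw [ucRun_qhat_succ]
      exact norm_euclProj_sub_le (isCompact_occSet (isCompact_confSet Λ T δ _))
        (convex_occSet_confSet Λ T δ _) _ (hq (t + 1) (by omega)))
  have e : ∀ t, inner ℝ (WithLp.toLp 2 (ℓ t) : EuclideanSpace ℝ (X × A))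
      ((ucRun Λ C T δ τ ℓ t).qhat - q) = ∑ p, ℓ t p * ((ucRun Λ C T δ τ ℓ t).qhat p - q p) := by
    intro t
    simp [PiLp.inner_apply, mul_comm]
  simp only [e] at h
  refine h.trans (add_le_add (le_of_eq (by ring)) ?_)
  -- Of the two factors `‖ℓ t‖`, one is bounded by the maximum over the interval, and the other
  -- cancels against `lossMax ℓ 0 t`.
  have hterm : ∀ t ∈ Finset.Icc t₁ t₂,
      ‖(WithLp.toLp 2 (ℓ t) : EuclideanSpace ℝ (X × A))‖ ^ 2 / (2 * (lossMax ℓ 0 t * C * √T)) ≤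
        lossMax ℓ t₁ t₂ * ((Fintype.card X : ℝ) * Fintype.card A / 2) * (1 / (C * √T)) := by
    intro t htm
    obtain ⟨h1, h2⟩ := Finset.mem_Icc.1 htm
    have a : ‖(WithLp.toLp 2 (ℓ t) : EuclideanSpace ℝ (X × A))‖ ^ 2 ≤
        (Fintype.card X : ℝ) * Fintype.card A * ‖ℓ t‖ ^ 2 := by
      rw [EuclideanSpace.norm_sq_eq]
      calc ∑ p, ‖ℓ t p‖ ^ 2 ≤ ∑ _p : X × A, ‖ℓ t‖ ^ 2 := Finset.sum_le_sum fun p _ =>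
            pow_le_pow_left₀ (norm_nonneg _) (norm_le_pi_norm (ℓ t) p) 2
        _ = _ := by simp [Fintype.card_prod]
    have b := norm_le_lossMax ℓ h1 h2
    have c := norm_le_lossMax ℓ (Nat.zero_le t) le_rfl
    -- If all losses so far vanish, the quotient has denominator zero and equals zero.
    rcases (lossMax_nonneg ℓ 0 t).eq_or_lt with h0 | h0
    · rw [← h0]
      have := lossMax_nonneg ℓ t₁ t₂
      simp only [zero_mul, mul_zero, div_zero]
      positivity
    · rw [div_le_iff₀ (by positivity)]
      refine a.trans ?_
      rw [show lossMax ℓ t₁ t₂ * ((Fintype.card X : ℝ) * Fintype.card A / 2) * (1 / (C * √T)) *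
        (2 * (lossMax ℓ 0 t * C * √T)) =
          (Fintype.card X : ℝ) * Fintype.card A * (lossMax ℓ t₁ t₂ * lossMax ℓ 0 t) by field_simp]
      have := mul_le_mul b c (norm_nonneg _) (lossMax_nonneg ℓ t₁ t₂)
      rw [sq]
      gcongr
  refine (Finset.sum_le_sum hterm).trans (le_of_eq ?_)
  rw [Finset.sum_const, Nat.card_Icc, nsmul_eq_mul, Nat.cast_sub (by omega)]
  push_cast
  ring

end Run
-- Visit counts and epochs
section Counts

variable {X : Type u} {A : Type v} {L : ℕ} [DecidableEq X] [DecidableEq A]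

/-- The number of visits of a pair in one trajectory. -/
def Trajectory.visits (τ : Trajectory X A L) (x : X) (a : A) : ℕ :=
  (Finset.univ.filter fun k : Fin L => τ.state k.castSucc = x ∧ τ.action k = a).card

/-- The number of visits of a triple in one trajectory. -/
def Trajectory.visits' (τ : Trajectory X A L) (x : X) (a : A) (x' : X) : ℕ :=
  (Finset.univ.filter fun k : Fin L =>
    τ.state k.castSucc = x ∧ τ.action k = a ∧ τ.state k.succ = x').card

/-- The trajectory goes from layer to layer. -/
def Trajectory.IsLayered (Λ : Layering X L) (τ : Trajectory X A L) : Prop :=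
  ∀ j, Λ.layer (τ.state j) = j

variable {Λ : Layering X L}

omit [DecidableEq X] [DecidableEq A] in
lemma card_filter_eq_ite {ι : Type*} [Fintype ι] (p : ι → Prop) [DecidablePred p] (i : ι)
    (h : ∀ k, p k → k = i) : (Finset.univ.filter p).card = if p i then 1 else 0 := by
  split_ifs with hi
  · rw [Finset.card_eq_one]
    exact ⟨i, by ext k; simp only [Finset.mem_filter_univ, Finset.mem_singleton]
                 exact ⟨h k, fun hk => hk ▸ hi⟩⟩
  · rw [Finset.card_eq_zero, Finset.filter_eq_empty_iff]
    exact fun k _ hk => hi (h k hk ▸ hk)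

/-- A layered trajectory can be in `x` only at time `Λ.layer x`. -/
lemma Trajectory.IsLayered.visits_eq {τ : Trajectory X A L} (h : τ.IsLayered Λ) {x : X}
    (hx : Λ.layer x < L) (a : A) : τ.visits x a =
      if τ.state (⟨Λ.layer x, hx⟩ : Fin L).castSucc = x ∧ τ.action ⟨Λ.layer x, hx⟩ = a
      then 1 else 0 :=
  card_filter_eq_ite (fun k : Fin L => τ.state k.castSucc = x ∧ τ.action k = a) _
    fun k hk => Fin.ext ((h k.castSucc).symm.trans (congrArg Λ.layer hk.1))

lemma Trajectory.IsLayered.visits'_eq {τ : Trajectory X A L} (h : τ.IsLayered Λ) {x : X}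
    (hx : Λ.layer x < L) (a : A) (x' : X) : τ.visits' x a x' =
      if τ.state (⟨Λ.layer x, hx⟩ : Fin L).castSucc = x ∧ τ.action ⟨Λ.layer x, hx⟩ = a ∧
        τ.state (⟨Λ.layer x, hx⟩ : Fin L).succ = x' then 1 else 0 :=
  card_filter_eq_ite (fun k : Fin L => τ.state k.castSucc = x ∧ τ.action k = a ∧
    τ.state k.succ = x') _ fun k hk => Fin.ext ((h k.castSucc).symm.trans (congrArg Λ.layer hk.1))

lemma Trajectory.IsLayered.visits_of_last {τ : Trajectory X A L} (h : τ.IsLayered Λ) {x : X}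
    (hx : Λ.layer x = L) (a : A) : τ.visits x a = 0 := by
  rw [Trajectory.visits, Finset.card_eq_zero, Finset.filter_eq_empty_iff]
  rintro k - ⟨hk, -⟩
  have := h k.castSucc
  rw [hk, hx, Fin.val_castSucc] at this
  omega

lemma Trajectory.IsLayered.visits_le_one {τ : Trajectory X A L} (h : τ.IsLayered Λ) (x : X)
    (a : A) : τ.visits x a ≤ 1 := by
  rcases lt_or_eq_of_le (Λ.layer_le x) with hx | hx
  · rw [h.visits_eq hx]; split_ifs <;> norm_num
  · rw [h.visits_of_last hx]; norm_num

lemma Trajectory.visits'_le (τ : Trajectory X A L) (x : X) (a : A) (x' : X) :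
    τ.visits' x a x' ≤ τ.visits x a :=
  Finset.card_le_card (Finset.monotone_filter_right _ fun _ _ h => ⟨h.1, h.2.1⟩)

lemma Trajectory.IsLayered.visits'_of_layer_ne {τ : Trajectory X A L} (h : τ.IsLayered Λ)
    {x x' : X} (hx : Λ.layer x' ≠ Λ.layer x + 1) (a : A) : τ.visits' x a x' = 0 := by
  rw [Trajectory.visits', Finset.card_eq_zero, Finset.filter_eq_empty_iff]
  rintro k - ⟨hk, -, hk'⟩
  have h1 := h k.castSucc
  have h2 := h k.succ
  rw [hk, Fin.val_castSucc] at h1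
  rw [hk', Fin.val_succ] at h2
  omega

variable [Fintype X] [Fintype A]

lemma Trajectory.sum_visits_mul (τ : Trajectory X A L) (h : X × A → ℝ) :
    ∑ k : Fin L, h (τ.state k.castSucc, τ.action k) = ∑ p : X × A, τ.visits p.1 p.2 * h p := by
  rw [← Finset.sum_fiberwise_of_maps_to (t := Finset.univ)
    (g := fun k : Fin L => (τ.state k.castSucc, τ.action k)) (fun _ _ => Finset.mem_univ _)]
  refine Finset.sum_congr rfl fun p _ => ?_
  rw [Finset.sum_congr rfl (g := fun _ => h p)
    fun k hk => by rw [(Finset.mem_filter.1 hk).2], Finset.sum_const, nsmul_eq_mul]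
  simp only [Prod.ext_iff, Trajectory.visits]

lemma Trajectory.IsLayered.sum_visits_layer_le {τ : Trajectory X A L} (h : τ.IsLayered Λ) (k : ℕ) :
    ∑ p ∈ Λ.layerSet k ×ˢ (Finset.univ : Finset A), τ.visits p.1 p.2 ≤ 1 := by
  have e := τ.sum_visits_mul fun p => if Λ.layer p.1 = k then 1 else 0
  have : (∑ p ∈ Λ.layerSet k ×ˢ (Finset.univ : Finset A), τ.visits p.1 p.2 : ℝ) ≤ 1 := by
    have s : (Finset.univ.filter fun p : X × A => Λ.layer p.1 = k) =
        Λ.layerSet k ×ˢ (Finset.univ : Finset A) := by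
      ext p; simp [mem_layerSet]
    simp only [mul_ite, mul_one, mul_zero] at e
    rw [← s, Finset.sum_filter, ← e]
    simp only [h _, Fin.val_castSucc]
    rw [Finset.sum_boole]
    have : (Finset.univ.filter fun j : Fin L => (j : ℕ) = k).card ≤ 1 :=
      Finset.card_le_one.2 fun i hi j hj => Fin.ext
        ((Finset.mem_filter.1 hi).2.trans (Finset.mem_filter.1 hj).2.symm)
    exact_mod_cast this
  exact_mod_cast this

variable {C : ℝ} {T : ℕ} {δ : ℝ} {τ : ℕ → Trajectory X A L} {ℓ : ℕ → X × A → ℝ}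

lemma ucRun_visits (n : ℕ) (x : X) (a : A) :
    (ucRun Λ C T δ τ ℓ n).visits x a = ∑ i ∈ Finset.range n, (τ i).visits x a := by
  induction n with
  | zero => rfl
  | succ n ih => rw [Finset.sum_range_succ, ← ih]; rfl

lemma ucRun_visits' (n : ℕ) (x : X) (a : A) (x' : X) :
    (ucRun Λ C T δ τ ℓ n).visits' x a x' = ∑ i ∈ Finset.range n, (τ i).visits' x a x' := by
  induction n with
  | zero => rfl
  | succ n ih => rw [Finset.sum_range_succ, ← ih]; rfl

/-- The condition for the start of a new epoch after the trajectory `σ`. -/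
def UCState.NewEpoch (s : UCState X A) (σ : Trajectory X A L) : Prop :=
  ∃ k : Fin L, max 1 (2 * s.initVisits (σ.state k.castSucc) (σ.action k)) ≤
    s.visits (σ.state k.castSucc) (σ.action k) + σ.visits (σ.state k.castSucc) (σ.action k)

lemma UCState.update_of_newEpoch {s : UCState X A} {o : Trajectory X A L × (X × A → ℝ)}
    (h : s.NewEpoch o.1) :
    (s.update Λ C T δ o).epoch = s.epoch + 1 ∧
      (s.update Λ C T δ o).initVisits = (s.update Λ C T δ o).visits ∧
      (s.update Λ C T δ o).initVisits' = (s.update Λ C T δ o).visits' :=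
  ⟨if_pos h, if_pos h, if_pos h⟩

lemma UCState.update_of_not_newEpoch {s : UCState X A} {o : Trajectory X A L × (X × A → ℝ)}
    (h : ¬ s.NewEpoch o.1) :
    (s.update Λ C T δ o).epoch = s.epoch ∧
      (s.update Λ C T δ o).initVisits = s.initVisits ∧
      (s.update Λ C T δ o).initVisits' = s.initVisits' :=
  ⟨if_neg h, if_neg h, if_neg h⟩

/-- The counts frozen at the start of an epoch are those after some number `m` of episodes. A bound
that holds for all `m` thus covers the random epoch starts. -/
lemma ucRun_init_eq (n : ℕ) : ∃ m ≤ n,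
    (ucRun Λ C T δ τ ℓ n).initVisits = (ucRun Λ C T δ τ ℓ m).visits ∧
    (ucRun Λ C T δ τ ℓ n).initVisits' = (ucRun Λ C T δ τ ℓ m).visits' := by
  induction n with
  | zero => exact ⟨0, le_rfl, rfl, rfl⟩
  | succ n ih =>
    by_cases h : (ucRun Λ C T δ τ ℓ n).NewEpoch (τ n)
    · exact ⟨n + 1, le_rfl, (UCState.update_of_newEpoch (o := (τ n, ℓ n)) h).2⟩
    · obtain ⟨m, hm, h1, h2⟩ := ih
      have e := (UCState.update_of_not_newEpoch (Λ := Λ) (C := C) (T := T) (δ := δ)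
        (o := (τ n, ℓ n)) h).2
      exact ⟨m, hm.trans n.le_succ, e.1.trans h1, e.2.trans h2⟩

/-- Allows the first epoch, whose set is unconstrained, to be treated with the radius for zero
visits. -/
lemma ucRun_initVisits_of_epoch_eq_one (n : ℕ) : 1 ≤ (ucRun Λ C T δ τ ℓ n).epoch ∧
    ((ucRun Λ C T δ τ ℓ n).epoch = 1 → ∀ x a, (ucRun Λ C T δ τ ℓ n).initVisits x a = 0) := by
  induction n with
  | zero => exact ⟨le_rfl, fun _ _ _ => rfl⟩
  | succ n ih =>
    by_cases h : (ucRun Λ C T δ τ ℓ n).NewEpoch (τ n)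
    · have e := (UCState.update_of_newEpoch (Λ := Λ) (C := C) (T := T) (δ := δ)
        (o := (τ n, ℓ n)) h).1
      refine ⟨by rw [ucRun, e]; omega, fun h1 => ?_⟩
      rw [ucRun, e] at h1
      omega
    · have e := UCState.update_of_not_newEpoch (Λ := Λ) (C := C) (T := T) (δ := δ)
        (o := (τ n, ℓ n)) h
      rw [ucRun, e.1, e.2.1]
      exact ih

/-- In an epoch no number of visits exceeds twice its initial value, if that is positive. -/
lemma ucRun_visits_succ_le (n : ℕ) (x : X) (a : A) : (ucRun Λ C T δ τ ℓ n).visits x a + 1 ≤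
    2 * max 1 ((ucRun Λ C T δ τ ℓ n).initVisits x a) := by
  induction n with
  | zero => simp [ucRun, UCState.init]
  | succ n ih =>
    by_cases h : (ucRun Λ C T δ τ ℓ n).NewEpoch (τ n)
    · have e := (UCState.update_of_newEpoch (Λ := Λ) (C := C) (T := T) (δ := δ)
        (o := (τ n, ℓ n)) h).2.1
      rw [ucRun, e]
      omega
    · have e := (UCState.update_of_not_newEpoch (Λ := Λ) (C := C) (T := T) (δ := δ)
        (o := (τ n, ℓ n)) h).2.1
      have e' : (ucRun Λ C T δ τ ℓ (n + 1)).visits x a =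
        (ucRun Λ C T δ τ ℓ n).visits x a + (τ n).visits x a := rfl
      rw [e', ucRun, e]
      -- An unvisited pair keeps its count; for a visited pair the claim is the failure of the
      -- criterion for a new epoch.
      by_cases hv : (τ n).visits x a = 0
      · rwa [hv]
      · obtain ⟨k, hk⟩ := Finset.card_pos.1 (Nat.pos_of_ne_zero hv)
        obtain ⟨hx, ha⟩ := (Finset.mem_filter.1 hk).2
        have : ¬ max 1 (2 * (ucRun Λ C T δ τ ℓ n).initVisits x a) ≤
            (ucRun Λ C T δ τ ℓ n).visits x a + (τ n).visits x a :=
          fun h' => h ⟨k, by rw [hx, ha]; exact h'⟩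
        omega

end Counts

/-! ### Confidence radii and widths -/

section Radius

variable {X : Type u} {A : Type v} {L : ℕ} [Fintype X] [Fintype A] [DecidableEq X] [DecidableEq A]
  {Λ : Layering X L} {C : ℝ} {T : ℕ} {δ : ℝ} {τ : ℕ → Trajectory X A L} {ℓ : ℕ → X × A → ℝ}

/-- The logarithm in the confidence radius. -/
noncomputable def logFactor (X : Type u) (A : Type v) [Fintype X] [Fintype A] (T : ℕ) (δ : ℝ) : ℝ :=
  Real.log ((T : ℝ) * Fintype.card X * Fintype.card A / δ)

omit [Fintype A] [DecidableEq X] [DecidableEq A] in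
lemma two_le_card (Λ : Layering X L) : 2 ≤ Fintype.card X := by
  obtain ⟨x, hx, -⟩ := Λ.first_unique
  obtain ⟨y, hy, -⟩ := Λ.last_unique
  have := Λ.pos
  exact Fintype.one_lt_card_iff.2 ⟨x, y, fun h => by rw [h] at hx; omega⟩

omit [DecidableEq X] [DecidableEq A] in
lemma log_two_le_logFactor [Nonempty A] (Λ : Layering X L) (hT : 0 < T) (hδ0 : 0 < δ)
    (hδ1 : δ ≤ 1) : Real.log 2 ≤ logFactor X A T δ := by
  refine Real.log_le_log two_pos ?_
  rw [le_div_iff₀ hδ0]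
  have h1 : (2 : ℝ) ≤ Fintype.card X := by exact_mod_cast two_le_card Λ
  have h2 : (1 : ℝ) ≤ T := by exact_mod_cast hT
  have h3 : (1 : ℝ) ≤ Fintype.card A := by exact_mod_cast Fintype.card_pos
  have h4 : (2 : ℝ) ≤ T * Fintype.card X := by nlinarith
  nlinarith

/-- The confidence radius as a function of the number of visits. -/
noncomputable def confRadius (Λ : Layering X L) (A : Type v) [Fintype A] (T : ℕ) (δ : ℝ) (x : X)
    (N : ℕ) : ℝ :=
  √(2 * ((Λ.layerSet (Λ.layer x + 1)).card : ℝ) * logFactor X A T δ / max 1 (N : ℝ))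

omit [DecidableEq X] [DecidableEq A] in
lemma UCState.radius_eq (s : UCState X A) (x : X) (a : A) :
    s.radius Λ T δ x a = confRadius Λ A T δ x (s.initVisits x a) := rfl

omit [DecidableEq X] [DecidableEq A] in
-- Because `2 log 2 > 1`. Without visits the confidence constraint is therefore harmless: twice the
-- radius exceeds the `ℓ¹` distance of any two distributions.
lemma one_le_confRadius_zero [Nonempty A] (hT : 0 < T) (hδ0 : 0 < δ) (hδ1 : δ ≤ 1) {x : X}
    (hx : Λ.layer x < L) : 1 ≤ confRadius Λ A T δ x 0 := by
  rw [confRadius, Real.one_le_sqrt]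
  have h1 := log_two_le_logFactor (A := A) Λ hT hδ0 hδ1
  have h2 := Real.log_two_gt_d9
  have h3 : (1 : ℝ) ≤ (Λ.layerSet (Λ.layer x + 1)).card := by
    exact_mod_cast card_layerSet_pos Λ (k := Λ.layer x + 1) (by omega)
  simp only [Nat.cast_zero, max_eq_left (zero_le_one' ℝ), div_one]
  nlinarith

/-- Bounds on the visits so far give that the true transition function is in the confidence set. -/
lemma mem_confSet_of_forall {P : X → A → X → ℝ} (hP : IsTransition Λ P)
    (hlay : ∀ n < T, (τ n).IsLayered Λ)
    (hdev : ∀ m < T, ∀ x a, Λ.layer x < L →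
      ∑ x', |P x a x' - ((∑ i ∈ Finset.range m, (τ i).visits' x a x' : ℕ) : ℝ) /
        max 1 ((∑ i ∈ Finset.range m, (τ i).visits x a : ℕ) : ℝ)| ≤
      confRadius Λ A T δ x (∑ i ∈ Finset.range m, (τ i).visits x a))
    {n : ℕ} (hn : n < T) : P ∈ (ucRun Λ C T δ τ ℓ n).confSet Λ T δ := by
  refine ⟨hP, fun _ x a => ?_⟩
  obtain ⟨m, hm, h1, h2⟩ := ucRun_init_eq (Λ := Λ) (C := C) (T := T) (δ := δ) (τ := τ) (ℓ := ℓ) n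
  rw [UCState.radius_eq, h1, ucRun_visits]
  simp only [UCState.empirical, h1, h2, ucRun_visits, ucRun_visits']
  rcases lt_or_eq_of_le (Λ.layer_le x) with hx | hx
  · exact hdev m (by omega) x a hx
  · rw [Finset.sum_eq_zero]
    · exact Real.sqrt_nonneg _
    · intro x' _
      have hne : Λ.layer x' ≠ Λ.layer x + 1 := by have := Λ.layer_le x'; omega
      have e1 : P x a x' = 0 := by
        by_contra h
        exact hne (hP.next_layer_of_ne h)
      rw [e1, Finset.sum_eq_zero fun i hi =>
        (hlay i (by have := Finset.mem_range.1 hi; omega)).visits'_of_layer_ne hne a]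
      simp

/-- A bound on the distance of two elements of the current confidence set. -/
noncomputable def confWidth (Λ : Layering X L) (T : ℕ) (δ : ℝ) (s : UCState X A) (p : X × A) : ℝ :=
  min 2 (2 * s.radius Λ T δ p.1 p.2)

omit [DecidableEq X] [DecidableEq A] in
lemma confWidth_nonneg (s : UCState X A) (p : X × A) : 0 ≤ confWidth Λ T δ s p :=
  le_min zero_le_two (mul_nonneg zero_le_two (Real.sqrt_nonneg _))

omit [DecidableEq X] [DecidableEq A] in
-- The truncation at `2` makes the width a bounded weight, to which Hoeffding's lemma applies.
lemma confWidth_le_two (s : UCState X A) (p : X × A) : confWidth Λ T δ s p ≤ 2 := min_le_left _ _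

/-- The triangle inequality through the empirical transition function. In the first epoch the
trivial bound `2` suffices, and from the last layer there are no transitions. -/
lemma sum_abs_sub_le_confWidth [Nonempty A] (hT : 0 < T) (hδ0 : 0 < δ) (hδ1 : δ ≤ 1) {n : ℕ}
    {P P' : X → A → X → ℝ} (hP : P ∈ (ucRun Λ C T δ τ ℓ n).confSet Λ T δ)
    (hP' : P' ∈ (ucRun Λ C T δ τ ℓ n).confSet Λ T δ) (p : X × A) :
    ∑ x', |P p.1 p.2 x' - P' p.1 p.2 x'| ≤ confWidth Λ T δ (ucRun Λ C T δ τ ℓ n) p := by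
  have h2 : ∑ x', |P p.1 p.2 x' - P' p.1 p.2 x'| ≤ 2 :=
    calc ∑ x', |P p.1 p.2 x' - P' p.1 p.2 x'| ≤ ∑ x', (P p.1 p.2 x' + P' p.1 p.2 x') := by
          refine Finset.sum_le_sum fun x' _ => abs_le.2 ⟨?_, ?_⟩ <;>
            linarith [hP.1.nonneg p.1 p.2 x', hP'.1.nonneg p.1 p.2 x']
      _ ≤ 2 := by
          rw [Finset.sum_add_distrib]
          linarith [hP.1.sum_le_one p.1 p.2, hP'.1.sum_le_one p.1 p.2]
  refine le_min h2 ?_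
  rcases lt_or_eq_of_le (Λ.layer_le p.1) with hx | hx
  · by_cases he : (ucRun Λ C T δ τ ℓ n).epoch = 1
    · rw [UCState.radius_eq, (ucRun_initVisits_of_epoch_eq_one n).2 he]
      linarith [one_le_confRadius_zero (A := A) hT hδ0 hδ1 hx]
    · have a1 := hP.2 he p.1 p.2
      have a2 := hP'.2 he p.1 p.2
      calc ∑ x', |P p.1 p.2 x' - P' p.1 p.2 x'|
          ≤ ∑ x', (|P p.1 p.2 x' - (ucRun Λ C T δ τ ℓ n).empirical p.1 p.2 x'| +
            |P' p.1 p.2 x' - (ucRun Λ C T δ τ ℓ n).empirical p.1 p.2 x'|) := by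
            refine Finset.sum_le_sum fun x' _ => ?_
            rw [abs_sub_comm (P' p.1 p.2 x')]
            exact abs_sub_le _ _ _
        _ ≤ _ := by rw [Finset.sum_add_distrib]; linarith
  · rw [Finset.sum_eq_zero]
    · exact mul_nonneg zero_le_two (Real.sqrt_nonneg _)
    · intro x' _
      have hne : Λ.layer x' ≠ Λ.layer p.1 + 1 := by have := Λ.layer_le x'; omega
      have e : ∀ Q : X → A → X → ℝ, IsTransition Λ Q → Q p.1 p.2 x' = 0 := fun Q hQ => by
        by_contra h
        exact hne (hQ.next_layer_of_ne h)
      rw [e P hP.1, e P' hP'.1]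
      simp

end Radius
-- Summing the widths over the observed visits
/-- The sum of `1 / √(N + 1)` over the visits is at most twice the root of their number. -/
lemma sum_div_sqrt_le (c : ℕ → ℕ) (T : ℕ) (hc : ∀ t < T, c t ≤ 1) :
    ∑ t ∈ Finset.range T, (c t : ℝ) / √((∑ i ∈ Finset.range t, c i : ℕ) + 1) ≤
      2 * √((∑ i ∈ Finset.range T, c i : ℕ) : ℝ) := by
  induction T with
  | zero => simp
  | succ T ih =>
    rw [Finset.sum_range_succ]
    refine (add_le_add (ih fun t ht => hc t (by omega)) le_rfl).trans ?_
    rw [Finset.sum_range_succ]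
    obtain h | h : c T = 0 ∨ c T = 1 := by have := hc T (by omega); omega
    · simp [h]
    · rw [h]
      set N : ℝ := ((∑ i ∈ Finset.range T, c i : ℕ) : ℝ) with hN
      have hN0 : 0 ≤ N := Nat.cast_nonneg _
      push_cast [← hN]
      have h1 : 0 < √(N + 1) := Real.sqrt_pos.2 (by linarith)
      have h2 := Real.sq_sqrt hN0
      have h3 := Real.sq_sqrt (show 0 ≤ N + 1 by linarith)
      -- This is `(√(N + 1) - √N)² ≥ 0` rearranged; the right side telescopes over the visits.
      have h4 : 1 / √(N + 1) ≤ 2 * √(N + 1) - 2 * √N := by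
        rw [div_le_iff₀ h1]
        nlinarith [sq_nonneg (√(N + 1) - √N)]
      rw [hN] at h4 ⊢
      push_cast at h4 ⊢
      linarith

section VisitSums

variable {X : Type u} {A : Type v} {L : ℕ} [Fintype X] [Fintype A] [DecidableEq X] [DecidableEq A]
  {Λ : Layering X L} {C : ℝ} {T : ℕ} {δ : ℝ} {τ : ℕ → Trajectory X A L} {ℓ : ℕ → X × A → ℝ}

/-- The current count is less than twice the frozen one (or `1`, if that is zero). Replacing the
frozen count costs a factor `√2`, and `2 * √2 * √2 = 4`. -/
lemma confWidth_le (hlog : 0 ≤ logFactor X A T δ) (n : ℕ) (p : X × A) :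
    confWidth Λ T δ (ucRun Λ C T δ τ ℓ n) p ≤
      4 * √((Λ.layerSet (Λ.layer p.1 + 1)).card * logFactor X A T δ) /
        √((∑ i ∈ Finset.range n, (τ i).visits p.1 p.2 : ℕ) + 1) := by
  refine (min_le_right _ _).trans ?_
  rw [UCState.radius_eq, confRadius, ← ucRun_visits (Λ := Λ) (C := C) (T := T) (δ := δ) (ℓ := ℓ)]
  have h := ucRun_visits_succ_le (Λ := Λ) (C := C) (T := T) (δ := δ) (τ := τ) (ℓ := ℓ) n p.1 p.2
  set N := (ucRun Λ C T δ τ ℓ n).visits p.1 p.2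
  set N' := (ucRun Λ C T δ τ ℓ n).initVisits p.1 p.2
  have h' : (N : ℝ) + 1 ≤ 2 * max 1 (N' : ℝ) := by exact_mod_cast h
  have hN : (0 : ℝ) < N + 1 := by positivity
  rw [mul_div_assoc (4 : ℝ), ← Real.sqrt_div (mul_nonneg (Nat.cast_nonneg _) hlog),
    show (4 : ℝ) = 2 * 2 by norm_num, mul_assoc (2 : ℝ) 2]
  refine mul_le_mul_of_nonneg_left ?_ (zero_le_two (α := ℝ))
  have e : ∀ z : ℝ, 2 * √z = √(4 * z) := fun z => by
    rw [show (4 : ℝ) = 2 ^ 2 by norm_num, Real.sqrt_mul (by positivity), Real.sqrt_sq zero_le_two]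
  rw [e]
  refine Real.sqrt_le_sqrt ?_
  rw [← mul_div_assoc, div_le_div_iff₀ (by positivity) hN]
  have : 0 ≤ ((Λ.layerSet (Λ.layer p.1 + 1)).card : ℝ) * logFactor X A T δ := by positivity
  nlinarith

/-- Cauchy–Schwarz over the pairs of a layer, whose visits number at most one per episode. -/
lemma sum_sqrt_visits_layer_le (hlay : ∀ n < T, (τ n).IsLayered Λ) (k : ℕ) :
    ∑ p ∈ Λ.layerSet k ×ˢ (Finset.univ : Finset A),
      √((∑ i ∈ Finset.range T, (τ i).visits p.1 p.2 : ℕ) : ℝ) ≤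
        √((Λ.layerSet k).card) * √(Fintype.card A * T) := by
  set S := Λ.layerSet k ×ˢ (Finset.univ : Finset A)
  have hcard : (S.card : ℝ) = (Λ.layerSet k).card * Fintype.card A := by
    simp [S, Finset.card_product]
  have htot : ∑ p ∈ S, ((∑ i ∈ Finset.range T, (τ i).visits p.1 p.2 : ℕ) : ℝ) ≤ T := by
    have : ∑ p ∈ S, ∑ i ∈ Finset.range T, (τ i).visits p.1 p.2 ≤ T := by
      rw [Finset.sum_comm]
      calc _ ≤ ∑ _i ∈ Finset.range T, 1 := Finset.sum_le_sum fun i hi =>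
            (hlay i (Finset.mem_range.1 hi)).sum_visits_layer_le k
        _ = T := by simp
    exact_mod_cast this
  rw [← Real.sqrt_mul (Nat.cast_nonneg _)]
  refine Real.le_sqrt_of_sq_le ?_
  refine (sq_sum_le_card_mul_sum_sq).trans ?_
  rw [hcard, ← mul_assoc]
  refine mul_le_mul_of_nonneg_left ?_ (by positivity)
  refine le_trans (le_of_eq ?_) htot
  exact Finset.sum_congr rfl fun p _ => Real.sq_sqrt (Nat.cast_nonneg _)

omit [Fintype A] [DecidableEq X] [DecidableEq A] in
lemma sum_card_layerSet (Λ : Layering X L) :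
    ∑ k ∈ Finset.range (L + 1), (Λ.layerSet k).card = Fintype.card X := by
  rw [← Finset.card_univ]
  exact (Finset.card_eq_sum_card_fiberwise fun x _ => by
    simpa [Nat.lt_succ_iff] using Λ.layer_le x).symm

omit [Fintype A] [DecidableEq X] [DecidableEq A] in
-- The arithmetic-geometric mean inequality; both families of layer sizes sum to at most the number
-- of states.
lemma sum_sqrt_mul_sqrt_card_layerSet_le (Λ : Layering X L) :
    ∑ k ∈ Finset.range (L + 1), √((Λ.layerSet (k + 1)).card : ℝ) * √((Λ.layerSet k).card : ℝ) ≤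
      Fintype.card X := by
  have h1 : ∑ k ∈ Finset.range (L + 1), ((Λ.layerSet k).card : ℝ) = Fintype.card X := by
    exact_mod_cast sum_card_layerSet Λ
  have h2 : ∑ k ∈ Finset.range (L + 1), ((Λ.layerSet (k + 1)).card : ℝ) ≤ Fintype.card X := by
    have e : Λ.layerSet (L + 1) = ∅ := Finset.eq_empty_of_forall_notMem fun y hy => by
      have := Λ.layer_le y
      rw [mem_layerSet] at hy
      omega
    have h3 := Finset.sum_range_succ' (fun k => ((Λ.layerSet k).card : ℝ)) (L + 1)
    rw [Finset.sum_range_succ, h1, e] at h3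
    have : (0 : ℝ) ≤ (Λ.layerSet 0).card := Nat.cast_nonneg _
    simp only [Finset.card_empty, Nat.cast_zero, add_zero] at h3
    linarith
  calc _ ≤ ∑ k ∈ Finset.range (L + 1),
        (((Λ.layerSet (k + 1)).card : ℝ) + (Λ.layerSet k).card) / 2 := by
        refine Finset.sum_le_sum fun k _ => ?_
        have a := Real.sq_sqrt (Nat.cast_nonneg (α := ℝ) (Λ.layerSet (k + 1)).card)
        have b := Real.sq_sqrt (Nat.cast_nonneg (α := ℝ) (Λ.layerSet k).card)
        nlinarith [sq_nonneg (√((Λ.layerSet (k + 1)).card : ℝ) - √((Λ.layerSet k).card : ℝ))]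
    _ ≤ _ := by
        rw [← Finset.sum_div, Finset.sum_add_distrib]
        linarith

/-- The widths of the confidence sets along the trajectories. -/
lemma sum_confWidth_visited_le (hlog : 0 ≤ logFactor X A T δ)
    (hlay : ∀ n < T, (τ n).IsLayered Λ) :
    ∑ t ∈ Finset.range T, ∑ k : Fin L, confWidth Λ T δ (ucRun Λ C T δ τ ℓ t)
        ((τ t).state k.castSucc, (τ t).action k) ≤
      6 * Fintype.card X * √(2 * T * Fintype.card A * logFactor X A T δ) := by
  set F := logFactor X A T δ
  have hp : ∀ p : X × A, ∑ t ∈ Finset.range T, ((τ t).visits p.1 p.2 : ℝ) *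
      confWidth Λ T δ (ucRun Λ C T δ τ ℓ t) p ≤
      8 * √F * (√((Λ.layerSet (Λ.layer p.1 + 1)).card : ℝ) *
        √((∑ i ∈ Finset.range T, (τ i).visits p.1 p.2 : ℕ) : ℝ)) := by
    intro p
    have h := sum_div_sqrt_le (fun t => (τ t).visits p.1 p.2) T
      fun t ht => (hlay t ht).visits_le_one p.1 p.2
    calc _ ≤ ∑ t ∈ Finset.range T, 4 * √((Λ.layerSet (Λ.layer p.1 + 1)).card * F) *
          (((τ t).visits p.1 p.2 : ℝ) /
            √((∑ i ∈ Finset.range t, (τ i).visits p.1 p.2 : ℕ) + 1)) := by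
          refine Finset.sum_le_sum fun t _ => ?_
          refine (mul_le_mul_of_nonneg_left (confWidth_le hlog t p) (Nat.cast_nonneg _)).trans
            (le_of_eq (by ring))
      _ ≤ 4 * √((Λ.layerSet (Λ.layer p.1 + 1)).card * F) *
          (2 * √((∑ i ∈ Finset.range T, (τ i).visits p.1 p.2 : ℕ) : ℝ)) := by
          rw [← Finset.mul_sum]
          exact mul_le_mul_of_nonneg_left h (by positivity)
      _ = _ := by rw [Real.sqrt_mul (Nat.cast_nonneg _)]; ring
  calc _ = ∑ p : X × A, ∑ t ∈ Finset.range T, ((τ t).visits p.1 p.2 : ℝ) *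
          confWidth Λ T δ (ucRun Λ C T δ τ ℓ t) p := by
        conv_rhs => rw [Finset.sum_comm]
        exact Finset.sum_congr rfl fun t _ => (τ t).sum_visits_mul _
    _ ≤ ∑ p : X × A, 8 * √F * (√((Λ.layerSet (Λ.layer p.1 + 1)).card : ℝ) *
        √((∑ i ∈ Finset.range T, (τ i).visits p.1 p.2 : ℕ) : ℝ)) :=
        Finset.sum_le_sum fun p _ => hp p
    _ = 8 * √F * ∑ k ∈ Finset.range (L + 1), ∑ p ∈ Λ.layerSet k ×ˢ (Finset.univ : Finset A),
        √((Λ.layerSet (k + 1)).card : ℝ) *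
          √((∑ i ∈ Finset.range T, (τ i).visits p.1 p.2 : ℕ) : ℝ) := by
        rw [← Finset.mul_sum, ← Finset.sum_fiberwise_of_maps_to (t := Finset.range (L + 1))
          (g := fun p : X × A => Λ.layer p.1)
          (fun p _ => Finset.mem_range.2 (Nat.lt_succ_of_le (Λ.layer_le p.1)))]
        congr 1
        refine Finset.sum_congr rfl fun k _ => Finset.sum_congr ?_ fun p hp => ?_
        · ext p; simp [mem_layerSet]
        · rw [Finset.mem_product, mem_layerSet] at hp
          rw [hp.1]
    _ ≤ 8 * √F * ∑ k ∈ Finset.range (L + 1), √((Λ.layerSet (k + 1)).card : ℝ) *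
        (√((Λ.layerSet k).card : ℝ) * √(Fintype.card A * T)) := by
        refine mul_le_mul_of_nonneg_left (Finset.sum_le_sum fun k _ => ?_) (by positivity)
        rw [← Finset.mul_sum]
        exact mul_le_mul_of_nonneg_left (sum_sqrt_visits_layer_le hlay k) (Real.sqrt_nonneg _)
    _ ≤ 8 * √F * (Fintype.card X * √(Fintype.card A * T)) := by
        simp only [← mul_assoc (√((Λ.layerSet _).card : ℝ)), ← Finset.sum_mul]
        gcongr
        exact sum_sqrt_mul_sqrt_card_layerSet_le Λ
    _ = 8 * Fintype.card X * √(T * Fintype.card A * F) := by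
        rw [mul_comm (T : ℝ), Real.sqrt_mul (show 0 ≤ (Fintype.card A : ℝ) * T by positivity) F]
        ring
    _ ≤ _ := by
        rw [show 2 * (T : ℝ) * Fintype.card A * F = 2 * (T * Fintype.card A * F) by ring,
          Real.sqrt_mul zero_le_two]
        -- The constant obtained is `8 = 4 * 2`; the factor `√2` from inside the root of the stated
        -- bound makes room for it.
        have h2 : 8 ≤ 6 * √2 := by
          have : (4 / 3 : ℝ) ≤ √2 := Real.le_sqrt_of_sq_le (by norm_num)
          linarith
        have h3 : 0 ≤ (Fintype.card X : ℝ) * √(T * Fintype.card A * F) := by positivity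
        nlinarith

end VisitSums

/-! ### The regret bound on a good event -/

section Regret

variable {X : Type u} {A : Type v} {L : ℕ} [Fintype X] [Fintype A] [DecidableEq X] [DecidableEq A]
  {Λ : Layering X L} {C : ℝ} {T : ℕ} {δ : ℝ} {τ : ℕ → Trajectory X A L} {ℓ : ℕ → X × A → ℝ}

omit [Fintype A] [DecidableEq X] [DecidableEq A] in
lemma succ_le_card (Λ : Layering X L) : L + 1 ≤ Fintype.card X := by
  rw [← sum_card_layerSet Λ]
  calc L + 1 = ∑ _k ∈ Finset.range (L + 1), 1 := by simp
    _ ≤ _ := Finset.sum_le_sum fun k hk =>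
      card_layerSet_pos Λ (Nat.lt_succ_iff.1 (Finset.mem_range.1 hk))

/-- The occupancy measure that UC-O-GDPS plays in episode `t`. -/
noncomputable def ucPlayed (Λ : Layering X L) (C : ℝ) (T : ℕ) (δ : ℝ) (P : X → A → X → ℝ)
    (τ : ℕ → Trajectory X A L) (ℓ : ℕ → X × A → ℝ) (t : ℕ) : EuclideanSpace ℝ (X × A) :=
  occ Λ P (inducedPolicy (ucRun Λ C T δ τ ℓ t).qhat)

/-- The iterate is the occupancy measure of its own induced policy under some `P'` in the confidence
set; the played measure belongs to the same policy under `P`. -/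
lemma sum_abs_ucPlayed_sub_qhat_le [Nonempty A] (hT : 0 < T) (hδ0 : 0 < δ) (hδ1 : δ ≤ 1)
    {P : X → A → X → ℝ} {n : ℕ} (hP : P ∈ (ucRun Λ C T δ τ ℓ n).confSet Λ T δ) :
    ∑ p, |ucPlayed Λ C T δ P τ ℓ n p - (ucRun Λ C T δ τ ℓ n).qhat p| ≤
      L * ∑ p, ucPlayed Λ C T δ P τ ℓ n p * confWidth Λ T δ (ucRun Λ C T δ τ ℓ n) p := by
  obtain ⟨P', hP', hf⟩ := (mem_occSet_iff fun P hP => hP.1).1 (ucRun_qhat_mem hP)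
  have hπ := isPolicy_inducedPolicy hf.nonneg
  have h := sum_abs_occ_sub_le hP.1 hP'.1 hπ
  rw [hf.occ_inducedPolicy hP'.1] at h
  refine h.trans (mul_le_mul_of_nonneg_left (Finset.sum_le_sum fun p _ => ?_) (Nat.cast_nonneg _))
  exact mul_le_mul_of_nonneg_left (sum_abs_sub_le_confWidth hT hδ0 hδ1 hP hP' p)
    (occ_nonneg hP.1 hπ p)

/-- The regret bound for sequences on which the confidence sets contain the true transition
function and the expected widths are close to the observed ones. -/
lemma intervalRegret_ucPlayed_le [Nonempty A] (hC : 0 < C) (hT : 0 < T) (hδ0 : 0 < δ) (hδ1 : δ ≤ 1)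
    {P : X → A → X → ℝ} (hlay : ∀ n < T, (τ n).IsLayered Λ)
    (hP : ∀ n < T, P ∈ (ucRun Λ C T δ τ ℓ n).confSet Λ T δ)
    (hconc : ∑ t ∈ Finset.range T, ∑ p, ucPlayed Λ C T δ P τ ℓ t p *
        confWidth Λ T δ (ucRun Λ C T δ τ ℓ t) p ≤
      ∑ t ∈ Finset.range T, ∑ k : Fin L, confWidth Λ T δ (ucRun Λ C T δ τ ℓ t)
        ((τ t).state k.castSucc, (τ t).action k) + L * √(2 * T * Real.log (1 / δ)))
    {q : EuclideanSpace ℝ (X × A)}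
    (hq : ∀ n < T, q ∈ occSet Λ ((ucRun Λ C T δ τ ℓ n).confSet Λ T δ)) {t₁ t₂ : ℕ}
    (ht : t₁ ≤ t₂) (htT : t₂ < T) :
    intervalRegret ℓ (ucPlayed Λ C T δ P τ ℓ) t₁ t₂ q ≤
      lossMax ℓ t₁ t₂ * estimationError X A L T δ + lossMax ℓ 0 t₂ * L * C * √T +
        lossMax ℓ t₁ t₂ * ((Fintype.card X : ℝ) * Fintype.card A / 2) *
          (((t₂ : ℝ) - t₁ + 1) / (C * √T)) := by
  have hlog : 0 ≤ logFactor X A T δ :=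
    (Real.log_nonneg one_le_two).trans (log_two_le_logFactor Λ hT hδ0 hδ1)
  -- Summed over all episodes: the terms are nonnegative, so one bound serves all intervals.
  have hest : ∑ t ∈ Finset.range T,
      ∑ p, |ucPlayed Λ C T δ P τ ℓ t p - (ucRun Λ C T δ τ ℓ t).qhat p| ≤
        estimationError X A L T δ := by
    have hLX : (L : ℝ) ≤ Fintype.card X := by exact_mod_cast (Nat.le_succ L).trans (succ_le_card Λ)
    calc _ ≤ ∑ t ∈ Finset.range T, L * ∑ p, ucPlayed Λ C T δ P τ ℓ t p *
          confWidth Λ T δ (ucRun Λ C T δ τ ℓ t) p := Finset.sum_le_sum fun t ht =>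
            sum_abs_ucPlayed_sub_qhat_le hT hδ0 hδ1 (hP t (Finset.mem_range.1 ht))
      _ ≤ L * (6 * Fintype.card X * √(2 * T * Fintype.card A * logFactor X A T δ) +
          L * √(2 * T * Real.log (1 / δ))) := by
          rw [← Finset.mul_sum]
          exact mul_le_mul_of_nonneg_left (hconc.trans
            (add_le_add (sum_confWidth_visited_le hlog hlay) le_rfl)) (Nat.cast_nonneg _)
      _ ≤ _ := by
          rw [estimationError, ← logFactor]
          -- One factor `L` is bounded by the number of states; the constant `4` in
          -- `estimationError` is more than is needed.
          have h1 : (L : ℝ) * (L * √(2 * T * Real.log (1 / δ))) ≤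
              L * (Fintype.card X * √(2 * T * Real.log (1 / δ))) := by gcongr
          have h2 : 0 ≤ (L : ℝ) * (Fintype.card X * √(2 * T * Real.log (1 / δ))) := by positivity
          linarith
  have hdec : intervalRegret ℓ (ucPlayed Λ C T δ P τ ℓ) t₁ t₂ q =
      ∑ t ∈ Finset.Icc t₁ t₂,
        ∑ p, ℓ t p * (ucPlayed Λ C T δ P τ ℓ t p - (ucRun Λ C T δ τ ℓ t).qhat p) +
      ∑ t ∈ Finset.Icc t₁ t₂, ∑ p, ℓ t p * ((ucRun Λ C T δ τ ℓ t).qhat p - q p) := by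
    simp only [intervalRegret, ← Finset.sum_add_distrib]
    exact Finset.sum_congr rfl fun t _ => Finset.sum_congr rfl fun p _ => by ring
  rw [hdec, add_assoc]
  refine add_le_add ?_ (sum_loss_qhat_sub_le hC hT hP hq ht htT)
  calc _ ≤ ∑ t ∈ Finset.Icc t₁ t₂, lossMax ℓ t₁ t₂ *
        ∑ p, |ucPlayed Λ C T δ P τ ℓ t p - (ucRun Λ C T δ τ ℓ t).qhat p| := by
        refine Finset.sum_le_sum fun t ht => ?_
        rw [Finset.mul_sum]
        refine Finset.sum_le_sum fun p _ => (le_abs_self _).trans ?_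
        rw [abs_mul]
        refine mul_le_mul_of_nonneg_right ?_ (abs_nonneg _)
        exact (norm_le_pi_norm (ℓ t) p).trans
          (norm_le_lossMax ℓ (Finset.mem_Icc.1 ht).1 (Finset.mem_Icc.1 ht).2)
    _ ≤ _ := by
        rw [← Finset.mul_sum]
        refine mul_le_mul_of_nonneg_left (le_trans ?_ hest) (lossMax_nonneg ℓ _ _)
        refine Finset.sum_le_sum_of_subset_of_nonneg (fun t ht => ?_)
          fun t _ _ => Finset.sum_nonneg fun p _ => abs_nonneg _
        exact Finset.mem_range.2 ((Finset.mem_Icc.1 ht).2.trans_lt htT)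

/-- The terms of the regret bound are at most `√T` up to a logarithmic factor. -/
lemma exists_regret_bound_le (X : Type u) (A : Type v) [Fintype X] [Fintype A] [Nonempty X]
    [Nonempty A] (L : ℕ) {C : ℝ} (hC : 0 < C) : ∃ K : ℝ, ∀ (T : ℕ) (δ : ℝ), 0 < δ → δ ≤ 1 →
      ∀ t₁ t₂ : ℕ, t₁ ≤ t₂ → t₂ < T → ∀ m m' M : ℝ, 0 ≤ m → m ≤ M → m' ≤ M →
      m * estimationError X A L T δ + m' * L * C * √T +
        m * ((Fintype.card X : ℝ) * Fintype.card A / 2) * (((t₂ : ℝ) - t₁ + 1) / (C * √T)) ≤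
      K * M * √T * (1 + Real.log (T / δ)) ^ 1 := by
  set x : ℝ := (Fintype.card X : ℝ)
  set a : ℝ := (Fintype.card A : ℝ)
  have hx : 1 ≤ x := Nat.one_le_cast.2 Fintype.card_pos
  have ha : 1 ≤ a := Nat.one_le_cast.2 Fintype.card_pos
  have hxa : 0 ≤ Real.log (x * a) := Real.log_nonneg (by nlinarith)
  -- One summand for each term of the regret bound. The power `1` of the logarithmic factor `g`
  -- suffices because `√g ≤ g` for `g ≥ 1`.
  refine ⟨4 * L * x * √2 + 6 * L * x * √(2 * a * (1 + Real.log (x * a))) + L * C + x * a / 2 / C,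
    fun T δ hδ0 hδ1 t₁ t₂ ht htT m m' M hm0 hmM hm'M => ?_⟩
  have hT : (1 : ℝ) ≤ T := by exact_mod_cast (Nat.zero_le t₂).trans_lt htT
  have hM : 0 ≤ M := hm0.trans hmM
  have hsT : 0 < √(T : ℝ) := Real.sqrt_pos.2 (by linarith)
  have hTδ : 1 / δ ≤ T / δ := by gcongr
  have h1δ : 1 ≤ 1 / δ := by rw [le_div_iff₀ hδ0]; linarith
  set g : ℝ := 1 + Real.log (T / δ) with hg
  have hg1 : 1 ≤ g := by
    have := Real.log_nonneg (h1δ.trans hTδ)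
    linarith
  have hsg : √g ≤ g := Real.sqrt_le_iff.2 ⟨by linarith, by nlinarith⟩
  have e1 : √(2 * T * Real.log (1 / δ)) ≤ √2 * √T * g := by
    have : Real.log (1 / δ) ≤ g := by
      have := Real.log_le_log (by linarith) hTδ
      linarith
    calc √(2 * T * Real.log (1 / δ)) ≤ √(2 * T * g) := by gcongr
      _ = √2 * √T * √g := by
        rw [Real.sqrt_mul (by positivity), Real.sqrt_mul zero_le_two]
      _ ≤ _ := by gcongr
  have e2 : √(2 * T * a * Real.log (T * x * a / δ)) ≤
      √(2 * a * (1 + Real.log (x * a))) * √T * g := by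
    have : Real.log (T * x * a / δ) ≤ (1 + Real.log (x * a)) * g := by
      rw [show (T : ℝ) * x * a / δ = (T / δ) * (x * a) by ring,
        Real.log_mul (by positivity) (by positivity)]
      nlinarith
    calc √(2 * T * a * Real.log (T * x * a / δ))
        ≤ √(2 * T * a * ((1 + Real.log (x * a)) * g)) := by gcongr
      _ = √(2 * a * (1 + Real.log (x * a))) * √T * √g := by
        rw [← Real.sqrt_mul (by positivity), ← Real.sqrt_mul (by positivity)]
        congr 1
        ring
      _ ≤ _ := by gcongr
  have hE : estimationError X A L T δ ≤
      (4 * L * x * √2 + 6 * L * x * √(2 * a * (1 + Real.log (x * a)))) * √T * g := by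
    rw [estimationError]
    calc _ ≤ 4 * L * x * (√2 * √T * g) +
          6 * L * x * (√(2 * a * (1 + Real.log (x * a))) * √T * g) := by
          change 4 * L * x * _ + 6 * L * x * √(2 * T * a * Real.log (T * x * a / δ)) ≤ _
          gcongr
      _ = _ := by ring
  have hE0 : 0 ≤ (4 * L * x * √2 + 6 * L * x * √(2 * a * (1 + Real.log (x * a)))) * √T * g := by
    positivity
  have b1 : m * estimationError X A L T δ ≤
      M * ((4 * L * x * √2 + 6 * L * x * √(2 * a * (1 + Real.log (x * a)))) * √T * g) :=
    (mul_le_mul_of_nonneg_left hE hm0).trans (mul_le_mul_of_nonneg_right hmM hE0)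
  have b2 : m' * L * C * √T ≤ M * (L * C * √T * g) :=
    calc m' * L * C * √T ≤ M * L * C * √T := by gcongr
      _ = M * (L * C * √T * 1) := by ring
      _ ≤ _ := by gcongr
  have b3 : m * (x * a / 2) * (((t₂ : ℝ) - t₁ + 1) / (C * √T)) ≤
      M * (x * a / 2 / C * √T * g) := by
    have hlen : (t₂ : ℝ) - t₁ + 1 ≤ T := by
      have h1 : (t₂ : ℝ) + 1 ≤ T := by exact_mod_cast htT
      have h2 : (0 : ℝ) ≤ t₁ := Nat.cast_nonneg _
      linarith
    calc m * (x * a / 2) * (((t₂ : ℝ) - t₁ + 1) / (C * √T))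
        ≤ m * (x * a / 2) * (T / (C * √T)) := by gcongr
      _ = m * (x * a / 2 / C * √T * 1) := by
          have : (T : ℝ) = √T * √T := (Real.mul_self_sqrt (by linarith)).symm
          field_simp
          nlinarith
      _ ≤ _ := by gcongr
  rw [pow_one]
  calc _ ≤ _ := add_le_add (add_le_add b1 b2) b3
    _ = _ := by ring

end Regret
-- Exponential bounds for the interaction
/-- Hoeffding's lemma for a finite distribution. -/
lemma sum_mul_exp_le {ι : Type u} [Fintype ι] (p f : ι → ℝ) (hp : ∀ i, 0 ≤ p i)
    (hp1 : ∑ i, p i = 1) {b : ℝ} (hb : 0 ≤ b) {a : ℝ} (hf : ∀ i, f i ∈ Set.Icc a (a + b)) (s : ℝ) :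
    ∑ i, p i * Real.exp (s * (f i - ∑ j, p j * f j)) ≤ Real.exp (s ^ 2 * b ^ 2 / 8) := by
  let _ : MeasurableSpace ι := ⊤
  have hsum : ∑ i, ENNReal.ofReal (p i) = 1 := by
    rw [← ENNReal.ofReal_sum_of_nonneg fun i _ => hp i, hp1, ENNReal.ofReal_one]
  set P : PMF ι := PMF.ofFintype (fun i => ENNReal.ofReal (p i)) hsum with hP
  have hint : ∀ h : ι → ℝ, ∫ i, h i ∂P.toMeasure = ∑ i, p i * h i := fun h => by
    rw [PMF.integral_eq_sum]
    exact Finset.sum_congr rfl fun i _ => by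
      rw [hP, PMF.ofFintype_apply, ENNReal.toReal_ofReal (hp i), smul_eq_mul]
  have h := (ProbabilityTheory.hasSubgaussianMGF_of_mem_Icc (μ := P.toMeasure) (X := f)
    (Measurable.of_discrete).aemeasurable (Filter.Eventually.of_forall hf)).mgf_le s
  rw [ProbabilityTheory.mgf, hint, hint] at h
  refine h.trans (le_of_eq ?_)
  congr 1
  rw [show a + b - a = b by ring]
  push_cast
  rw [Real.norm_of_nonneg hb]
  ring

section Interaction

variable {X : Type u} {A : Type v} {L : ℕ} {Ω : Type w} [mΩ : MeasurableSpace Ω]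
  {traj : ℕ → Ω → Trajectory X A L} {loss : ℕ → Ω → X × A → ℝ}

omit mΩ in
lemma measurable_past_traj {i n : ℕ} (hi : i < n) : Measurable[past traj loss n] (traj i) :=
  measurable_fst.comp ((measurable_pi_apply (⟨i, hi⟩ : Fin n)).comp
    (comap_measurable fun ω (i : Fin n) => (traj i ω, loss i ω)))

omit mΩ in
lemma measurable_past_loss {i n : ℕ} (hi : i < n) : Measurable[past traj loss n] (loss i) :=
  measurable_snd.comp ((measurable_pi_apply (⟨i, hi⟩ : Fin n)).comp
    (comap_measurable fun ω (i : Fin n) => (traj i ω, loss i ω)))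

omit mΩ in
lemma past_mono {n m : ℕ} (h : n ≤ m) : past traj loss n ≤ past traj loss m := by
  refine Measurable.comap_le ?_
  refine @measurable_pi_lambda _ _ _ (past traj loss m) _ _ fun i => ?_
  exact (measurable_past_traj (i.2.trans_le h)).prodMk (measurable_past_loss (i.2.trans_le h))

variable {Λ : Layering X L} {P : X → A → X → ℝ} {π : History X A L → X → A → ℝ} {T : ℕ}
  {μ : Measure Ω} [Fintype X] [DecidableEq X] [Fintype A] [DecidableEq A]

omit [Fintype X] [DecidableEq X] [Fintype A] [DecidableEq A] in
lemma IsInteraction.past_le (h : IsInteraction Λ P π T μ traj loss) {n : ℕ} (hn : n ≤ T) :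
    past traj loss n ≤ mΩ :=
  Measurable.comap_le (measurable_pi_lambda _ fun i =>
    (h.measurable_traj i (by omega)).prodMk (h.measurable_loss i (by omega)))

/-- The conditional distribution of the trajectory of episode `n`, given the past. -/
noncomputable def condTraj (traj : ℕ → Ω → Trajectory X A L) (loss : ℕ → Ω → X × A → ℝ)
    (μ : Measure Ω) (n : ℕ) (τ : Trajectory X A L) : Ω → ℝ :=
  μ[({ω | traj n ω = τ} : Set Ω).indicator (fun _ => (1 : ℝ)) | past traj loss n]

lemma IsInteraction.condTraj_ae_eq (h : IsInteraction Λ P π T μ traj loss) :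
    ∀ᵐ ω ∂μ, ∀ n < T, ∀ τ, condTraj traj loss μ n τ ω =
      trajProb Λ P (π (history traj loss n ω)) τ := by
  rw [ae_all_iff]
  intro n
  by_cases hn : n < T
  · filter_upwards [ae_all_iff.2 (h.condLaw n hn)] with ω hω _ τ
    exact hω τ
  · exact Filter.Eventually.of_forall fun ω hn' => absurd hn' hn

variable [IsProbabilityMeasure μ]

omit [Fintype X] [DecidableEq X] [Fintype A] [DecidableEq A] [IsProbabilityMeasure μ] in
lemma IsInteraction.measurableSet_traj_eq (h : IsInteraction Λ P π T μ traj loss) {n : ℕ}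
    (hn : n < T) (τ : Trajectory X A L) : MeasurableSet {ω | traj n ω = τ} :=
  h.measurable_traj n hn (MeasurableSpace.measurableSet_top (s := {τ}))

/-- The expectation of a function of the past and of the next trajectory. -/
lemma IsInteraction.integral_eq (h : IsInteraction Λ P π T μ traj loss) {n : ℕ} (hn : n < T)
    (F : Trajectory X A L → Ω → ℝ) (hF : ∀ τ, Measurable[past traj loss n] (F τ)) {B : ℝ}
    (hB : ∀ τ ω, |F τ ω| ≤ B) :
    ∫ ω, F (traj n ω) ω ∂μ = ∫ ω, ∑ τ, condTraj traj loss μ n τ ω * F τ ω ∂μ := by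
  have hm := h.past_le hn.le
  set ind : Trajectory X A L → Ω → ℝ := fun τ => {ω | traj n ω = τ}.indicator fun _ => 1
  have hind : ∀ τ, Integrable (ind τ) μ := fun τ =>
    (integrable_const 1).indicator (h.measurableSet_traj_eq hn τ)
  have hFm : ∀ τ, StronglyMeasurable[past traj loss n] (F τ) := fun τ => (hF τ).stronglyMeasurable
  have hFi : ∀ τ, Integrable (F τ * ind τ) μ := fun τ =>
    (hind τ).bdd_mul ((hFm τ).mono hm).aestronglyMeasurable (Filter.Eventually.of_forall (hB τ))
  -- Since there are finitely many trajectories, each value of `traj n` is treated separately and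
  -- the past-measurable factor is pulled out of the conditional expectation.
  have hpull : ∀ τ, μ[F τ * ind τ | past traj loss n] =ᵐ[μ] F τ * condTraj traj loss μ n τ :=
    fun τ => condExp_mul_of_stronglyMeasurable_left (hFm τ) (hFi τ) (hind τ)
  have e : ∀ ω, F (traj n ω) ω = ∑ τ, (F τ * ind τ) ω := fun ω => by
    rw [Finset.sum_eq_single (traj n ω)]
    · simp [ind]
    · intro τ _ hτ
      simp [ind, Set.indicator, hτ.symm]
    · simp
  simp only [e]
  rw [integral_finsetSum _ fun τ _ => hFi τ, integral_finsetSum]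
  · refine Finset.sum_congr rfl fun τ _ => ?_
    rw [← integral_condExp hm, integral_congr_ae (hpull τ)]
    exact integral_congr_ae (Filter.Eventually.of_forall fun ω => mul_comm _ _)
  · intro τ _
    refine (integrable_condExp.congr (hpull τ)).congr
      (Filter.Eventually.of_forall fun ω => mul_comm _ _)

omit mΩ in
lemma measurable_past_apply_traj (g : Trajectory X A L → Ω → ℝ) {n m : ℕ} (hnm : n < m)
    (hg : ∀ τ, Measurable[past traj loss n] (g τ)) :
    Measurable[past traj loss m] fun ω => g (traj n ω) ω := by
  classical
  have e : (fun ω => g (traj n ω) ω) =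
      fun ω => ∑ τ, (if traj n ω = τ then 1 else 0) * g τ ω := by
    funext ω
    rw [Finset.sum_eq_single (traj n ω)] <;> simp +contextual [eq_comm]
  rw [e]
  refine Finset.measurable_fun_sum _ fun τ _ =>
    Measurable.mul ?_ ((hg τ).mono (past_mono hnm.le) le_rfl)
  exact (measurable_from_top (f := fun σ : Trajectory X A L => if σ = τ then (1 : ℝ) else 0)).comp
    (measurable_past_traj hnm)

/-- A product of nonnegative factors with conditional expectations at most `1`. -/
lemma IsInteraction.integral_prod_le_one (h : IsInteraction Λ P π T μ traj loss)
    (g : ℕ → Trajectory X A L → Ω → ℝ) (hg : ∀ n < T, ∀ τ, Measurable[past traj loss n] (g n τ))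
    (hg0 : ∀ n τ ω, 0 ≤ g n τ ω) {B : ℝ} (hgB : ∀ n τ ω, g n τ ω ≤ B)
    (hle : ∀ n < T, ∀ᵐ ω ∂μ, ∑ τ, condTraj traj loss μ n τ ω * g n τ ω ≤ 1) :
    Integrable (fun ω => ∏ n ∈ Finset.range T, g n (traj n ω) ω) μ ∧
      ∫ ω, ∏ n ∈ Finset.range T, g n (traj n ω) ω ∂μ ≤ 1 := by
  have hmeas : ∀ N ≤ T, Measurable[past traj loss N] fun ω =>
      ∏ n ∈ Finset.range N, g n (traj n ω) ω := fun N hN =>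
    Finset.measurable_fun_prod _ fun n hn => by
      have := Finset.mem_range.1 hn
      exact measurable_past_apply_traj (g n) this (hg n (by omega))
  have hprod0 : ∀ N ω, 0 ≤ ∏ n ∈ Finset.range N, g n (traj n ω) ω := fun N ω =>
    Finset.prod_nonneg fun n _ => hg0 n _ ω
  have hprodB : ∀ N ω, ∏ n ∈ Finset.range N, g n (traj n ω) ω ≤ B ^ N := fun N ω => by
    have := Finset.prod_le_prod (s := Finset.range N) (fun n _ => hg0 n (traj n ω) ω)
      fun n _ => hgB n (traj n ω) ω
    simpa using this
  have hint : ∀ N ≤ T, Integrable (fun ω => ∏ n ∈ Finset.range N, g n (traj n ω) ω) μ :=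
    fun N hN => Integrable.of_bound
      ((hmeas N hN).mono (h.past_le hN) le_rfl).aestronglyMeasurable (B ^ N)
      (Filter.Eventually.of_forall fun ω => by
        rw [Real.norm_of_nonneg (hprod0 N ω)]; exact hprodB N ω)
  have key : ∀ N ≤ T, ∫ ω, ∏ n ∈ Finset.range N, g n (traj n ω) ω ∂μ ≤ 1 := by
    intro N
    induction N with
    | zero => intro; simp
    | succ N ih =>
      intro hN
      refine le_trans ?_ (ih (by omega))
      simp only [Finset.prod_range_succ]
      -- Conditioning the last factor on its past reduces the product to the preceding ones. The
      -- bound by powers of `B` serves integrability only.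
      rw [h.integral_eq (n := N) (by omega)
        (fun τ ω => (∏ n ∈ Finset.range N, g n (traj n ω) ω) * g N τ ω)
        (fun τ => (hmeas N (by omega)).mul (hg N (by omega) τ)) (B := B ^ N * B)]
      · refine integral_mono_of_nonneg ?_ (hint N (by omega)) ?_
        · have hpos : ∀ᵐ ω ∂μ, ∀ τ, 0 ≤ condTraj traj loss μ N τ ω := by
            rw [ae_all_iff]
            intro τ
            exact condExp_nonneg (Filter.Eventually.of_forall fun ω =>
              Set.indicator_nonneg (fun _ _ => zero_le_one) ω)
          filter_upwards [hpos] with ω hω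
          exact Finset.sum_nonneg fun τ _ =>
            mul_nonneg (hω τ) (mul_nonneg (hprod0 N ω) (hg0 N τ ω))
        · filter_upwards [hle N (by omega)] with ω hω
          calc _ = (∏ n ∈ Finset.range N, g n (traj n ω) ω) *
                ∑ τ, condTraj traj loss μ N τ ω * g N τ ω := by
                rw [Finset.mul_sum]
                exact Finset.sum_congr rfl fun τ _ => by ring
            _ ≤ _ := mul_le_of_le_one_right (hprod0 N ω) hω
      · intro τ ω
        rw [abs_of_nonneg (mul_nonneg (hprod0 N ω) (hg0 N τ ω))]
        exact mul_le_mul (hprodB N ω) (hgB N τ ω) (hg0 N τ ω)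
          ((hprod0 N ω).trans (hprodB N ω))
  exact ⟨hint T le_rfl, key T le_rfl⟩

/-- Markov's inequality for such a product. -/
lemma IsInteraction.measureReal_prod_ge_le (h : IsInteraction Λ P π T μ traj loss)
    (g : ℕ → Trajectory X A L → Ω → ℝ) (hg : ∀ n < T, ∀ τ, Measurable[past traj loss n] (g n τ))
    (hg0 : ∀ n τ ω, 0 ≤ g n τ ω) {B : ℝ} (hgB : ∀ n τ ω, g n τ ω ≤ B)
    (hle : ∀ n < T, ∀ᵐ ω ∂μ, ∑ τ, condTraj traj loss μ n τ ω * g n τ ω ≤ 1) (c : ℝ) :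
    μ.real {ω | Real.exp c ≤ ∏ n ∈ Finset.range T, g n (traj n ω) ω} ≤ Real.exp (-c) := by
  obtain ⟨hi, hl⟩ := h.integral_prod_le_one g hg hg0 hgB hle
  have := mul_meas_ge_le_integral_of_nonneg (Filter.Eventually.of_forall fun ω =>
    Finset.prod_nonneg fun n _ => hg0 n (traj n ω) ω) hi (Real.exp c)
  rw [Real.exp_neg, ← one_div, le_div_iff₀ (Real.exp_pos c), mul_comm]
  exact this.trans hl

omit [DecidableEq X] [Fintype A] [DecidableEq A] in
lemma isLayered_of_trajProb_ne_zero (hP : IsTransition Λ P) {ρ : X → A → ℝ}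
    {τ : Trajectory X A L} (h : trajProb Λ P ρ τ ≠ 0) : τ.IsLayered Λ := by
  intro j
  induction j using Fin.induction with
  | zero =>
    have := left_ne_zero_of_mul h
    simpa using this
  | succ k ih =>
    have := Finset.prod_ne_zero_iff.1 (right_ne_zero_of_mul h) k (Finset.mem_univ k)
    rw [hP.next_layer_of_ne (right_ne_zero_of_mul this), ih]
    simp

/-- Each of the finitely many trajectories that are not layered has conditional probability zero,
hence probability zero. -/
lemma IsInteraction.ae_isLayered (h : IsInteraction Λ P π T μ traj loss) (hP : IsTransition Λ P) :
    ∀ᵐ ω ∂μ, ∀ n < T, (traj n ω).IsLayered Λ := by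
  rw [ae_all_iff]
  intro n
  by_cases hn : n < T
  swap
  · exact Filter.Eventually.of_forall fun ω hn' => absurd hn' hn
  have hτ : ∀ τ : Trajectory X A L, ∀ᵐ ω ∂μ, ¬ τ.IsLayered Λ → traj n ω ≠ τ := by
    intro τ
    by_cases hl : τ.IsLayered Λ
    · exact Filter.Eventually.of_forall fun ω hl' => absurd hl hl'
    have h0 : condTraj traj loss μ n τ =ᵐ[μ] 0 := by
      filter_upwards [h.condTraj_ae_eq] with ω hω
      rw [hω n hn τ]
      by_contra hne
      exact hl (isLayered_of_trajProb_ne_zero hP hne)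
    have hi := integral_condExp (μ := μ) (h.past_le hn.le)
      (f := ({ω | traj n ω = τ} : Set Ω).indicator fun _ => (1 : ℝ))
    have hi' : ∫ ω, condTraj traj loss μ n τ ω ∂μ = 0 := by
      rw [integral_congr_ae h0]; simp
    rw [condTraj] at hi'
    rw [hi', integral_indicator_const _ (h.measurableSet_traj_eq hn τ), smul_eq_mul, mul_one] at hi
    have hz := (measureReal_eq_zero_iff (measure_ne_top μ _)).1 hi.symm
    filter_upwards [measure_eq_zero_iff_ae_notMem.1 hz] with ω hω _
    exact hω
  filter_upwards [ae_all_iff.2 hτ] with ω hω _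
  by_contra hl
  exact hω _ hl rfl

end Interaction
section Nonempty

variable {X : Type u} {A : Type v} {L : ℕ} [Fintype X] [Fintype A] [DecidableEq X] [DecidableEq A]
  {Λ : Layering X L} {C : ℝ} {T : ℕ} {δ : ℝ} {τ : ℕ → Trajectory X A L} {ℓ : ℕ → X × A → ℝ}

omit [Fintype A] in
lemma Trajectory.sum_visits' (σ : Trajectory X A L) (x : X) (a : A) :
    ∑ x', σ.visits' x a x' = σ.visits x a := by
  rw [Trajectory.visits, Finset.card_eq_sum_card_fiberwise (t := Finset.univ)
    (f := fun k : Fin L => σ.state k.succ) fun _ _ => Finset.mem_coe.2 (Finset.mem_univ _)]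
  refine Finset.sum_congr rfl fun x' _ => ?_
  rw [Trajectory.visits', Finset.filter_filter]
  simp only [and_assoc]

/-- The empirical transition function, made uniform in unvisited pairs, is itself a member. So the
iterates give policies on layered trajectories even when `P` is outside the confidence set, as the
probabilistic estimates require before the good event is available. -/
lemma exists_mem_confSet [Nonempty A] (hT : 0 < T) (hδ0 : 0 < δ) (hδ1 : δ ≤ 1)
    (hlay : ∀ n < T, (τ n).IsLayered Λ) {n : ℕ} (hn : n < T) :
    ∃ P, P ∈ (ucRun Λ C T δ τ ℓ n).confSet Λ T δ := by
  obtain ⟨m, hm, h1, h2⟩ := ucRun_init_eq (Λ := Λ) (C := C) (T := T) (δ := δ) (τ := τ) (ℓ := ℓ) n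
  have hlay' : ∀ i ∈ Finset.range m, (τ i).IsLayered Λ := fun i hi =>
    hlay i (by have := Finset.mem_range.1 hi; omega)
  set N : X → A → ℕ := fun x a => ∑ i ∈ Finset.range m, (τ i).visits x a with hN
  set M : X → A → X → ℕ := fun x a x' => ∑ i ∈ Finset.range m, (τ i).visits' x a x' with hM
  have hM0 : ∀ x a x', Λ.layer x' ≠ Λ.layer x + 1 → M x a x' = 0 := fun x a x' h =>
    Finset.sum_eq_zero fun i hi => (hlay' i hi).visits'_of_layer_ne h a
  have hMN : ∀ x a, ∑ x', M x a x' = N x a := fun x a => by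
    simp only [hM, hN]
    rw [Finset.sum_comm]
    exact Finset.sum_congr rfl fun i _ => (τ i).sum_visits' x a
  have hemp : ∀ x a x', (ucRun Λ C T δ τ ℓ n).empirical x a x' =
      (M x a x' : ℝ) / max 1 (N x a : ℝ) := fun x a x' => by
    simp only [UCState.empirical, h1, h2, ucRun_visits, ucRun_visits', hM, hN]
  have hrad : ∀ x a, (ucRun Λ C T δ τ ℓ n).radius Λ T δ x a = confRadius Λ A T δ x (N x a) :=
    fun x a => by rw [UCState.radius_eq, h1, ucRun_visits]
  have hU := isTransition_uniformTransition (A := A) Λ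
  refine ⟨fun x a x' => if N x a = 0 then uniformTransition Λ x a x' else
    (M x a x' : ℝ) / max 1 (N x a : ℝ), ⟨fun x a x' => ?_, fun x a hx => ?_, fun x a x' h => ?_⟩,
    fun _ x a => ?_⟩
  · split_ifs
    · exact hU.nonneg x a x'
    · positivity
  · split_ifs with h
    · exact hU.sum_eq_one x a hx
    · have h1N : (1 : ℝ) ≤ N x a := by exact_mod_cast Nat.one_le_iff_ne_zero.2 h
      rw [← Finset.sum_div, max_eq_right h1N, ← Nat.cast_sum, hMN, div_self (by linarith)]
  · split_ifs at h
    · exact hU.next_layer x a x' h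
    · by_contra hne
      simp [hM0 x a x' hne] at h
  · simp only [hemp, hrad]
    split_ifs with h
    · have hz : ∀ x', M x a x' = 0 := fun x' =>
        (Finset.sum_eq_zero_iff.1 ((hMN x a).trans h)) x' (Finset.mem_univ x')
      simp only [hz, Nat.cast_zero, zero_div, sub_zero, abs_of_nonneg (hU.nonneg x a _), h]
      rcases lt_or_eq_of_le (Λ.layer_le x) with hx | hx
      · exact (hU.sum_le_one x a).trans (one_le_confRadius_zero hT hδ0 hδ1 hx)
      · rw [Finset.sum_eq_zero]
        · exact Real.sqrt_nonneg _
        · intro x' _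
          by_contra hne
          have := hU.next_layer_of_ne hne
          have := Λ.layer_le x'
          omega
    · simp only [sub_self, abs_zero, Finset.sum_const_zero]
      exact Real.sqrt_nonneg _

lemma isPolicy_inducedPolicy_ucRun [Nonempty A] (hT : 0 < T) (hδ0 : 0 < δ) (hδ1 : δ ≤ 1)
    (hlay : ∀ n < T, (τ n).IsLayered Λ) {n : ℕ} (hn : n < T) :
    IsPolicy (inducedPolicy (ucRun Λ C T δ τ ℓ n).qhat) := by
  obtain ⟨P, hP⟩ := exists_mem_confSet (C := C) (ℓ := ℓ) hT hδ0 hδ1 hlay hn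
  obtain ⟨P', hP', hf⟩ := (mem_occSet_iff fun P hP => hP.1).1 (ucRun_qhat_mem hP)
  exact isPolicy_inducedPolicy hf.nonneg

end Nonempty

/-! ### Deviations of the empirical transitions -/

section Empirical

variable {X : Type u} {A : Type v} {L : ℕ} [Fintype X] [DecidableEq X] [DecidableEq A]
  {Λ : Layering X L} {T : ℕ}

/-- The exponential factor of a transition in the pair `(x, a)`. -/
noncomputable def visitFactor (P : X → A → X → ℝ) (x : X) (a : A) (σ : X → ℝ) (s : ℝ)
    (y : X) (b : A) (y' : X) : ℝ :=
  if y = x ∧ b = a then Real.exp (s * (σ y' - ∑ z, P x a z * σ z) - s ^ 2 / 2) else 1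

lemma visitFactor_nonneg (P : X → A → X → ℝ) (x : X) (a : A) (σ : X → ℝ) (s : ℝ) (y : X) (b : A)
    (y' : X) : 0 ≤ visitFactor P x a σ s y b y' := by
  unfold visitFactor; split_ifs <;> positivity

lemma visitFactor_le (P : X → A → X → ℝ) (x : X) (a : A) (σ : X → ℝ) (s : ℝ) (y : X) (b : A)
    (y' : X) : visitFactor P x a σ s y b y' ≤
      1 + ∑ y', Real.exp (s * (σ y' - ∑ z, P x a z * σ z) - s ^ 2 / 2) := by
  have h0 : 0 ≤ ∑ y', Real.exp (s * (σ y' - ∑ z, P x a z * σ z) - s ^ 2 / 2) := by positivity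
  unfold visitFactor
  split_ifs
  · have := Finset.single_le_sum
      (f := fun y' => Real.exp (s * (σ y' - ∑ z, P x a z * σ z) - s ^ 2 / 2))
      (fun _ _ => (Real.exp_pos _).le) (Finset.mem_univ y')
    linarith
  · linarith

/-- Hoeffding's lemma with range `2` gives exactly the exponent `s ^ 2 / 2` that the factor
subtracts. -/
lemma sum_transition_mul_visitFactor_le {P : X → A → X → ℝ} (hP : IsTransition Λ P) {x : X} {a : A}
    (hx : Λ.layer x < L) {σ : X → ℝ} (hσ : ∀ y, σ y ∈ Set.Icc (-1) 1) (s : ℝ) (y : X) (b : A) :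
    ∑ y', P y b y' * visitFactor P x a σ s y b y' ≤ ∑ y', P y b y' := by
  by_cases h : y = x ∧ b = a
  · obtain ⟨rfl, rfl⟩ := h
    simp only [visitFactor, and_self, if_true, Real.exp_sub, ← mul_div_assoc]
    rw [← Finset.sum_div, hP.sum_eq_one y b hx, div_le_one (Real.exp_pos _)]
    refine (sum_mul_exp_le (P y b) σ (hP.nonneg y b) (hP.sum_eq_one y b hx) zero_le_two
      (a := -1) (fun y' => ?_) s).trans (le_of_eq (by congr 1; ring))
    have := hσ y'
    norm_num at this ⊢
    exact this
  · simp [visitFactor, h]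

/-- The factor of an episode, for the first `N` visits of `(x, a)`. -/
noncomputable def truncFactor (Λ : Layering X L) (P : X → A → X → ℝ) {x : X} (hx : Λ.layer x < L)
    (a : A) (σ : X → ℝ) (s : ℝ) (N c : ℕ) (τ : Trajectory X A L) : ℝ :=
  if c < N then visitFactor P x a σ s (τ.state (⟨Λ.layer x, hx⟩ : Fin L).castSucc)
    (τ.action ⟨Λ.layer x, hx⟩) (τ.state (⟨Λ.layer x, hx⟩ : Fin L).succ) else 1

/-- Truncation after `N` visits makes the product independent of the random episode in which the
count reaches `N`. The parameter `s` can then be tuned to the fixed number `N`. -/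
lemma prod_truncFactor_eq (P : X → A → X → ℝ) {x : X} (hx : Λ.layer x < L) (a : A) (σ : X → ℝ)
    (s : ℝ) {τ : ℕ → Trajectory X A L} (hlay : ∀ n < T, (τ n).IsLayered Λ) {m : ℕ} (hm : m ≤ T)
    {N : ℕ} (hN : ∑ i ∈ Finset.range m, (τ i).visits x a = N) :
    ∏ n ∈ Finset.range T,
      truncFactor Λ P hx a σ s N (∑ i ∈ Finset.range n, (τ i).visits x a) (τ n) =
    Real.exp (s * (∑ x', ((∑ i ∈ Finset.range m, (τ i).visits' x a x' : ℕ) : ℝ) * σ x' -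
      N * ∑ z, P x a z * σ z) - N * (s ^ 2 / 2)) := by
  set mean := ∑ z, P x a z * σ z with hmean
  rw [← Finset.prod_range_mul_prod_Ico _ hm, Finset.prod_eq_one (s := Finset.Ico m T), mul_one]
  · have hf : ∀ n ∈ Finset.range m,
        truncFactor Λ P hx a σ s N (∑ i ∈ Finset.range n, (τ i).visits x a) (τ n) =
        Real.exp (s * (∑ x', ((τ n).visits' x a x' : ℝ) * σ x' -
          (τ n).visits x a * mean) - (τ n).visits x a * (s ^ 2 / 2)) := by
      intro n hn
      have hnm := Finset.mem_range.1 hn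
      have hl := hlay n (by omega)
      simp only [truncFactor, visitFactor, hl.visits_eq hx, hl.visits'_eq hx]
      by_cases hv : (τ n).state (⟨Λ.layer x, hx⟩ : Fin L).castSucc = x ∧
          (τ n).action ⟨Λ.layer x, hx⟩ = a
      -- A visit in an episode before `m` raises the count to at most `N`, so it was below `N` and
      -- the factor is not truncated.
      · have hlt : ∑ i ∈ Finset.range n, (τ i).visits x a < N := by
          have h1 : (τ n).visits x a = 1 := by rw [hl.visits_eq hx, if_pos hv]
          have h2 : ∑ i ∈ Finset.range (n + 1), (τ i).visits x a ≤
              ∑ i ∈ Finset.range m, (τ i).visits x a :=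
            Finset.sum_le_sum_of_subset (Finset.range_mono hnm)
          rw [Finset.sum_range_succ, h1] at h2
          omega
        rw [if_pos hlt, if_pos hv, if_pos hv]
        simp only [hv, true_and, Nat.cast_ite, Nat.cast_one, Nat.cast_zero, ite_mul, one_mul,
          zero_mul, Finset.sum_ite_eq, Finset.mem_univ, if_true]
        rfl
      · have hv' : ∀ x', ¬ ((τ n).state (⟨Λ.layer x, hx⟩ : Fin L).castSucc = x ∧
            (τ n).action ⟨Λ.layer x, hx⟩ = a ∧
            (τ n).state (⟨Λ.layer x, hx⟩ : Fin L).succ = x') := fun x' h => hv ⟨h.1, h.2.1⟩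
        simp only [hv, hv', if_false, ite_self, Nat.cast_zero, zero_mul, Finset.sum_const_zero,
          sub_zero, mul_zero, Real.exp_zero]
    rw [Finset.prod_congr rfl hf, ← Real.exp_sum]
    congr 1
    rw [Finset.sum_sub_distrib, ← Finset.mul_sum, Finset.sum_sub_distrib, ← Finset.sum_mul,
      ← Finset.sum_mul, ← Nat.cast_sum, hN, Finset.sum_comm]
    simp only [← Finset.sum_mul, ← Nat.cast_sum]
  · intro n hn
    refine if_neg (not_lt.2 ?_)
    rw [← hN]
    exact Finset.sum_le_sum_of_subset (Finset.range_mono (Finset.mem_Ico.1 hn).1)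

/-- The signs that belong to a set of states. -/
def setSign (S : Finset X) (x : X) : ℝ := if x ∈ S then 1 else -1

omit [Fintype X] in
lemma setSign_mem_Icc (S : Finset X) (x : X) : setSign S x ∈ Set.Icc (-1 : ℝ) 1 := by
  unfold setSign; split_ifs <;> simp

/-- The `ℓ¹` distance of two distributions on a finite set is attained at a choice of signs. -/
lemma exists_setSign_of_lt (p q : X → ℝ) (Y : Finset X) (hp : ∀ x ∉ Y, p x = 0)
    (hq : ∀ x ∉ Y, q x = 0) (hpq : ∑ x, p x = ∑ x, q x) {ε : ℝ} (hε : 0 ≤ ε)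
    (h : ε < ∑ x, |p x - q x|) :
    ∃ S ∈ Y.powerset.erase Y, ε < ∑ x, q x * setSign S x - ∑ x, p x * setSign S x := by
  set S := Y.filter fun x => p x ≤ q x with hS
  have e : ∑ x, q x * setSign S x - ∑ x, p x * setSign S x = ∑ x, |p x - q x| := by
    rw [← Finset.sum_sub_distrib]
    refine Finset.sum_congr rfl fun x _ => ?_
    by_cases hx : x ∈ Y
    · by_cases hle : p x ≤ q x
      · rw [setSign, if_pos (Finset.mem_filter.2 ⟨hx, hle⟩), abs_of_nonpos (by linarith)]
        ring
      · rw [setSign, if_neg (show x ∉ S from fun h => hle (Finset.mem_filter.1 h).2),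
          abs_of_nonneg (by linarith)]
        ring
    · rw [hp x hx, hq x hx]
      simp
  -- The full set is impossible: with constant signs on `Y` the difference would be that of the
  -- total masses, which is zero. This leaves `2 ^ m - 1` sign patterns for `m = Y.card`.
  refine ⟨S, Finset.mem_erase.2 ⟨fun hSY => ?_, Finset.mem_powerset.2 (Finset.filter_subset _ _)⟩,
    by rwa [e]⟩
  have : ∑ x, q x * setSign S x - ∑ x, p x * setSign S x = ∑ x, q x - ∑ x, p x := by
    rw [← Finset.sum_sub_distrib, ← Finset.sum_sub_distrib]
    refine Finset.sum_congr rfl fun x _ => ?_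
    by_cases hx : x ∈ Y
    · rw [setSign, hSY, if_pos hx, mul_one, mul_one]
    · rw [hp x hx, hq x hx]
      simp
  rw [← e, this, hpq, sub_self] at h
  linarith

variable [Fintype A]

/-- If the empirical transition probabilities are off, then one of the products is large. -/
lemma exists_exp_le_prod_truncFactor {P : X → A → X → ℝ} (hP : IsTransition Λ P) {δ : ℝ}
    (hlog : 0 ≤ logFactor X A T δ) {x : X} (hx : Λ.layer x < L) (a : A)
    {τ : ℕ → Trajectory X A L} (hlay : ∀ n < T, (τ n).IsLayered Λ) {m N : ℕ} (hm : m ≤ T)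
    (hN : ∑ i ∈ Finset.range m, (τ i).visits x a = N) (hN1 : 1 ≤ N)
    (hdev : confRadius Λ A T δ x N <
      ∑ x', |P x a x' - ((∑ i ∈ Finset.range m, (τ i).visits' x a x' : ℕ) : ℝ) / max 1 (N : ℝ)|) :
    ∃ S ∈ (Λ.layerSet (Λ.layer x + 1)).powerset.erase (Λ.layerSet (Λ.layer x + 1)),
      Real.exp ((Λ.layerSet (Λ.layer x + 1)).card * logFactor X A T δ) ≤
      ∏ n ∈ Finset.range T, truncFactor Λ P hx a (setSign S) (confRadius Λ A T δ x N) N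
        (∑ i ∈ Finset.range n, (τ i).visits x a) (τ n) := by
  have hN1' : (1 : ℝ) ≤ N := by exact_mod_cast hN1
  have hN0 : (0 : ℝ) < N := by linarith
  rw [max_eq_right hN1'] at hdev
  set ε := confRadius Λ A T δ x N with hε
  -- With `s = ε` the exponent is at least `N * ε ^ 2 / 2`, which is the layer size times the
  -- logarithm.
  have hε2 : ε ^ 2 * N = 2 * (Λ.layerSet (Λ.layer x + 1)).card * logFactor X A T δ := by
    rw [hε, confRadius, Real.sq_sqrt (by positivity), max_eq_right hN1', div_mul_cancel₀ _ hN0.ne']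
  set M : X → ℕ := fun x' => ∑ i ∈ Finset.range m, (τ i).visits' x a x' with hM
  have hMN : ∑ x', M x' = N := by
    rw [← hN]
    simp only [hM]
    rw [Finset.sum_comm]
    exact Finset.sum_congr rfl fun i _ => (τ i).sum_visits' x a
  obtain ⟨S, hS, hlt⟩ := exists_setSign_of_lt (P x a) (fun x' => (M x' : ℝ) / N)
    (Λ.layerSet (Λ.layer x + 1))
    (fun x' hx' => by
      by_contra h
      exact hx' (mem_layerSet.2 (hP.next_layer_of_ne h)))
    (fun x' hx' => by
      have : M x' = 0 := Finset.sum_eq_zero fun i hi =>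
        (hlay i (by have := Finset.mem_range.1 hi; omega)).visits'_of_layer_ne
          (fun h => hx' (mem_layerSet.2 h)) a
      simp [this])
    (by rw [hP.sum_eq_one x a hx, ← Finset.sum_div, ← Nat.cast_sum, hMN, div_self hN0.ne'])
    (show 0 ≤ ε from Real.sqrt_nonneg _) hdev
  refine ⟨S, hS, ?_⟩
  rw [prod_truncFactor_eq P hx a _ _ hlay hm hN]
  refine Real.exp_le_exp.2 ?_
  have e : ∑ x', (M x' : ℝ) / N * setSign S x' = (∑ x', (M x' : ℝ) * setSign S x') / N := by
    rw [Finset.sum_div]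
    exact Finset.sum_congr rfl fun x' _ => by ring
  rw [e, lt_sub_iff_add_lt, lt_div_iff₀ hN0] at hlt
  have hε0 : 0 ≤ ε := Real.sqrt_nonneg _
  have := mul_le_mul_of_nonneg_left hlt.le hε0
  change _ ≤ ε * (∑ x', (M x' : ℝ) * setSign S x' - N * ∑ z, P x a z * setSign S z) -
    N * (ε ^ 2 / 2)
  nlinarith

end Empirical
-- The two high-probability events
section Events

variable {X : Type u} {A : Type v} {L : ℕ} {Ω : Type w} [mΩ : MeasurableSpace Ω]
  {traj : ℕ → Ω → Trajectory X A L} {loss : ℕ → Ω → X × A → ℝ}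
  {Λ : Layering X L} {P : X → A → X → ℝ} {π : History X A L → X → A → ℝ} {T : ℕ} {δ : ℝ}
  {μ : Measure Ω} [Fintype X] [DecidableEq X] [Fintype A] [DecidableEq A] [IsProbabilityMeasure μ]

lemma IsInteraction.measureReal_prod_truncFactor_le (h : IsInteraction Λ P π T μ traj loss)
    (hP : IsTransition Λ P) (hπ : ∀ᵐ ω ∂μ, ∀ n < T, IsPolicy (π (history traj loss n ω)))
    {x : X} (hx : Λ.layer x < L) (a : A) {σ : X → ℝ} (hσ : ∀ y, σ y ∈ Set.Icc (-1) 1) (s : ℝ)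
    (N : ℕ) (c : ℝ) :
    μ.real {ω | Real.exp c ≤ ∏ n ∈ Finset.range T, truncFactor Λ P hx a σ s N
      (∑ i ∈ Finset.range n, (traj i ω).visits x a) (traj n ω)} ≤ Real.exp (-c) := by
  refine h.measureReal_prod_ge_le
    (fun n τ ω => truncFactor Λ P hx a σ s N (∑ i ∈ Finset.range n, (traj i ω).visits x a) τ)
    (fun n hn τ => ?_) (fun n τ ω => ?_)
    (B := 1 + ∑ y', Real.exp (s * (σ y' - ∑ z, P x a z * σ z) - s ^ 2 / 2)) (fun n τ ω => ?_)
    (fun n hn => ?_) c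
  · refine (Measurable.of_discrete (f := fun c : ℕ => truncFactor Λ P hx a σ s N c τ)).comp ?_
    refine Finset.measurable_fun_sum _ fun i hi => ?_
    exact (measurable_from_top (f := fun τ : Trajectory X A L => τ.visits x a)).comp
      (measurable_past_traj (Finset.mem_range.1 hi))
  · unfold truncFactor
    split_ifs
    · exact visitFactor_nonneg P x a σ s _ _ _
    · exact zero_le_one
  · unfold truncFactor
    split_ifs
    · exact visitFactor_le P x a σ s _ _ _
    · exact le_add_of_nonneg_right (Finset.sum_nonneg fun _ _ => (Real.exp_pos _).le)
  · filter_upwards [h.condTraj_ae_eq, hπ] with ω hω hπω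
    simp only [hω n hn, truncFactor]
    have hρ := hπω n hn
    -- The marginal of this step has total mass `1`; the weighted sum is compared with it term by
    -- term.
    have h1 := sum_trajProb_mul hP hρ ⟨Λ.layer x, hx⟩ fun _ _ _ => 1
    simp only [mul_one, sum_trajProb hP hρ] at h1
    split_ifs
    · rw [sum_trajProb_mul hP hρ ⟨Λ.layer x, hx⟩ (visitFactor P x a σ s), h1]
      refine Finset.sum_le_sum fun y _ => Finset.sum_le_sum fun b _ => ?_
      simp only [mul_assoc, ← Finset.mul_sum]
      exact mul_le_mul_of_nonneg_left (mul_le_mul_of_nonneg_left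
        (sum_transition_mul_visitFactor_le hP hx hσ s y b) (hρ.nonneg y b))
        (stateOcc_nonneg hP hρ _ y)
    · simp only [mul_one, sum_trajProb hP hρ, le_refl]

/-- From `2 ^ (k + 1) - 1 ≤ 4 ^ k` and `4 * exp (-F) ≤ 1`: all sign patterns together cost no more
than a single `exp (-F)`. -/
lemma two_pow_sub_one_mul_exp_le {F : ℝ} (hF : Real.exp (-F) ≤ 1 / 4) {m : ℕ} (hm : 1 ≤ m) :
    ((2 : ℝ) ^ m - 1) * Real.exp (-(m * F)) ≤ Real.exp (-F) := by
  obtain ⟨k, rfl⟩ : ∃ k, m = k + 1 := ⟨m - 1, by omega⟩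
  have h4 : (2 : ℝ) ^ (k + 1) - 1 ≤ 4 ^ k := by
    clear hm
    induction k with
    | zero => norm_num
    | succ k ih =>
      have : (1 : ℝ) ≤ 4 ^ k := one_le_pow₀ (by norm_num)
      rw [pow_succ, pow_succ 4]
      linarith
  have e : Real.exp (-((k + 1 : ℕ) * F)) = Real.exp (-F) ^ k * Real.exp (-F) := by
    rw [← pow_succ, ← Real.exp_nat_mul]
    congr 1
    ring
  have hp := Real.exp_pos (-F)
  rw [e]
  calc _ ≤ (4 : ℝ) ^ k * (Real.exp (-F) ^ k * Real.exp (-F)) := by gcongr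
    _ = (4 * Real.exp (-F)) ^ k * Real.exp (-F) := by rw [mul_pow]; ring
    _ ≤ 1 * Real.exp (-F) := by
        gcongr
        exact pow_le_one₀ (by positivity) (by linarith)
    _ = _ := one_mul _

/-- With probability at least `1 - δ` the empirical transition functions are always within the
confidence radii of the true transition function. -/
lemma IsInteraction.exists_confidence_event [Nonempty A] (h : IsInteraction Λ P π T μ traj loss)
    (hP : IsTransition Λ P) (hπ : ∀ᵐ ω ∂μ, ∀ n < T, IsPolicy (π (history traj loss n ω)))
    (hT : 0 < T) (hδ0 : 0 < δ) (hδ : δ ≤ 1 / 2) :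
    ∃ B : Set Ω, μ.real B ≤ δ ∧ ∀ᵐ ω ∂μ, ω ∉ B → ∀ m < T, ∀ x a, Λ.layer x < L →
      ∑ x', |P x a x' - ((∑ i ∈ Finset.range m, (traj i ω).visits' x a x' : ℕ) : ℝ) /
        max 1 ((∑ i ∈ Finset.range m, (traj i ω).visits x a : ℕ) : ℝ)| ≤
      confRadius Λ A T δ x (∑ i ∈ Finset.range m, (traj i ω).visits x a) := by
  set F := logFactor X A T δ with hF
  have hlog : 0 ≤ F :=
    (Real.log_nonneg one_le_two).trans (log_two_le_logFactor Λ hT hδ0 (by linarith))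
  have hX : (2 : ℝ) ≤ Fintype.card X := by exact_mod_cast two_le_card Λ
  have hA : (1 : ℝ) ≤ Fintype.card A := Nat.one_le_cast.2 Fintype.card_pos
  have hT1 : (1 : ℝ) ≤ T := by exact_mod_cast hT
  have hTX : (2 : ℝ) ≤ T * Fintype.card X := by nlinarith
  have hTXA : (2 : ℝ) ≤ T * Fintype.card X * Fintype.card A := by nlinarith
  have hexp : Real.exp (-F) = δ / (T * Fintype.card X * Fintype.card A) := by
    rw [hF, logFactor, Real.exp_neg, Real.exp_log (by positivity), inv_div]
  -- Here `δ ≤ 1 / 2` enters, together with the presence of at least two states.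
  have hexp4 : Real.exp (-F) ≤ 1 / 4 := by
    rw [hexp, div_le_div_iff₀ (by linarith) (by norm_num)]
    linarith
  set I : X → Finset (Finset X) := fun x =>
    (Λ.layerSet (Λ.layer x + 1)).powerset.erase (Λ.layerSet (Λ.layer x + 1)) with hI
  set D : X × A → ℕ → Finset X → Set Ω := fun p N S => {ω | ∃ hx : Λ.layer p.1 < L,
    Real.exp ((Λ.layerSet (Λ.layer p.1 + 1)).card * F) ≤
      ∏ n ∈ Finset.range T, truncFactor Λ P hx p.2 (setSign S) (confRadius Λ A T δ p.1 N) N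
        (∑ i ∈ Finset.range n, (traj i ω).visits p.1 p.2) (traj n ω)} with hD
  -- Each pair and each visit number contribute at most `exp (-F) = δ / (T |X| |A|)`, so the union
  -- has probability at most `δ`.
  refine ⟨⋃ p ∈ Finset.univ, ⋃ N ∈ Finset.Icc 1 T, ⋃ S ∈ I p.1, D p N S, ?_, ?_⟩
  · have hDle : ∀ p N, ∑ S ∈ I p.1, μ.real (D p N S) ≤ Real.exp (-F) := by
      intro p N
      by_cases hx : Λ.layer p.1 < L
      · have hm : 1 ≤ (Λ.layerSet (Λ.layer p.1 + 1)).card := card_layerSet_pos Λ (by omega)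
        refine le_trans ?_ (two_pow_sub_one_mul_exp_le hexp4 hm)
        calc _ ≤ ∑ _S ∈ I p.1, Real.exp (-((Λ.layerSet (Λ.layer p.1 + 1)).card * F)) := by
              refine Finset.sum_le_sum fun S _ => ?_
              have := h.measureReal_prod_truncFactor_le hP hπ hx p.2 (setSign_mem_Icc S)
                (confRadius Λ A T δ p.1 N) N ((Λ.layerSet (Λ.layer p.1 + 1)).card * F)
              simpa only [hD, hx, exists_true_left] using this
          _ = _ := by
              rw [Finset.sum_const, nsmul_eq_mul, hI]
              simp only
              rw [Finset.card_erase_of_mem (Finset.mem_powerset_self _), Finset.card_powerset,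
                Nat.cast_sub Nat.one_le_two_pow]
              push_cast
              rfl
      · rw [Finset.sum_eq_zero]
        · exact (Real.exp_pos _).le
        · intro S _
          simp [hD, hx]
    calc _ ≤ ∑ p : X × A, ∑ N ∈ Finset.Icc 1 T, ∑ S ∈ I p.1, μ.real (D p N S) := by
          refine (measureReal_biUnion_finset_le _ _).trans (Finset.sum_le_sum fun p _ => ?_)
          refine (measureReal_biUnion_finset_le _ _).trans (Finset.sum_le_sum fun N _ => ?_)
          exact measureReal_biUnion_finset_le _ _
      _ ≤ ∑ _p : X × A, ∑ _N ∈ Finset.Icc 1 T, Real.exp (-F) :=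
          Finset.sum_le_sum fun p _ => Finset.sum_le_sum fun N _ => hDle p N
      _ = δ := by
          simp only [Finset.sum_const, Finset.card_univ, Fintype.card_prod, Nat.card_Icc,
            nsmul_eq_mul, Nat.add_sub_cancel, hexp]
          push_cast
          field_simp
  · filter_upwards [h.ae_isLayered hP] with ω hlay hω m hm x a hx
    set N := ∑ i ∈ Finset.range m, (traj i ω).visits x a with hN
    by_contra hdev
    rw [not_le] at hdev
    -- Without visits the deviation is `1`, within the radius; only positive visit numbers enter the
    -- union.
    rcases Nat.eq_zero_or_pos N with h0 | h1
    · have hM : ∀ x', ∑ i ∈ Finset.range m, (traj i ω).visits' x a x' = 0 := fun x' =>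
        Nat.le_zero.1 (h0 ▸ hN ▸ Finset.sum_le_sum fun i _ => (traj i ω).visits'_le x a x')
      simp only [hM, Nat.cast_zero, zero_div, sub_zero, abs_of_nonneg (hP.nonneg x a _),
        hP.sum_eq_one x a hx, h0] at hdev
      exact absurd (one_le_confRadius_zero (A := A) hT hδ0 (by linarith) hx) (not_le.2 hdev)
    · obtain ⟨S, hS, hle⟩ := exists_exp_le_prod_truncFactor hP hlog hx a
        (τ := fun n => traj n ω) hlay hm.le hN.symm h1 hdev
      refine hω ?_
      have hNT : N ≤ T := by
        calc N ≤ ∑ _i ∈ Finset.range m, 1 := Finset.sum_le_sum fun i hi =>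
              (hlay i ((Finset.mem_range.1 hi).trans hm)).visits_le_one x a
          _ ≤ T := by simpa using hm.le
      simp only [Set.mem_iUnion]
      exact ⟨(x, a), Finset.mem_univ _, N, Finset.mem_Icc.2 ⟨h1, hNT⟩, S, hS, hx, hle⟩

/-- With probability at least `1 - δ` the expected sum of bounded weights along the trajectories is
close to the observed one. -/
lemma IsInteraction.exists_concentration_event (h : IsInteraction Λ P π T μ traj loss)
    (hP : IsTransition Λ P) (hπ : ∀ᵐ ω ∂μ, ∀ n < T, IsPolicy (π (history traj loss n ω)))
    (hT : 0 < T) (hδ0 : 0 < δ) (hδ1 : δ ≤ 1) (W : ℕ → Ω → X × A → ℝ)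
    (hW : ∀ n < T, ∀ p, Measurable[past traj loss n] fun ω => W n ω p)
    (hW0 : ∀ n ω p, 0 ≤ W n ω p) (hW2 : ∀ n ω p, W n ω p ≤ 2) :
    ∃ B : Set Ω, μ.real B ≤ δ ∧ ∀ᵐ ω ∂μ, ω ∉ B →
      ∑ t ∈ Finset.range T, ∑ p, occ Λ P (π (history traj loss t ω)) p * W t ω p ≤
        ∑ t ∈ Finset.range T, ∑ k : Fin L, W t ω ((traj t ω).state k.castSucc, (traj t ω).action k)
          + L * √(2 * T * Real.log (1 / δ)) := by
  have hL : (0 : ℝ) < L := by exact_mod_cast Λ.pos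
  have hT' : (0 : ℝ) < T := by exact_mod_cast hT
  have hlog : 0 ≤ Real.log (1 / δ) := Real.log_nonneg (by rw [le_div_iff₀ hδ0]; linarith)
  set f : ℕ → Trajectory X A L → Ω → ℝ := fun n τ ω =>
    ∑ k : Fin L, W n ω (τ.state k.castSucc, τ.action k) with hf
  have hf0 : ∀ n τ ω, 0 ≤ f n τ ω := fun n τ ω => Finset.sum_nonneg fun k _ => hW0 n ω _
  have hf2 : ∀ n τ ω, f n τ ω ≤ 2 * L := fun n τ ω => by
    calc f n τ ω ≤ ∑ _k : Fin L, (2 : ℝ) := Finset.sum_le_sum fun k _ => hW2 n ω _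
      _ = 2 * L := by simp [mul_comm]
  -- Built from `condTraj`, so that it is measurable with respect to the past without any
  -- measurability of the chosen policies. The clamping to `[0, 2L]` is almost surely void and makes
  -- the bound on the factors hold everywhere.
  set mean : ℕ → Ω → ℝ := fun n ω =>
    max 0 (min (2 * L) (∑ τ, condTraj traj loss μ n τ ω * f n τ ω)) with hmean
  set ε := L * √(2 * T * Real.log (1 / δ)) with hε
  -- The maximizer of `s * ε - T * (s ^ 2 * L ^ 2 / 2)`; the value of `ε` makes the maximum `log (1
  -- / δ)`. The quadratic term is Hoeffding's for the range `2L`.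
  set s := ε / (T * L ^ 2) with hs
  have hs0 : 0 ≤ s := by positivity
  have hε2 : ε ^ 2 = L ^ 2 * (2 * T * Real.log (1 / δ)) := by
    rw [hε, mul_pow, Real.sq_sqrt (by positivity)]
  have hcs : s * ε - T * (s ^ 2 * L ^ 2 / 2) = Real.log (1 / δ) := by
    have : s * ε - T * (s ^ 2 * L ^ 2 / 2) = ε ^ 2 / (2 * T * L ^ 2) := by
      rw [hs]; field_simp; ring
    rw [this, hε2]
    field_simp
  set g : ℕ → Trajectory X A L → Ω → ℝ := fun n τ ω =>
    Real.exp (s * (mean n ω - f n τ ω) - s ^ 2 * L ^ 2 / 2) with hg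
  have hmean_ae : ∀ᵐ ω ∂μ, ∀ n < T,
      mean n ω = ∑ τ, trajProb Λ P (π (history traj loss n ω)) τ * f n τ ω := by
    filter_upwards [h.condTraj_ae_eq, hπ] with ω hω hπω n hn
    simp only [hmean, hω n hn]
    have hρ := hπω n hn
    rw [min_eq_right, max_eq_right]
    · exact Finset.sum_nonneg fun τ _ => mul_nonneg (trajProb_nonneg hP hρ τ) (hf0 n τ ω)
    · calc _ ≤ ∑ τ, trajProb Λ P (π (history traj loss n ω)) τ * (2 * L) :=
            Finset.sum_le_sum fun τ _ =>
              mul_le_mul_of_nonneg_left (hf2 n τ ω) (trajProb_nonneg hP hρ τ)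
        _ = 2 * L := by rw [← Finset.sum_mul, sum_trajProb hP hρ, one_mul]
  have hfm : ∀ n < T, ∀ τ, Measurable[past traj loss n] (f n τ) := fun n hn τ =>
    Finset.measurable_fun_sum _ fun k _ => hW n hn _
  refine ⟨{ω | Real.exp (Real.log (1 / δ)) ≤ ∏ n ∈ Finset.range T, g n (traj n ω) ω}, ?_, ?_⟩
  · have := h.measureReal_prod_ge_le g (fun n hn τ => ?_) (fun n τ ω => (Real.exp_pos _).le)
      (B := Real.exp (s * (2 * L))) (fun n τ ω => ?_) (fun n hn => ?_) (Real.log (1 / δ))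
    · refine this.trans (le_of_eq ?_)
      rw [Real.exp_neg, Real.exp_log (by positivity), one_div, inv_inv]
    · have hmm : Measurable[past traj loss n] (mean n) := by
        refine measurable_const.max (measurable_const.min ?_)
        exact Finset.measurable_fun_sum _ fun τ _ =>
          (stronglyMeasurable_condExp.measurable).mul (hfm n hn τ)
      exact Real.measurable_exp.comp
        (((hmm.sub (hfm n hn τ)).const_mul s).sub measurable_const)
    · refine Real.exp_le_exp.2 ?_
      have h1 : mean n ω ≤ 2 * L := max_le (by positivity) (min_le_left _ _)
      have h2 := hf0 n τ ω
      have h3 : s * (mean n ω - f n τ ω) ≤ s * (2 * L) :=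
        mul_le_mul_of_nonneg_left (by linarith) hs0
      have h4 : 0 ≤ s ^ 2 * L ^ 2 / 2 := by positivity
      linarith
    · filter_upwards [h.condTraj_ae_eq, hπ, hmean_ae] with ω hω hπω hm
      have hρ := hπω n hn
      simp only [hω n hn, hg, Real.exp_sub, ← mul_div_assoc]
      rw [← Finset.sum_div, div_le_one (Real.exp_pos _)]
      have hh := sum_mul_exp_le (trajProb Λ P (π (history traj loss n ω))) (fun τ => f n τ ω)
        (fun τ => trajProb_nonneg hP hρ τ) (sum_trajProb hP hρ) (b := 2 * L) (by positivity)
        (a := 0) (fun τ => ⟨hf0 n τ ω, by rw [zero_add]; exact hf2 n τ ω⟩) (-s)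
      rw [← hm n hn] at hh
      refine le_trans (le_of_eq ?_) (hh.trans (le_of_eq ?_))
      · exact Finset.sum_congr rfl fun τ _ => by congr 2; ring
      · congr 1; ring
  · filter_upwards [hπ, hmean_ae] with ω hπω hm hω
    simp only [not_le] at hω
    rw [← Real.exp_sum, Real.exp_lt_exp, Finset.sum_sub_distrib, ← Finset.mul_sum,
      Finset.sum_sub_distrib, Finset.sum_const, Finset.card_range, nsmul_eq_mul] at hω
    have e : ∑ t ∈ Finset.range T, mean t ω =
        ∑ t ∈ Finset.range T, ∑ p, occ Λ P (π (history traj loss t ω)) p * W t ω p := by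
      refine Finset.sum_congr rfl fun t ht => ?_
      have ht := Finset.mem_range.1 ht
      rw [hm t ht, ← sum_trajProb_mul_sum hP (hπω t ht) (W t ω)]
    rw [e, ← hcs] at hω
    -- The strict inequality `hω` gives a contradiction also when `s = 0`, that is, for `δ = 1`.
    by_contra hlt
    rw [not_le] at hlt
    have := mul_le_mul_of_nonneg_left (show ε ≤ ∑ t ∈ Finset.range T,
      ∑ p, occ Λ P (π (history traj loss t ω)) p * W t ω p -
        ∑ t ∈ Finset.range T, f t (traj t ω) ω by simp only [hf]; linarith) hs0
    linarith

end Events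

/-- The complement of a measurable hull of the failure set serves as `E`, so neither `B` nor `Q` has
to be measurable. -/
lemma exists_measurableSet_of_ae {Ω : Type w} [MeasurableSpace Ω] {μ : Measure Ω}
    [IsProbabilityMeasure μ] {B : Set Ω} {c : ℝ} (hB : μ.real B ≤ c) {Q : Ω → Prop}
    (h : ∀ᵐ ω ∂μ, ω ∉ B → Q ω) :
    ∃ E : Set Ω, MeasurableSet E ∧ 1 - c ≤ μ.real E ∧ ∀ ω ∈ E, Q ω := by
  refine ⟨(toMeasurable μ {ω | ¬ Q ω})ᶜ, (measurableSet_toMeasurable _ _).compl, ?_,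
    fun ω hω => ?_⟩
  · have h1 : μ {ω | ¬ Q ω} ≤ μ B := measure_mono_ae (by
      filter_upwards [h] with ω hω hQ
      by_contra hB'
      exact hQ (hω hB'))
    have h2 : μ.real {ω | ¬ Q ω} ≤ μ.real B := ENNReal.toReal_mono (measure_ne_top μ B) h1
    rw [probReal_compl_eq_one_sub (measurableSet_toMeasurable _ _), measureReal_def,
      measure_toMeasurable, ← measureReal_def]
    linarith
  · by_contra hQ
    exact hω (subset_toMeasurable μ _ hQ)

/-! ### Application to UC-O-GDPS -/

section Algorithm

variable {X : Type u} {A : Type v} {L : ℕ} {Ω : Type w}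
  {traj : ℕ → Ω → Trajectory X A L} {loss : ℕ → Ω → X × A → ℝ}
  {Λ : Layering X L} {P : X → A → X → ℝ} {C : ℝ} {T : ℕ} {δ : ℝ}
  [Fintype X] [DecidableEq X] [Fintype A] [DecidableEq A]

/-- The counters evolve by a function of themselves and the trajectory, on discrete spaces. The
iterates, chosen by `Classical.epsilon`, play no role. -/
lemma measurable_ucRun_initVisits (n : ℕ) : Measurable[past traj loss n] fun ω =>
    ((ucRun Λ C T δ (fun n => traj n ω) (fun n => loss n ω) n).visits,
      (ucRun Λ C T δ (fun n => traj n ω) (fun n => loss n ω) n).initVisits) := by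
  induction n with
  | zero => exact measurable_const (a := ((fun _ _ => 0, fun _ _ => 0) : (X → A → ℕ) × (X → A → ℕ)))
  | succ n ih =>
    -- The remaining fields are placeholders that do not influence these two counters.
    let s : (X → A → ℕ) × (X → A → ℕ) → UCState X A := fun c =>
      { epoch := 0, visits := c.1, visits' := 0, initVisits := c.2, initVisits' := 0, maxLoss := 0,
        qhat := 0 }
    exact (Measurable.of_discrete
      (f := fun c : ((X → A → ℕ) × (X → A → ℕ)) × Trajectory X A L =>
        (((s c.1).count c.2 0).visits, ((s c.1).count c.2 0).initVisits))).comp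
      ((ih.mono (past_mono n.le_succ) le_rfl).prodMk (measurable_past_traj n.lt_succ_self))

lemma measurable_confWidth_ucRun (n : ℕ) (p : X × A) : Measurable[past traj loss n] fun ω =>
    confWidth Λ T δ (ucRun Λ C T δ (fun n => traj n ω) (fun n => loss n ω) n) p :=
  (Measurable.of_discrete (f := fun c : X → A → ℕ =>
    min 2 (2 * confRadius Λ A T δ p.1 (c p.1 p.2)))).comp
    (measurable_snd.comp (measurable_ucRun_initVisits n))

lemma ucogdps_history (n : ℕ) (ω : Ω) : ucogdps Λ C T δ (history traj loss n ω) =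
    inducedPolicy (ucRun Λ C T δ (fun n => traj n ω) (fun n => loss n ω) n).qhat := by
  rw [ucogdps, ucState_history]

lemma played_eq_ucPlayed (ω : Ω) : played Λ P (ucogdps Λ C T δ) traj loss ω =
    ucPlayed Λ C T δ P (fun n => traj n ω) (fun n => loss n ω) := by
  funext t
  rw [played, ucogdps_history, ucPlayed]

variable [mΩ : MeasurableSpace Ω] {μ : Measure Ω} [IsProbabilityMeasure μ]

/-- With probability at least `1 - 2δ` the confidence sets contain the true transition function,
and the regret bound holds. -/
lemma exists_event [Nonempty A] (hC : 0 < C) (hP : IsTransition Λ P) (hδ0 : 0 < δ) (hδ1 : δ ≤ 1)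
    (h : IsInteraction Λ P (ucogdps Λ C T δ) T μ traj loss) :
    ∃ E : Set Ω, MeasurableSet E ∧ 1 - 2 * δ ≤ μ.real E ∧ ∀ ω ∈ E,
      (∀ n < T, P ∈ (ucState Λ C T δ (history traj loss n ω)).confSet Λ T δ) ∧
      ∀ t₁ t₂ : ℕ, t₁ ≤ t₂ → t₂ < T → ∀ q ∈ commonPolytope Λ C T δ traj loss ω,
        intervalRegret (fun t => loss t ω) (played Λ P (ucogdps Λ C T δ) traj loss ω) t₁ t₂ q ≤
          lossMax (fun t => loss t ω) t₁ t₂ * estimationError X A L T δ +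
            lossMax (fun t => loss t ω) 0 t₂ * L * C * √T +
            lossMax (fun t => loss t ω) t₁ t₂ * ((Fintype.card X : ℝ) * Fintype.card A / 2) *
              (((t₂ : ℝ) - t₁ + 1) / (C * √T)) := by
  rcases Nat.eq_zero_or_pos T with rfl | hT
  · exact ⟨Set.univ, MeasurableSet.univ, by simpa using hδ0.le,
      fun ω _ => ⟨fun n hn => absurd hn (by omega), fun _ _ _ ht => absurd ht (by omega)⟩⟩
  -- For `δ > 1 / 2` the required probability is negative and the empty event suffices.
  rcases lt_or_ge (1 / 2) δ with hδ | hδ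
  · exact ⟨∅, MeasurableSet.empty, by simp; linarith, fun ω hω => absurd hω (Set.notMem_empty ω)⟩
  have hπ : ∀ᵐ ω ∂μ, ∀ n < T, IsPolicy (ucogdps Λ C T δ (history traj loss n ω)) := by
    filter_upwards [h.ae_isLayered hP] with ω hlay n hn
    rw [ucogdps_history]
    exact isPolicy_inducedPolicy_ucRun hT hδ0 hδ1 hlay hn
  obtain ⟨B₁, hB₁, h₁⟩ := h.exists_confidence_event hP hπ hT hδ0 hδ
  obtain ⟨B₂, hB₂, h₂⟩ := h.exists_concentration_event hP hπ hT hδ0 hδ1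
    (fun n ω => confWidth Λ T δ (ucRun Λ C T δ (fun n => traj n ω) (fun n => loss n ω) n))
    (fun n _ p => measurable_confWidth_ucRun n p) (fun _ _ p => confWidth_nonneg _ p)
    (fun _ _ p => confWidth_le_two _ p)
  refine exists_measurableSet_of_ae (B := B₁ ∪ B₂)
    ((measureReal_union_le _ _).trans (by linarith)) ?_
  filter_upwards [h.ae_isLayered hP, h₁, h₂] with ω hlay hω₁ hω₂ hω
  have hconf : ∀ n < T, P ∈ (ucRun Λ C T δ (fun n => traj n ω) (fun n => loss n ω) n).confSet
      Λ T δ := fun n hn =>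
    mem_confSet_of_forall hP hlay (hω₁ fun hB => hω (Or.inl hB)) hn
  refine ⟨fun n hn => by rw [ucState_history]; exact hconf n hn, fun t₁ t₂ ht htT q hq => ?_⟩
  rw [played_eq_ucPlayed]
  have hconc := hω₂ fun hB => hω (Or.inr hB)
  simp only [ucogdps_history] at hconc
  refine intervalRegret_ucPlayed_le hC hT hδ0 hδ1 hlay hconf hconc (fun n hn => ?_) ht htT
  rw [← ucState_history]
  exact hq n hn

end Algorithm
end LoopFreeMDP

theorem mainTheorem5 {X : Type u} {A : Type v} [Fintype X] [DecidableEq X] [Fintype A]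
    [DecidableEq A] [Nonempty A] {L : ℕ} (Λ : LoopFreeMDP.Layering X L) (C : ℝ) (hC : 0 < C) :
    (∀ (T : ℕ) (δ : ℝ), 0 < δ → δ ≤ 1 →
      ∀ P : X → A → X → ℝ, LoopFreeMDP.IsTransition Λ P →
      ∀ (Ω : Type w) [MeasurableSpace Ω] (μ : Measure Ω) [IsProbabilityMeasure μ]
        (traj : ℕ → Ω → LoopFreeMDP.Trajectory X A L) (loss : ℕ → Ω → X × A → ℝ),
        LoopFreeMDP.IsInteraction Λ P (LoopFreeMDP.ucogdps Λ C T δ) T μ traj loss →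
        ∃ E : Set Ω, MeasurableSet E ∧ 1 - 2 * δ ≤ μ.real E ∧
          ∀ ω ∈ E, ∀ t₁ t₂ : ℕ, t₁ ≤ t₂ → t₂ < T →
            ∀ q ∈ LoopFreeMDP.commonPolytope Λ C T δ traj loss ω,
              LoopFreeMDP.intervalRegret (fun t => loss t ω)
                  (LoopFreeMDP.played Λ P (LoopFreeMDP.ucogdps Λ C T δ) traj loss ω) t₁ t₂ q ≤
                LoopFreeMDP.lossMax (fun t => loss t ω) t₁ t₂ *
                    LoopFreeMDP.estimationError X A L T δ +
                  LoopFreeMDP.lossMax (fun t => loss t ω) 0 t₂ * L * C * √T +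
                  LoopFreeMDP.lossMax (fun t => loss t ω) t₁ t₂ *
                    ((Fintype.card X : ℝ) * Fintype.card A / 2) *
                    (((t₂ : ℝ) - t₁ + 1) / (C * √T))) ∧
    LoopFreeMDP.WeakNoIntervalRegret.{u, v, w} Λ (LoopFreeMDP.ucogdps (A := A) Λ C) := by
  open LoopFreeMDP in
  refine ⟨fun T δ hδ0 hδ1 P hP Ω _ μ _ traj loss h => ?_, ?_⟩
  · obtain ⟨E, hE, hμE, hω⟩ := exists_event hC hP hδ0 hδ1 h
    exact ⟨E, hE, hμE, fun ω hωE => (hω ω hωE).2⟩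
  · have : Nonempty X := ⟨Λ.first_unique.choose⟩
    obtain ⟨K, hK⟩ := exists_regret_bound_le X A L hC
    refine ⟨K, 1, fun T δ hδ0 hδ1 P hP Ω _ μ _ traj loss h => ?_⟩
    obtain ⟨E, hE, hμE, hω⟩ := exists_event hC hP hδ0 hδ1 h
    refine ⟨E, hE, hμE, fun ω hωE t₁ t₂ ht htT q hq => ?_⟩
    obtain ⟨hconf, hreg⟩ := hω ω hωE
    -- On `E` the true `P` belongs to every confidence set, so the valid occupancy measures are
    -- admissible comparators.
    have hqc : q ∈ commonPolytope Λ C T δ traj loss ω := fun n hn => by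
      obtain ⟨P', hP', π, hπ, rfl⟩ := hq
      rw [Set.mem_singleton_iff.1 hP']
      exact ⟨P, hconf n hn, π, hπ, rfl⟩
    exact (hreg t₁ t₂ ht htT q hqc).trans (hK T δ hδ0 hδ1 t₁ t₂ ht htT _ _ _
      (lossMax_nonneg _ _ _) (lossMax_le_lossMax _ (Nat.zero_le _) (by omega))
      (lossMax_le_lossMax _ le_rfl (by omega)))
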